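/- Let $\Bbbk$ be an algebraically closed field, let $(T,R)$ be a finite-dimensional quasitriangular Hopf algebra over $\Bbbk$, $R=R^1\otimes R^2$, and give $\operatorname{Rep}(T)$ (finite-dimensional modules) the braiding $v\otimes w\mapsto R^2\cdot w\otimes R^1\cdot v$. Let $H$ be a finite-dimensional Hopf algebra in the braided category $\operatorname{Rep}(T)$, and let $B=H\#T$ be its bosonization: $B=H\otimes T$ as a vector space, with $$(h\#t)(y\#r)=h(t_1\cdot y)\#t_2r,\qquad \Delta(h\#t)=(h_1\#R^2t_1)\otimes(R^1\cdot h_2\#t_2),$$ and $\pi:B\to T$, $\pi(h\#t)=\varepsilon(h)t$. Let $K$ be a finite-dimensional left $B$-comodule algebra, with coaction $\kappa\mapsto\kappa_{-1}\otimes\kappa_0\in B\otimes K$, that is right simple: $K\neq0$ and $K$ has no right ideal $J\neq 0,K$ with $J\ni\kappa\Rightarrow\kappa_{-1}\otimes\kappa_0\in B\otimes J$. *The relative centre.* Let $G:\operatorname{Rep}(T)\to\mathcal Z(\operatorname{Rep}(B))$ be the monoidal functor $G(V)=(V_\pi,\sigma^V)$, where $V_\pi$ is $V$ with the action of $B$ through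 $\pi$ and $\sigma^V_W:V\otimes W\to W\otimes V$ is the inverse of $w\otimes v\mapsto R^2\cdot v\otimes(1\#R^1)\cdot w$. Let $\mathcal Z^{\operatorname{Rep}(T)}(\operatorname{Rep}(B))$ be the full subcategory of those objects of $\mathcal Z(\operatorname{Rep}(B))$ whose double braiding with $G(V)$ is the identity for all $V$. *The algebra $A_{\operatorname{Rep}(T),{}_K\mathcal M}$.* Let ${}_K\mathcal M$ be the category of finite-dimensional left $K$-modules. It is a left $\operatorname{Rep}(B)$-module category by $X\otimes M$ with $\kappa\cdot(x\otimes m)=\kappa_{-1}\cdot x\otimes\kappa_0\cdot m$, and a left $\operatorname{Rep}(T)$-module category through $G$. Its internal Homs are $\underline{\operatorname{Hom}}(M,N)=\operatorname{Hom}_K(B\otimes M,N)$ with $(h\cdot\alpha)(g\otimes m)=\alpha(gh\otimes m)$. For $V\in\operatorname{Rep}(T)$ let $$\beta^V_{M,N}:\underline{\operatorname{Hom}}(M,V\otimes N)\to\underline{\operatorname{Hom}}(V^*\otimes M,N)$$ be the map that corresponds under the adjunctions to sending $f:X\otimes M\to V\otimes N$ to the composite $$X\otimes V^*\otimes M\xrightarrow{(\sigma^{V^*}_X)^{-1}\otimes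 M}V^*\otimes X\otimes M\xrightarrow{V^*\otimes f}V^*\otimes V\otimes N\xrightarrow{\operatorname{ev}_V\otimes N}N.$$ The relative end $A=A_{\operatorname{Rep}(T),{}_K\mathcal M}=\oint_M\underline{\operatorname{Hom}}(M,M)$ is the object of $\operatorname{Rep}(B)$ that is universal with a dinatural family $\pi_M:A\to\underline{\operatorname{Hom}}(M,M)$ such that $\underline{\operatorname{Hom}}(\operatorname{ev}_V\otimes M,M)\,\pi_M=\beta^V_{V\otimes M,M}\,\pi_{V\otimes M}$ for all $V$ and $M$. It is an algebra in $\mathcal Z(\operatorname{Rep}(B))$: its half-braiding $\sigma_X:A\otimes X\to X\otimes A$ is determined by the commutativity, for all $X$ and $M$, of $$A\otimes X\xrightarrow{\pi_{X\otimes M}\otimes X}\underline{\operatorname{Hom}}(X\otimes M,X\otimes M)\otimes X\xrightarrow{\;\mathfrak b\;}\underline{\operatorname{Hom}}(M,X\otimes M)$$ with $$A\otimes X\xrightarrow{\sigma_X}X\otimes A\xrightarrow{X\otimes\pi_M}X\otimes\underline{\operatorname{Hom}}(M,M)\xrightarrow{\;\mathfrak a^{-1}\;}\underline{\operatorname{Hom}}(M,X\otimes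 M),$$ where $\mathfrak b$ and $\mathfrak a^{-1}$ correspond under the adjunction to the evaluations; and the $\pi_M$ are compatible with the unit of $A$ and with the multiplication of $A$ and the composition of $\underline{\operatorname{Hom}}(M,M)$. *The algebra $S^T(H,K)$.* It is the space of the linear maps $\alpha:B\otimes K\to K$ such that 1. $\alpha(\kappa_{-1}x\otimes\kappa_0l)=\kappa\,\alpha(x\otimes l)$ for all $x\in B$ and $\kappa,l\in K$; 2. $\alpha(x\otimes\kappa)=\alpha(x\otimes1)\kappa$ for all $x\in B$ and $\kappa\in K$; 3. $\alpha$ is $T$-colinear for the coactions $x\otimes\kappa\mapsto R^2\pi(\kappa_{-1})\otimes\big((1\#R^1)x\otimes\kappa_0\big)$ of $B\otimes K$ and $\kappa\mapsto\pi(\kappa_{-1})\otimes\kappa_0$ of $K$ (given 2, this says that $R^2\otimes\alpha((1\#R^1)x\otimes1)=\pi(\alpha(x\otimes1)_{-1})\otimes\alpha(x\otimes1)_0$ for all $x\in B$). It carries the action $(h\cdot\alpha)(x\otimes\kappa)=\alpha(xh\otimes\kappa)$ of $B$, the half-braiding $\alpha\otimes y\mapsto\alpha_{-1}\cdot y\otimes\alpha_0$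 of the coaction determined by $$\alpha_{-1}\otimes\alpha_0(x\otimes\kappa)=\mathcal S(x_1)\,\alpha(x_2\otimes1)_{-1}\,x_3\otimes\alpha(x_2\otimes1)_0\,\kappa ,$$ the product $(\alpha\beta)(x\otimes\kappa)=\alpha(x_1\otimes\beta(x_2\otimes\kappa))$ and the unit $x\otimes\kappa\mapsto\varepsilon(x)\kappa$. Then the following hold. (i) The algebras $A_{\operatorname{Rep}(T),{}_K\mathcal M}$ and $S^T(H,K)$ in $\mathcal Z(\operatorname{Rep}(H\#T))$, with the structures described above, exist, and they are isomorphic as algebras in $\mathcal Z(\operatorname{Rep}(H\#T))$. (ii) $S^T(H,K)$ lies in $\mathcal Z^{\operatorname{Rep}(T)}(\operatorname{Rep}(H\#T))$ and is a (braided) commutative algebra there. -/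

import Mathlib

open TensorProduct CategoryTheory MonoidalCategory

universe u

namespace CentralHopf

/-! ### Quasitriangular Hopf algebras, braided Hopf algebras, bosonization -/

/-- A universal `R`-matrix on the Hopf algebra `T`.  Elements of `T ⊗ T ⊗ T` live in
`T ⊗ (T ⊗ T)`; there `R₁₃`, `R₂₃`, `R₁₂` are the images of `R` under
`a ⊗ b ↦ a ⊗ (1 ⊗ b)`, `a ⊗ b ↦ 1 ⊗ (a ⊗ b)`, `a ⊗ b ↦ a ⊗ (b ⊗ 1)`. -/
structure RMatrix (k : Type u) [Field k] (T : Type u) [Ring T] [HopfAlgebra k T] where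
  R : (T ⊗[k] T)ˣ
  comul_left : TensorProduct.assoc k T T T
      (Algebra.TensorProduct.map (Bialgebra.comulAlgHom k T) (AlgHom.id k T) (R : T ⊗[k] T)) =
    Algebra.TensorProduct.map (AlgHom.id k T) Algebra.TensorProduct.includeRight (R : T ⊗[k] T) *
      ((1 : T) ⊗ₜ[k] (R : T ⊗[k] T))
  comul_right :
      Algebra.TensorProduct.map (AlgHom.id k T) (Bialgebra.comulAlgHom k T) (R : T ⊗[k] T) =
    Algebra.TensorProduct.map (AlgHom.id k T) Algebra.TensorProduct.includeRight (R : T ⊗[k] T) *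
      Algebra.TensorProduct.map (AlgHom.id k T) Algebra.TensorProduct.includeLeft
        (R : T ⊗[k] T)
  counit_left : TensorProduct.lid k T
      ((Coalgebra.counit (R := k) (A := T)).rTensor T (R : T ⊗[k] T)) = 1
  counit_right : TensorProduct.rid k T
      ((Coalgebra.counit (R := k) (A := T)).lTensor T (R : T ⊗[k] T)) = 1
  quasi_cocomm : ∀ t : T,
    TensorProduct.comm k T T (Coalgebra.comul t) * (R : T ⊗[k] T) =
      (R : T ⊗[k] T) * Coalgebra.comul t

section Boson

variable {k : Type u} [Field k] {T : Type u} [Ring T] [HopfAlgebra k T]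

/-- The braiding `σ(v ⊗ w) = R² · w ⊗ R¹ · v` of two representations of `T`, where
`𝓡 = R¹ ⊗ R²`, as a map `V ⊗ W → W ⊗ V`. -/
noncomputable def RMatrix.braid (𝓡 : RMatrix k T) {V W : Type u}
    [AddCommGroup V] [Module k V] [AddCommGroup W] [Module k W]
    (ρV : T →ₐ[k] Module.End k V) (ρW : T →ₐ[k] Module.End k W) :
    V ⊗[k] W →ₗ[k] W ⊗[k] V :=
  (TensorProduct.comm k V W).toLinearMap ∘ₗ
    Module.endTensorEndAlgHom (R := k) (S := k) (A := k)
      (Algebra.TensorProduct.map ρV ρW (𝓡.R : T ⊗[k] T))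

/-- A Hopf algebra in the braided category of representations of the quasitriangular Hopf algebra
`(T, 𝓡)`: an algebra and coalgebra `H` with an action of `T` for which all structure maps are
`T`-linear, the coproduct being multiplicative for the braided product on `H ⊗ H`. -/
class BraidedHopfAlgebra (𝓡 : RMatrix k T) (H : Type u) [Ring H] [Algebra k H]
    [Coalgebra k H] where
  act : T →ₐ[k] Module.End k H
  act_mul : ∀ (t : T) (x y : H), act t (x * y) =
    LinearMap.mul' k H (Module.endTensorEndAlgHom (R := k) (S := k) (A := k)
      (Algebra.TensorProduct.map act act (Coalgebra.comul (R := k) t)) (x ⊗ₜ[k] y))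
  act_one : ∀ t : T, act t 1 = Coalgebra.counit (R := k) t • (1 : H)
  comul_act : ∀ (t : T) (x : H), Coalgebra.comul (R := k) (act t x) =
    Module.endTensorEndAlgHom (R := k) (S := k) (A := k)
      (Algebra.TensorProduct.map act act (Coalgebra.comul (R := k) t)) (Coalgebra.comul x)
  counit_act : ∀ (t : T) (x : H), Coalgebra.counit (R := k) (act t x) =
    Coalgebra.counit (R := k) t * Coalgebra.counit (R := k) x
  comul_one : Coalgebra.comul (R := k) (1 : H) = 1 ⊗ₜ[k] 1
  counit_one : Coalgebra.counit (R := k) (1 : H) = 1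
  counit_mul : ∀ x y : H, Coalgebra.counit (R := k) (x * y) =
    Coalgebra.counit (R := k) x * Coalgebra.counit (R := k) y
  /-- `Δ(x y) = x₁ (R² · y₁) ⊗ (R¹ · x₂) y₂`. -/
  comul_mul : ∀ x y : H, Coalgebra.comul (R := k) (x * y) =
    (TensorProduct.map (LinearMap.mul' k H) (LinearMap.mul' k H) ∘ₗ
      (TensorProduct.assoc k H H (H ⊗[k] H)).symm.toLinearMap ∘ₗ
      (TensorProduct.map LinearMap.id
        ((TensorProduct.assoc k H H H).toLinearMap ∘ₗ
          TensorProduct.map (𝓡.braid act act) LinearMap.id ∘ₗ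
          (TensorProduct.assoc k H H H).symm.toLinearMap)) ∘ₗ
      (TensorProduct.assoc k H H (H ⊗[k] H)).toLinearMap)
      (Coalgebra.comul (R := k) x ⊗ₜ[k] Coalgebra.comul (R := k) y)
  antipode : H →ₗ[k] H
  antipode_act : ∀ (t : T) (x : H), antipode (act t x) = act t (antipode x)
  mul_antipode_left : ∀ x : H, LinearMap.mul' k H (antipode.rTensor H
    (Coalgebra.comul (R := k) x)) = Coalgebra.counit (R := k) x • 1
  mul_antipode_right : ∀ x : H, LinearMap.mul' k H (antipode.lTensor H
    (Coalgebra.comul (R := k) x)) = Coalgebra.counit (R := k) x • 1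

end Boson
end CentralHopf

set_option linter.unusedVariables false
set_option linter.unusedSectionVars false

namespace CentralHopf
section Boson

variable {k : Type u} [Field k] {T : Type u} [Ring T] [HopfAlgebra k T]

namespace BraidedHopfAlgebra

variable (𝓡 : RMatrix k T) {H : Type u} [Ring H] [Algebra k H] [Coalgebra k H]
  [BraidedHopfAlgebra 𝓡 H]

/-- The orbit map `t ↦ t · y`. -/
noncomputable def orb (y : H) : T →ₗ[k] H := (act (𝓡 := 𝓡) (H := H)).toLinearMap.flip y

@[simp] lemma orb_apply (y : H) (t : T) : orb 𝓡 y t = act (𝓡 := 𝓡) t y := rfl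

open Coalgebra in
lemma act_mul_sum (t : T) (x y : H) : act (𝓡 := 𝓡) t (x * y) =
    ∑ i ∈ (ℛ k t).index, act (𝓡 := 𝓡) ((ℛ k t).left i) x * act (𝓡 := 𝓡) ((ℛ k t).right i) y := by
  rw [act_mul, ← (ℛ k t).eq]
  simp [Module.endTensorEndAlgHom_apply]

open Coalgebra in
lemma comul_act_sum (t : T) (x : H) : comul (R := k) (act (𝓡 := 𝓡) t x) =
    ∑ i ∈ (ℛ k t).index, ∑ j ∈ (ℛ k x).index,
      act (𝓡 := 𝓡) ((ℛ k t).left i) ((ℛ k x).left j) ⊗ₜ[k]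
        act (𝓡 := 𝓡) ((ℛ k t).right i) ((ℛ k x).right j) := by
  rw [comul_act, ← (ℛ k t).eq, ← (ℛ k x).eq, Finset.sum_comm]
  simp [Module.endTensorEndAlgHom_apply]

/-- Two algebra maps `f : H → A`, `g : T → A` satisfy `g(t) f(y) = f(t₁ · y) g(t₂)`. -/
def Covariant {A : Type u} [Ring A] [Algebra k A] (f : H →ₗ[k] A) (g : T →ₐ[k] A) : Prop :=
  ∀ (t : T) (y : H), g t * f y = LinearMap.mul' k A
    (TensorProduct.map (f ∘ₗ orb 𝓡 y) g.toLinearMap (Coalgebra.comul (R := k) t))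

open Coalgebra in
/-- The action of `T` on `H ⊗ T` by `t · (y ⊗ r) = t₁ · y ⊗ t₂ r`. -/
noncomputable def opT : T →ₐ[k] Module.End k (H ⊗[k] T) :=
  ((Module.endTensorEndAlgHom (R := k) (S := k) (A := k)).comp
    (Algebra.TensorProduct.map (act (𝓡 := 𝓡) (H := H)) (Algebra.lmul k T))).comp
    (Bialgebra.comulAlgHom k T)

/-- The action of `H` on `H ⊗ T` by left multiplication on the first factor. -/
noncomputable def opH (_ : RMatrix k T) : H →ₐ[k] Module.End k (H ⊗[k] T) :=
  ((Module.endTensorEndAlgHom (R := k) (S := k) (A := k)).comp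
    (Algebra.TensorProduct.includeLeft)).comp (Algebra.lmul k H)

@[simp] lemma opH_tmul (h y : H) (r : T) : opH 𝓡 h (y ⊗ₜ[k] r) = (h * y) ⊗ₜ[k] r := by
  simp [opH, Module.endTensorEndAlgHom_apply]

lemma opT_tmul (t : T) (y : H) (r : T) : opT 𝓡 t (y ⊗ₜ[k] r) =
    TensorProduct.map (orb 𝓡 y) (LinearMap.mulRight k r) (Coalgebra.comul (R := k) t) := by
  simp only [opT, AlgHom.comp_apply, Bialgebra.comulAlgHom_apply]
  induction Coalgebra.comul (R := k) t using TensorProduct.induction_on with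
  | zero => simp
  | tmul a b => simp [Module.endTensorEndAlgHom_apply]
  | add a b ha hb => simp only [map_add, LinearMap.add_apply, ha, hb]

open Coalgebra in
lemma opT_tmul_sum (t : T) (y : H) (r : T) : opT 𝓡 t (y ⊗ₜ[k] r) =
    ∑ i ∈ (ℛ k t).index, act (𝓡 := 𝓡) ((ℛ k t).left i) y ⊗ₜ[k] ((ℛ k t).right i * r) := by
  rw [opT_tmul]; conv_lhs => rw [← (ℛ k t).eq]
  simp

open Coalgebra in
lemma opT_opH : Covariant 𝓡 (opH (H := H) 𝓡).toLinearMap (opT 𝓡) := by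
  intro t y
  ext z s
  conv_rhs => rw [← (ℛ k t).eq]
  simp only [Module.End.mul_apply, AlgHom.toLinearMap_apply, TensorProduct.AlgebraTensorModule.curry_apply,
    LinearMap.restrictScalars_self, TensorProduct.curry_apply, opH_tmul, opT_tmul_sum, map_sum,
    TensorProduct.map_tmul, LinearMap.mul'_apply, LinearMap.sum_apply, LinearMap.comp_apply, orb_apply]
  simp only [act_mul_sum, TensorProduct.sum_tmul]
  -- coassociativity
  let Φ : T ⊗[k] (T ⊗[k] T) →ₗ[k] H ⊗[k] T :=
    TensorProduct.map (LinearMap.mul' k H) (LinearMap.id) ∘ₗ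
    (TensorProduct.assoc k H H T).symm.toLinearMap ∘ₗ
    TensorProduct.map (orb 𝓡 y) (TensorProduct.map (orb 𝓡 z) (LinearMap.mulRight k s))
  have h := congrArg Φ (sum_tmul_tmul_eq (ℛ k t) (fun i => ℛ k ((ℛ k t).left i)) (fun i => ℛ k ((ℛ k t).right i)))
  simpa [Φ] using h

end BraidedHopfAlgebra
end Boson
end CentralHopf

namespace CentralHopf
section Boson

variable {k : Type u} [Field k] {T : Type u} [Ring T] [HopfAlgebra k T]

/-- The bosonization `H # T`; its elements are those of `H ⊗ T`. -/
def Bosonization (_ : RMatrix k T) (H : Type u) [Ring H] [Algebra k H] : Type u := H ⊗[k] T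

namespace Bosonization

open BraidedHopfAlgebra

variable (𝓡 : RMatrix k T) {H : Type u} [Ring H] [Algebra k H]

noncomputable instance : AddCommGroup (Bosonization 𝓡 H) :=
  inferInstanceAs (AddCommGroup (H ⊗[k] T))

noncomputable instance : Module k (Bosonization 𝓡 H) :=
  inferInstanceAs (Module k (H ⊗[k] T))

/-- The identification of `H # T` with `H ⊗ T`. -/
noncomputable def equiv : Bosonization 𝓡 H ≃ₗ[k] H ⊗[k] T := LinearEquiv.refl k (H ⊗[k] T)

/-- The element `h # t`. -/
noncomputable def mk (h : H) (t : T) : Bosonization 𝓡 H := (equiv 𝓡).symm (h ⊗ₜ[k] t)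

@[simp] lemma equiv_mk (h : H) (t : T) : equiv 𝓡 (mk 𝓡 h t) = h ⊗ₜ[k] t := rfl

@[simp] lemma equiv_symm_tmul (h : H) (t : T) : (equiv 𝓡).symm (h ⊗ₜ[k] t) = mk 𝓡 h t := rfl

variable [Coalgebra k H] [BraidedHopfAlgebra 𝓡 H]

/-- Left multiplication by `h # t` is `y # r ↦ h (t₁ · y) # t₂ r`. -/
noncomputable def opMul : H ⊗[k] T →ₗ[k] Module.End k (H ⊗[k] T) :=
  LinearMap.mul' k _ ∘ₗ TensorProduct.map (opH 𝓡).toLinearMap (opT 𝓡).toLinearMap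

@[simp] lemma opMul_tmul (h : H) (t : T) :
    opMul 𝓡 (h ⊗ₜ[k] t) = opH 𝓡 h * opT 𝓡 t := by
  simp [opMul]

open Coalgebra in
lemma opMul_opMul (x y : H ⊗[k] T) :
    opMul 𝓡 (opMul 𝓡 x y) = opMul 𝓡 x * opMul 𝓡 y := by
  induction x using TensorProduct.induction_on with
  | zero => simp
  | add a b ha hb => simp only [map_add, LinearMap.add_apply, ha, hb, add_mul]
  | tmul h t =>
    induction y using TensorProduct.induction_on with
    | zero => simp
    | add a b ha hb => simp only [map_add, ha, hb, mul_add]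
    | tmul y r =>
      have h1 : opT 𝓡 t * opH 𝓡 y = _ := opT_opH 𝓡 t y
      rw [← (ℛ k t).eq] at h1
      simp only [map_sum, TensorProduct.map_tmul, LinearMap.mul'_apply, LinearMap.comp_apply,
        AlgHom.toLinearMap_apply, orb_apply] at h1
      rw [opMul_tmul, opMul_tmul, Module.End.mul_apply, opT_tmul_sum, mul_assoc,
        ← mul_assoc (opT 𝓡 t), h1]
      simp [Finset.sum_mul, Finset.mul_sum, mul_assoc]

lemma opMul_one (y : H ⊗[k] T) : opMul 𝓡 ((1 : H) ⊗ₜ[k] (1 : T)) y = y := by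
  simp

open Coalgebra in
lemma opMul_apply_one (x : H ⊗[k] T) : opMul 𝓡 x ((1 : H) ⊗ₜ[k] (1 : T)) = x := by
  induction x using TensorProduct.induction_on with
  | zero => simp
  | add a b ha hb => simp only [map_add, LinearMap.add_apply, ha, hb]
  | tmul h t =>
    rw [opMul_tmul, Module.End.mul_apply, opT_tmul_sum]
    simp only [act_one, mul_one, opH_tmul, TensorProduct.smul_tmul,
      ← TensorProduct.tmul_sum, sum_counit_smul]

noncomputable instance : Ring (Bosonization 𝓡 H) where
  __ := (inferInstance : AddCommGroup (Bosonization 𝓡 H))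
  mul x y := (equiv 𝓡).symm (opMul 𝓡 (equiv 𝓡 x) (equiv 𝓡 y))
  one := mk 𝓡 1 1
  mul_assoc x y z := by
    change (equiv 𝓡).symm (opMul 𝓡 (opMul 𝓡 (equiv 𝓡 x) (equiv 𝓡 y)) (equiv 𝓡 z)) =
      (equiv 𝓡).symm (opMul 𝓡 (equiv 𝓡 x) (opMul 𝓡 (equiv 𝓡 y) (equiv 𝓡 z)))
    rw [opMul_opMul, Module.End.mul_apply]
  one_mul x := opMul_one 𝓡 (equiv 𝓡 x)
  mul_one x := opMul_apply_one 𝓡 (equiv 𝓡 x)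
  left_distrib x y z := map_add (opMul 𝓡 (equiv 𝓡 x)) _ _
  right_distrib x y z := by
    change opMul 𝓡 (equiv 𝓡 x + equiv 𝓡 y) (equiv 𝓡 z) = _
    rw [map_add]; rfl
  zero_mul x := by
    change opMul 𝓡 0 (equiv 𝓡 x) = 0
    rw [map_zero]; rfl
  mul_zero x := map_zero (opMul 𝓡 (equiv 𝓡 x))

noncomputable instance : Algebra k (Bosonization 𝓡 H) :=
  Algebra.ofModule
    (fun r x y => by
      change opMul 𝓡 (r • equiv 𝓡 x) (equiv 𝓡 y) = _
      rw [map_smul]; rfl)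
    (fun r x y => map_smul (opMul 𝓡 (equiv 𝓡 x)) r (equiv 𝓡 y))

lemma one_def : (1 : Bosonization 𝓡 H) = mk 𝓡 1 1 := rfl

lemma equiv_mul (x y : Bosonization 𝓡 H) :
    equiv 𝓡 (x * y) = opMul 𝓡 (equiv 𝓡 x) (equiv 𝓡 y) := rfl

open Coalgebra in
/-- The product formula `(h # t)(y # r) = h (t₁ · y) # t₂ r`. -/
lemma mk_mul_mk (h y : H) (t r : T) : mk 𝓡 h t * mk 𝓡 y r =
    ∑ i ∈ (ℛ k t).index,
      mk 𝓡 (h * act (𝓡 := 𝓡) ((ℛ k t).left i) y) ((ℛ k t).right i * r) := by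
  apply (equiv 𝓡).injective
  rw [equiv_mul]
  simp [opT_tmul_sum]

/-- The inclusion `h ↦ h # 1`. -/
noncomputable def inH : H →ₐ[k] Bosonization 𝓡 H :=
  AlgHom.ofLinearMap ((equiv 𝓡).symm.toLinearMap ∘ₗ (TensorProduct.mk k H T).flip 1)
    rfl (fun x y => by apply (equiv 𝓡).injective; rw [equiv_mul]; simp)

/-- The inclusion `t ↦ 1 # t`. -/
noncomputable def inT : T →ₐ[k] Bosonization 𝓡 H :=
  AlgHom.ofLinearMap ((equiv 𝓡).symm.toLinearMap ∘ₗ TensorProduct.mk k H T 1)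
    rfl (fun x y => by
      apply (equiv 𝓡).injective; rw [equiv_mul]
      have h := opMul_apply_one 𝓡 ((1 : H) ⊗ₜ[k] x)
      rw [opMul_tmul, Module.End.mul_apply, map_one, Module.End.one_apply] at h
      simp only [LinearMap.comp_apply, LinearEquiv.coe_coe, TensorProduct.mk_apply,
        equiv_symm_tmul, equiv_mk, opMul_tmul, map_one, one_mul]
      have e : (1 : H) ⊗ₜ[k] y = TensorProduct.map LinearMap.id (LinearMap.mulRight k y)
        ((1 : H) ⊗ₜ[k] (1 : T)) := by simp
      rw [opT_tmul] at h ⊢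
      rw [show orb 𝓡 (1 : H) = LinearMap.id ∘ₗ orb 𝓡 (1 : H) from rfl,
        show LinearMap.mulRight k y = LinearMap.mulRight k y ∘ₗ LinearMap.mulRight k 1 by
          ext; simp, TensorProduct.map_comp, LinearMap.comp_apply, h]
      simp)

lemma inH_apply (h : H) : inH 𝓡 h = mk 𝓡 h 1 := rfl
lemma inT_apply (t : T) : inT 𝓡 (H := H) t = mk 𝓡 1 t := rfl

lemma mk_eq (h : H) (t : T) : mk 𝓡 h t = inH 𝓡 h * inT 𝓡 t := by
  apply (equiv 𝓡).injective
  rw [equiv_mul]; simp [inH_apply, inT_apply]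

lemma covariant_in : Covariant 𝓡 (inH (H := H) 𝓡).toLinearMap (inT 𝓡) := by
  intro t y
  conv_lhs => rw [AlgHom.toLinearMap_apply, inT_apply, inH_apply, mk_mul_mk]
  conv_rhs => rw [← (Coalgebra.Repr.arbitrary k t).eq]
  simp [mk_eq]

/-- The universal property of the smash product. -/
noncomputable def lift {A : Type u} [Ring A] [Algebra k A] (f : H →ₐ[k] A) (g : T →ₐ[k] A)
    (h : Covariant 𝓡 f.toLinearMap g) : Bosonization 𝓡 H →ₐ[k] A :=
  AlgHom.ofLinearMap
    (LinearMap.mul' k A ∘ₗ TensorProduct.map f.toLinearMap g.toLinearMap ∘ₗ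
      (equiv 𝓡).toLinearMap)
    (by simp [one_def])
    (fun x y => by
      simp only [LinearMap.comp_apply, LinearEquiv.coe_coe, equiv_mul]
      induction equiv 𝓡 x using TensorProduct.induction_on with
      | zero => simp
      | add a b ha hb => simp only [map_add, LinearMap.add_apply, ha, hb, add_mul]
      | tmul a t =>
        induction equiv 𝓡 y using TensorProduct.induction_on with
        | zero => simp
        | add a b ha hb => simp only [map_add, ha, hb, mul_add]
        | tmul b r =>
          have h1 := h t b
          rw [← (Coalgebra.Repr.arbitrary k t).eq] at h1
          simp only [map_sum, TensorProduct.map_tmul, LinearMap.mul'_apply, LinearMap.comp_apply,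
            AlgHom.toLinearMap_apply, orb_apply] at h1
          simp only [opMul_tmul, Module.End.mul_apply, opT_tmul_sum, map_sum, opH_tmul,
            TensorProduct.map_tmul, AlgHom.toLinearMap_apply, LinearMap.mul'_apply]
          rw [mul_assoc, ← mul_assoc (g t), h1]
          simp [Finset.sum_mul, Finset.mul_sum, mul_assoc])

lemma lift_mk {A : Type u} [Ring A] [Algebra k A] (f : H →ₐ[k] A) (g : T →ₐ[k] A)
    (h : Covariant 𝓡 f.toLinearMap g) (a : H) (t : T) :
    lift 𝓡 f g h (mk 𝓡 a t) = f a * g t := by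
  simp [lift]

variable {𝓡} in
lemma algHom_ext {A : Type u} [Ring A] [Algebra k A] {f g : Bosonization 𝓡 H →ₐ[k] A}
    (h₁ : ∀ a, f (inH 𝓡 a) = g (inH 𝓡 a)) (h₂ : ∀ t, f (inT 𝓡 t) = g (inT 𝓡 t)) : f = g := by
  ext x
  obtain ⟨x, rfl⟩ := (equiv 𝓡).symm.surjective x
  induction x using TensorProduct.induction_on with
  | zero => simp
  | add a b ha hb => simp only [map_add, ha, hb]
  | tmul a t => rw [equiv_symm_tmul, mk_eq, map_mul, map_mul, h₁, h₂]

end Bosonization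
end Boson
end CentralHopf

namespace CentralHopf
section Boson

variable {k : Type u} [Field k] {T : Type u} [Ring T] [HopfAlgebra k T]

namespace RMatrix

variable (𝓡 : RMatrix k T)

/-- A decomposition of `R` as a finite sum of pure tensors. -/
lemma exists_repr : ∃ (s : Finset (T × T)), (𝓡.R : T ⊗[k] T) = ∑ i ∈ s, i.1 ⊗ₜ[k] i.2 :=
  TensorProduct.exists_finset _

noncomputable def supp : Finset (T × T) := 𝓡.exists_repr.choose

lemma R_eq : (𝓡.R : T ⊗[k] T) = ∑ i ∈ 𝓡.supp, i.1 ⊗ₜ[k] i.2 := 𝓡.exists_repr.choose_spec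

open Coalgebra in
lemma comul_left_sum : ∑ i ∈ 𝓡.supp, ∑ j ∈ (ℛ k i.1).index,
      (ℛ k i.1).left j ⊗ₜ[k] ((ℛ k i.1).right j ⊗ₜ[k] i.2) =
    ∑ i ∈ 𝓡.supp, ∑ j ∈ 𝓡.supp, i.1 ⊗ₜ[k] (j.1 ⊗ₜ[k] (i.2 * j.2)) := by
  have h := 𝓡.comul_left
  rw [R_eq] at h
  simp only [map_sum, Algebra.TensorProduct.map_tmul, Bialgebra.comulAlgHom_apply,
    AlgHom.coe_id, id_eq, Algebra.TensorProduct.includeRight_apply, TensorProduct.tmul_sum,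
    Finset.sum_mul, Finset.mul_sum, Algebra.TensorProduct.tmul_mul_tmul, mul_one, one_mul] at h
  rw [Finset.sum_comm] at h
  rw [← h]
  refine Finset.sum_congr rfl fun i _ => ?_
  conv_rhs => rw [← (ℛ k i.1).eq]
  simp [TensorProduct.sum_tmul]

open Coalgebra in
lemma comul_right_sum : ∑ i ∈ 𝓡.supp, ∑ j ∈ (ℛ k i.2).index,
      i.1 ⊗ₜ[k] ((ℛ k i.2).left j ⊗ₜ[k] (ℛ k i.2).right j) =
    ∑ i ∈ 𝓡.supp, ∑ j ∈ 𝓡.supp, (i.1 * j.1) ⊗ₜ[k] (j.2 ⊗ₜ[k] i.2) := by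
  have h := 𝓡.comul_right
  rw [R_eq] at h
  simp only [map_sum, Algebra.TensorProduct.map_tmul, Bialgebra.comulAlgHom_apply,
    AlgHom.coe_id, id_eq, Algebra.TensorProduct.includeRight_apply,
    Algebra.TensorProduct.includeLeft_apply,
    Finset.sum_mul, Finset.mul_sum, Algebra.TensorProduct.tmul_mul_tmul, mul_one, one_mul] at h
  rw [Finset.sum_comm] at h
  rw [← h]
  refine Finset.sum_congr rfl fun i _ => ?_
  conv_rhs => rw [← (ℛ k i.2).eq]
  simp [TensorProduct.tmul_sum]

open Coalgebra in
lemma cocomm_sum (t : T) : ∑ j ∈ (ℛ k t).index, ∑ i ∈ 𝓡.supp,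
      ((ℛ k t).right j * i.1) ⊗ₜ[k] ((ℛ k t).left j * i.2) =
    ∑ j ∈ (ℛ k t).index, ∑ i ∈ 𝓡.supp,
      (i.1 * (ℛ k t).left j) ⊗ₜ[k] (i.2 * (ℛ k t).right j) := by
  have h := 𝓡.quasi_cocomm t
  rw [R_eq, ← (ℛ k t).eq] at h
  simp only [map_sum, TensorProduct.comm_tmul, Finset.sum_mul, Finset.mul_sum,
    Algebra.TensorProduct.tmul_mul_tmul] at h
  rw [Finset.sum_comm, h, Finset.sum_comm]

open Coalgebra in
lemma counit_left_sum : ∑ i ∈ 𝓡.supp, counit (R := k) i.1 • i.2 = 1 := by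
  simpa [R_eq] using 𝓡.counit_left

open Coalgebra in
lemma counit_right_sum : ∑ i ∈ 𝓡.supp, counit (R := k) i.2 • i.1 = 1 := by
  simpa [R_eq] using 𝓡.counit_right

open Coalgebra in
/-- `R²S(r²) ⊗ r¹R¹ = 1`. -/
lemma sum_antipode : ∑ i ∈ 𝓡.supp, ∑ j ∈ 𝓡.supp,
    (i.1 * j.1) ⊗ₜ[k] (j.2 * HopfAlgebra.antipode k i.2) = (1 : T ⊗[k] T) := by
  have h := congrArg (TensorProduct.map LinearMap.id
    (LinearMap.mul' k T ∘ₗ (HopfAlgebra.antipode k (A := T)).lTensor T)) 𝓡.comul_right_sum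
  simp only [map_sum, TensorProduct.map_tmul, LinearMap.id_apply, LinearMap.comp_apply,
    LinearMap.lTensor_tmul, LinearMap.mul'_apply] at h
  rw [← h]
  simp only [← TensorProduct.tmul_sum, HopfAlgebra.sum_mul_antipode_eq_smul]
  simp only [← TensorProduct.smul_tmul, ← TensorProduct.sum_tmul]
  rw [counit_right_sum]; rfl

end RMatrix

namespace BraidedHopfAlgebra
variable (𝓡 : RMatrix k T) {H : Type u} [Ring H] [Algebra k H] [Coalgebra k H]
  [BraidedHopfAlgebra 𝓡 H]

open Coalgebra in
lemma comul_mul_sum (x y : H) : comul (R := k) (x * y) =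
    ∑ a ∈ (ℛ k x).index, ∑ b ∈ (ℛ k y).index, ∑ i ∈ 𝓡.supp,
      ((ℛ k x).left a * act (𝓡 := 𝓡) i.2 ((ℛ k y).left b)) ⊗ₜ[k]
        (act (𝓡 := 𝓡) i.1 ((ℛ k x).right a) * (ℛ k y).right b) := by
  rw [BraidedHopfAlgebra.comul_mul (𝓡 := 𝓡), ← (ℛ k x).eq, ← (ℛ k y).eq]
  simp only [RMatrix.braid, 𝓡.R_eq, TensorProduct.sum_tmul, TensorProduct.tmul_sum, map_sum,
    Algebra.TensorProduct.map_tmul, Module.endTensorEndAlgHom_apply, LinearMap.comp_apply,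
    LinearEquiv.coe_coe, TensorProduct.assoc_tmul, TensorProduct.map_tmul,
    TensorProduct.assoc_symm_tmul, LinearMap.sum_apply, TensorProduct.AlgebraTensorModule.map_tmul,
    TensorProduct.comm_tmul, LinearMap.id_apply, LinearMap.mul'_apply]
  rw [Finset.sum_comm]
end BraidedHopfAlgebra

end Boson
end CentralHopf

namespace CentralHopf
section Boson

variable {k : Type u} [Field k] {T : Type u} [Ring T] [HopfAlgebra k T]

namespace Bosonization
open BraidedHopfAlgebra Coalgebra

variable (𝓡 : RMatrix k T) {H : Type u} [Ring H] [Algebra k H] [Coalgebra k H]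
  [BraidedHopfAlgebra 𝓡 H]

lemma Covariant.sum {A : Type u} [Ring A] [Algebra k A] {f : H →ₗ[k] A} {g : T →ₐ[k] A}
    (h : BraidedHopfAlgebra.Covariant 𝓡 f g) (t : T) (y : H) : g t * f y =
    ∑ i ∈ (ℛ k t).index, f (act (𝓡 := 𝓡) ((ℛ k t).left i) y) * g ((ℛ k t).right i) := by
  rw [h t y]; conv_lhs => rw [← (ℛ k t).eq]
  simp

/-- `t ↦ (1 # t₁) ⊗ (1 # t₂)`. -/
noncomputable def comT : T →ₐ[k] Bosonization 𝓡 H ⊗[k] Bosonization 𝓡 H :=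
  (Algebra.TensorProduct.map (inT 𝓡) (inT 𝓡)).comp (Bialgebra.comulAlgHom k T)

lemma comT_sum (t : T) : comT 𝓡 (H := H) t =
    ∑ i ∈ (ℛ k t).index, inT 𝓡 ((ℛ k t).left i) ⊗ₜ[k] inT 𝓡 ((ℛ k t).right i) := by
  rw [comT, AlgHom.comp_apply, Bialgebra.comulAlgHom_apply]
  conv_lhs => rw [← (ℛ k t).eq]
  simp

/-- `y ↦ (1 # R²) ⊗ (R¹ · y # 1)`. -/
noncomputable def comW' : H →ₗ[k] Bosonization 𝓡 H ⊗[k] Bosonization 𝓡 H :=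
  ∑ i ∈ 𝓡.supp, TensorProduct.mk k _ _ (inT 𝓡 i.2) ∘ₗ (inH 𝓡).toLinearMap ∘ₗ
    act (𝓡 := 𝓡) i.1

lemma comW'_apply (y : H) : comW' 𝓡 y =
    ∑ i ∈ 𝓡.supp, inT 𝓡 i.2 ⊗ₜ[k] inH 𝓡 (act (𝓡 := 𝓡) i.1 y) := by
  simp [comW']

noncomputable def comW : H →ₐ[k] Bosonization 𝓡 H ⊗[k] Bosonization 𝓡 H :=
  AlgHom.ofLinearMap (comW' 𝓡)
    (by
      rw [comW'_apply]
      have h := congrArg (fun x => inT 𝓡 (H := H) x ⊗ₜ[k] (1 : Bosonization 𝓡 H))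
        𝓡.counit_left_sum
      simp only [map_sum, map_smul, TensorProduct.sum_tmul, map_one] at h
      simpa [act_one, TensorProduct.smul_tmul, Algebra.TensorProduct.one_def] using h)
    (fun x y => by
      have h := congrArg (TensorProduct.lift ((LinearMap.mul k (Bosonization 𝓡 H ⊗[k] Bosonization 𝓡 H)).compl₁₂ LinearMap.id LinearMap.id) ∘ₗ
        TensorProduct.map
          ((TensorProduct.mk k (Bosonization 𝓡 H) (Bosonization 𝓡 H) 1) ∘ₗ
            (inH 𝓡).toLinearMap ∘ₗ orb 𝓡 x)
          (TensorProduct.map (inT 𝓡).toLinearMap ((inH 𝓡).toLinearMap ∘ₗ orb 𝓡 y) ∘ₗ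
            (TensorProduct.comm k T T).toLinearMap)) 𝓡.comul_left_sum
      simp only [map_sum, LinearMap.comp_apply, TensorProduct.map_tmul, LinearEquiv.coe_coe,
        TensorProduct.comm_tmul, TensorProduct.lift.tmul, LinearMap.compl₁₂_apply,
        LinearMap.id_apply, LinearMap.mul_apply', TensorProduct.mk_apply, AlgHom.toLinearMap_apply,
        orb_apply, Algebra.TensorProduct.tmul_mul_tmul, one_mul, map_mul] at h
      simp only [comW'_apply, act_mul_sum, map_sum, map_mul, TensorProduct.tmul_sum,
        Finset.sum_mul, Finset.mul_sum, Algebra.TensorProduct.tmul_mul_tmul]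
      rw [h, Finset.sum_comm])

lemma comW_apply (y : H) : comW 𝓡 y =
    ∑ i ∈ 𝓡.supp, inT 𝓡 i.2 ⊗ₜ[k] inH 𝓡 (act (𝓡 := 𝓡) i.1 y) := comW'_apply 𝓡 y

/-- `y ↦ (y # 1) ⊗ 1`. -/
noncomputable def comV : H →ₐ[k] Bosonization 𝓡 H ⊗[k] Bosonization 𝓡 H :=
  Algebra.TensorProduct.includeLeft.comp (inH 𝓡)

lemma comV_apply (y : H) : comV 𝓡 y = inH 𝓡 y ⊗ₜ[k] 1 := rfl

lemma inT_mul_inH (t : T) (y : H) : inT 𝓡 t * inH 𝓡 y =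
    ∑ i ∈ (ℛ k t).index, inH 𝓡 (act (𝓡 := 𝓡) ((ℛ k t).left i) y) * inT 𝓡 ((ℛ k t).right i) :=
  Covariant.sum 𝓡 (covariant_in 𝓡) t y

lemma covariant_of_sum {A : Type u} [Ring A] [Algebra k A] {f : H →ₗ[k] A} {g : T →ₐ[k] A}
    (h : ∀ t y, g t * f y =
    ∑ i ∈ (ℛ k t).index, f (act (𝓡 := 𝓡) ((ℛ k t).left i) y) * g ((ℛ k t).right i)) :
    BraidedHopfAlgebra.Covariant 𝓡 f g := by
  intro t y
  rw [h]; conv_rhs => rw [← (ℛ k t).eq]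
  simp

lemma comT_mul_comV (t : T) (y : H) : comT 𝓡 t * comV 𝓡 y =
    ∑ i ∈ (ℛ k t).index,
      comV 𝓡 (act (𝓡 := 𝓡) ((ℛ k t).left i) y) * comT 𝓡 ((ℛ k t).right i) := by
  have h := congrArg (TensorProduct.map (LinearMap.mul' k _) LinearMap.id ∘ₗ
      (TensorProduct.assoc k _ _ _).symm.toLinearMap ∘ₗ
      TensorProduct.map ((inH 𝓡).toLinearMap ∘ₗ orb 𝓡 y)
      (TensorProduct.map (inT 𝓡 (H := H)).toLinearMap (inT 𝓡 (H := H)).toLinearMap))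
    (sum_tmul_tmul_eq (ℛ k t) (fun i => ℛ k ((ℛ k t).left i)) (fun i => ℛ k ((ℛ k t).right i)))
  simp only [map_sum, LinearMap.comp_apply, TensorProduct.map_tmul, LinearEquiv.coe_coe,
    TensorProduct.assoc_symm_tmul, LinearMap.mul'_apply, LinearMap.id_apply,
    AlgHom.toLinearMap_apply, orb_apply] at h
  simp only [comT_sum, comV_apply, Finset.sum_mul, Finset.mul_sum,
    Algebra.TensorProduct.tmul_mul_tmul, mul_one, one_mul, inT_mul_inH, TensorProduct.sum_tmul]
  exact h

lemma comT_mul_comW (t : T) (y : H) : comT 𝓡 t * comW 𝓡 y =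
    ∑ i ∈ (ℛ k t).index,
      comW 𝓡 (act (𝓡 := 𝓡) ((ℛ k t).left i) y) * comT 𝓡 ((ℛ k t).right i) := by
  let Φ₁ : T ⊗[k] (T ⊗[k] T) →ₗ[k] Bosonization 𝓡 H ⊗[k] Bosonization 𝓡 H :=
    ∑ i ∈ 𝓡.supp, TensorProduct.map
      ((inT 𝓡 (H := H)).toLinearMap ∘ₗ LinearMap.mulRight k i.2)
      (LinearMap.mul' k (Bosonization 𝓡 H) ∘ₗ TensorProduct.map
        ((inH 𝓡).toLinearMap ∘ₗ orb 𝓡 y ∘ₗ LinearMap.mulRight k i.1)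
        (inT 𝓡).toLinearMap)
  have h₁ := congrArg Φ₁
    (sum_tmul_tmul_eq (ℛ k t) (fun i => ℛ k ((ℛ k t).left i)) (fun i => ℛ k ((ℛ k t).right i)))
  let Φ₂ : T ⊗[k] (T ⊗[k] T) →ₗ[k] Bosonization 𝓡 H ⊗[k] Bosonization 𝓡 H :=
    ∑ i ∈ 𝓡.supp, TensorProduct.map
      ((inT 𝓡 (H := H)).toLinearMap ∘ₗ LinearMap.mulLeft k i.2)
      (LinearMap.mul' k (Bosonization 𝓡 H) ∘ₗ TensorProduct.map
        ((inH 𝓡).toLinearMap ∘ₗ orb 𝓡 y ∘ₗ LinearMap.mulLeft k i.1)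
        (inT 𝓡).toLinearMap) ∘ₗ (TensorProduct.leftComm k T T T).toLinearMap
  have h₂ := congrArg Φ₂
    (sum_tmul_tmul_eq (ℛ k t) (fun i => ℛ k ((ℛ k t).left i)) (fun i => ℛ k ((ℛ k t).right i)))
  let Φ₃ (s : T) : T ⊗[k] T →ₗ[k] Bosonization 𝓡 H ⊗[k] Bosonization 𝓡 H :=
    TensorProduct.map (inT 𝓡 (H := H)).toLinearMap
      (LinearMap.mulRight k (inT 𝓡 s) ∘ₗ (inH 𝓡).toLinearMap ∘ₗ orb 𝓡 y) ∘ₗ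
      (TensorProduct.comm k T T).toLinearMap
  have h₃ := fun j => congrArg (Φ₃ ((ℛ k t).right j)) (𝓡.cocomm_sum ((ℛ k t).left j))
  simp only [Φ₁, Φ₂, Φ₃, map_sum, LinearMap.comp_apply, TensorProduct.map_tmul, LinearEquiv.coe_coe,
    LinearMap.mul'_apply, LinearMap.sum_apply, LinearMap.mulRight_apply, LinearMap.mulLeft_apply,
    TensorProduct.comm_tmul, TensorProduct.leftComm_tmul,
    AlgHom.toLinearMap_apply, orb_apply] at h₁ h₂ h₃
  simp only [h₃] at h₁
  rw [h₁] at h₂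
  simp only [comW_apply, comT_sum, Finset.sum_mul, Finset.mul_sum,
    Algebra.TensorProduct.tmul_mul_tmul, inT_mul_inH, TensorProduct.tmul_sum]
  simp only [map_mul, Module.End.mul_apply] at h₂ ⊢
  refine Eq.trans ?_ (h₂.trans ?_)
  · rw [Finset.sum_comm]
    exact Finset.sum_congr rfl fun j _ => Finset.sum_comm
  · refine Finset.sum_congr rfl fun j _ => ?_
    rw [Finset.sum_comm]

lemma comW_mul_comV (y z : H) : comW 𝓡 y * comV 𝓡 z =
    ∑ i ∈ 𝓡.supp, comV 𝓡 (act (𝓡 := 𝓡) i.2 z) * comW 𝓡 (act (𝓡 := 𝓡) i.1 y) := by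
  have h := congrArg (TensorProduct.map (LinearMap.mul' k _) LinearMap.id ∘ₗ
      (TensorProduct.assoc k _ _ _).symm.toLinearMap ∘ₗ
      (TensorProduct.map 
        ((inH 𝓡).toLinearMap ∘ₗ orb 𝓡 z)
        ((TensorProduct.comm k _ _).toLinearMap ∘ₗ TensorProduct.map ((inH 𝓡).toLinearMap ∘ₗ orb 𝓡 y) (inT 𝓡 (H := H)).toLinearMap)) ∘ₗ
        (TensorProduct.leftComm k T T T).toLinearMap) 𝓡.comul_right_sum
  simp only [map_sum, LinearMap.comp_apply, TensorProduct.map_tmul, LinearEquiv.coe_coe,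
    TensorProduct.assoc_symm_tmul, LinearMap.mul'_apply, LinearMap.id_apply,
    TensorProduct.comm_tmul, TensorProduct.leftComm_tmul,
    AlgHom.toLinearMap_apply, orb_apply] at h
  simp only [comW_apply, comV_apply, Finset.sum_mul, Finset.mul_sum,
    Algebra.TensorProduct.tmul_mul_tmul, mul_one, one_mul, inT_mul_inH, TensorProduct.sum_tmul]
  rw [h, Finset.sum_comm]
  simp only [map_mul, Module.End.mul_apply]

/-- `y ↦ y₁ # R² ⊗ R¹ · y₂ # 1`, the coproduct of the bosonization on `H`. -/
noncomputable def comH' : H →ₗ[k] Bosonization 𝓡 H ⊗[k] Bosonization 𝓡 H :=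
  LinearMap.mul' k _ ∘ₗ
    TensorProduct.map (comV 𝓡).toLinearMap (comW 𝓡).toLinearMap ∘ₗ comul

lemma comH'_sum (y : H) : comH' 𝓡 y =
    ∑ i ∈ (ℛ k y).index, comV 𝓡 ((ℛ k y).left i) * comW 𝓡 ((ℛ k y).right i) := by
  rw [comH', LinearMap.comp_apply, LinearMap.comp_apply]
  conv_lhs => rw [← (ℛ k y).eq]
  simp

lemma comH'_comul {y : H} {z : H ⊗[k] H} (h : comul (R := k) y = z) : comH' 𝓡 y =
    LinearMap.mul' k _ (TensorProduct.map (comV 𝓡).toLinearMap (comW 𝓡).toLinearMap z) := by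
  rw [comH', LinearMap.comp_apply, LinearMap.comp_apply, h]

noncomputable def comH : H →ₐ[k] Bosonization 𝓡 H ⊗[k] Bosonization 𝓡 H :=
  AlgHom.ofLinearMap (comH' 𝓡)
    (by rw [comH'_comul 𝓡 (BraidedHopfAlgebra.comul_one (𝓡 := 𝓡))]; simp)
    (fun x y => by
      rw [comH'_comul 𝓡 (comul_mul_sum 𝓡 x y)]
      simp only [map_sum, TensorProduct.map_tmul, LinearMap.mul'_apply, AlgHom.toLinearMap_apply,
        map_mul, comH'_sum, Finset.sum_mul, Finset.mul_sum]
      rw [Finset.sum_comm]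
      refine Finset.sum_congr rfl fun b _ => Finset.sum_congr rfl fun a _ => ?_
      rw [mul_assoc, ← mul_assoc (comW 𝓡 _), comW_mul_comV]
      simp only [Finset.sum_mul, Finset.mul_sum, mul_assoc])

lemma comH_sum (y : H) : comH 𝓡 y =
    ∑ i ∈ (ℛ k y).index, comV 𝓡 ((ℛ k y).left i) * comW 𝓡 ((ℛ k y).right i) := comH'_sum 𝓡 y

lemma comT_comH : BraidedHopfAlgebra.Covariant 𝓡 (comH (H := H) 𝓡).toLinearMap (comT 𝓡) := by
  refine covariant_of_sum 𝓡 fun t y => ?_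
  simp only [AlgHom.toLinearMap_apply]
  have e : ∀ s, comH 𝓡 (act (𝓡 := 𝓡) s y) = _ := fun s => comH'_comul 𝓡 (comul_act_sum 𝓡 s y)
  simp only [e, comH_sum, map_sum, TensorProduct.map_tmul, LinearMap.mul'_apply,
    AlgHom.toLinearMap_apply, Finset.mul_sum, Finset.sum_mul, ← mul_assoc, comT_mul_comV]
  simp only [mul_assoc, comT_mul_comW, Finset.mul_sum]
  let Φ (a b : H) : T ⊗[k] (T ⊗[k] T) →ₗ[k] Bosonization 𝓡 H ⊗[k] Bosonization 𝓡 H :=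
    LinearMap.mul' k _ ∘ₗ TensorProduct.map ((comV 𝓡).toLinearMap ∘ₗ orb 𝓡 a)
      (LinearMap.mul' k _ ∘ₗ TensorProduct.map ((comW 𝓡).toLinearMap ∘ₗ orb 𝓡 b)
        (comT 𝓡).toLinearMap)
  have h := fun a b => congrArg (Φ a b)
    (sum_tmul_tmul_eq (ℛ k t) (fun i => ℛ k ((ℛ k t).left i)) (fun i => ℛ k ((ℛ k t).right i)))
  simp only [Φ, map_sum, LinearMap.comp_apply, TensorProduct.map_tmul, LinearMap.mul'_apply,
    AlgHom.toLinearMap_apply, orb_apply] at h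
  rw [← Finset.sum_congr rfl fun a _ => h _ _, Finset.sum_comm]
  exact Finset.sum_congr rfl fun j _ => Finset.sum_comm

/-- The coproduct of the bosonization:
`Δ(h # t) = h₁ # R² t₁ ⊗ R¹ · h₂ # t₂`. -/
noncomputable def comulHom :
    Bosonization 𝓡 H →ₐ[k] Bosonization 𝓡 H ⊗[k] Bosonization 𝓡 H :=
  lift 𝓡 (comH 𝓡) (comT 𝓡) (comT_comH 𝓡)

/-- The counit `h ↦ ε(h)` of `H`. -/
noncomputable def counitH : H →ₐ[k] k :=
  AlgHom.ofLinearMap counit (BraidedHopfAlgebra.counit_one (𝓡 := 𝓡))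
    (BraidedHopfAlgebra.counit_mul (𝓡 := 𝓡))

lemma counit_covariant {A : Type u} [Ring A] [Algebra k A] (g : T →ₐ[k] A) :
    BraidedHopfAlgebra.Covariant 𝓡 ((Algebra.ofId k A).comp (counitH (H := H) 𝓡)).toLinearMap
      g := by
  refine covariant_of_sum 𝓡 fun t y => ?_
  have h := congrArg g (sum_counit_smul (ℛ k t))
  simp only [map_sum, map_smul] at h
  simp only [AlgHom.toLinearMap_apply, AlgHom.comp_apply, counitH, AlgHom.ofLinearMap_apply,
    counit_act, Algebra.ofId_apply, map_mul]
  conv_lhs => rw [← h]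
  simp only [Finset.sum_mul, Algebra.smul_def]
  refine Finset.sum_congr rfl fun i _ => ?_
  rw [mul_assoc, mul_assoc, Algebra.commutes (counit y)]

/-- The counit `h # t ↦ ε(h) ε(t)`. -/
noncomputable def counitHom : Bosonization 𝓡 H →ₐ[k] k :=
  lift 𝓡 ((Algebra.ofId k k).comp (counitH 𝓡)) (Bialgebra.counitAlgHom k T)
    (counit_covariant 𝓡 _)

/-- The canonical projection `π(h # t) = ε(h) t`. -/
noncomputable def proj : Bosonization 𝓡 H →ₐ[k] T :=
  lift 𝓡 ((Algebra.ofId k T).comp (counitH 𝓡)) (AlgHom.id k T) (counit_covariant 𝓡 _)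

end Bosonization
end Boson
end CentralHopf

namespace CentralHopf
section Boson

variable {k : Type u} [Field k] {T : Type u} [Ring T] [HopfAlgebra k T]

namespace Bosonization
open BraidedHopfAlgebra Coalgebra

variable (𝓡 : RMatrix k T) {H : Type u} [Ring H] [Algebra k H] [Coalgebra k H]
  [BraidedHopfAlgebra 𝓡 H]

lemma comulHom_inH (y : H) : comulHom 𝓡 (inH 𝓡 y) = comH 𝓡 y := by
  rw [comulHom, inH_apply, lift_mk, map_one, mul_one]

lemma comulHom_inT (t : T) : comulHom 𝓡 (H := H) (inT 𝓡 t) = comT 𝓡 t := by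
  rw [comulHom, inT_apply, lift_mk, map_one, one_mul]

lemma counitHom_inH (y : H) : counitHom 𝓡 (inH 𝓡 y) = counit (R := k) y := by
  rw [counitHom, inH_apply, lift_mk, map_one, mul_one]; rfl

lemma counitHom_inT (t : T) : counitHom 𝓡 (H := H) (inT 𝓡 t) = counit (R := k) t := by
  rw [counitHom, inT_apply, lift_mk, map_one, one_mul]; rfl

lemma comH_expand (y : H) : comH 𝓡 y =
    ∑ i ∈ (ℛ k y).index, ∑ c ∈ 𝓡.supp,
      (inH 𝓡 ((ℛ k y).left i) * inT 𝓡 c.2) ⊗ₜ[k]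
        inH 𝓡 (act (𝓡 := 𝓡) c.1 ((ℛ k y).right i)) := by
  simp [comH_sum, comV_apply, comW_apply, Finset.mul_sum]

lemma comH_act (a : T) (y : H) : comH 𝓡 (act (𝓡 := 𝓡) a y) =
    ∑ j ∈ (ℛ k a).index, ∑ i ∈ (ℛ k y).index, ∑ c ∈ 𝓡.supp,
      (inH 𝓡 (act (𝓡 := 𝓡) ((ℛ k a).left j) ((ℛ k y).left i)) * inT 𝓡 c.2) ⊗ₜ[k]
        inH 𝓡 (act (𝓡 := 𝓡) c.1 (act (𝓡 := 𝓡) ((ℛ k a).right j) ((ℛ k y).right i))) := by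
  have e : comH 𝓡 (act (𝓡 := 𝓡) a y) = _ := comH'_comul 𝓡 (comul_act_sum 𝓡 a y)
  rw [e]
  simp [comV_apply, comW_apply, Finset.mul_sum]

lemma comH_mul_comT (y : H) (t : T) : comH 𝓡 y * comT 𝓡 t =
    ∑ i ∈ (ℛ k y).index, ∑ c ∈ 𝓡.supp, ∑ j ∈ (ℛ k t).index,
      (inH 𝓡 ((ℛ k y).left i) * inT 𝓡 (c.2 * (ℛ k t).left j)) ⊗ₜ[k]
        (inH 𝓡 (act (𝓡 := 𝓡) c.1 ((ℛ k y).right i)) * inT 𝓡 ((ℛ k t).right j)) := by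
  simp only [comH_expand, comT_sum, Finset.sum_mul, Finset.mul_sum,
    Algebra.TensorProduct.tmul_mul_tmul, map_mul, mul_assoc]
  rw [Finset.sum_comm]
  refine Finset.sum_congr rfl fun i _ => ?_
  rw [Finset.sum_comm]

lemma coassoc_left (y : H) :
    (Algebra.TensorProduct.assoc k k k _ _ _)
      (Algebra.TensorProduct.map (comulHom 𝓡) (AlgHom.id k _) (comH 𝓡 y)) =
    ∑ α ∈ (ℛ k y).index, ∑ β ∈ (ℛ k ((ℛ k y).left α)).index, ∑ c ∈ 𝓡.supp,
      ∑ i ∈ 𝓡.supp, ∑ j ∈ 𝓡.supp,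
        (inH 𝓡 ((ℛ k ((ℛ k y).left α)).left β) * inT 𝓡 (c.2 * j.2)) ⊗ₜ[k]
          ((inH 𝓡 (act (𝓡 := 𝓡) c.1 ((ℛ k ((ℛ k y).left α)).right β)) * inT 𝓡 i.2) ⊗ₜ[k]
            inH 𝓡 (act (𝓡 := 𝓡) (i.1 * j.1) ((ℛ k y).right α))) := by
  rw [comH_expand]
  simp only [map_sum, Algebra.TensorProduct.map_tmul, map_mul, comulHom_inH, comulHom_inT,
    AlgHom.coe_id, id_eq, comH_mul_comT, TensorProduct.sum_tmul,
    Algebra.TensorProduct.assoc_tmul]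
  refine Finset.sum_congr rfl fun α _ => ?_
  rw [Finset.sum_comm]
  refine Finset.sum_congr rfl fun β _ => ?_
  rw [Finset.sum_comm]
  refine Finset.sum_congr rfl fun c _ => ?_
  let Ψ : T ⊗[k] (T ⊗[k] T) →ₗ[k]
      Bosonization 𝓡 H ⊗[k] (Bosonization 𝓡 H ⊗[k] Bosonization 𝓡 H) :=
    TensorProduct.map (LinearMap.mulLeft k (inH 𝓡 ((ℛ k ((ℛ k y).left α)).left β)) ∘ₗ
        (inT 𝓡).toLinearMap ∘ₗ LinearMap.mulLeft k c.2)
      (TensorProduct.map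
        (LinearMap.mulLeft k
          (inH 𝓡 (act (𝓡 := 𝓡) c.1 ((ℛ k ((ℛ k y).left α)).right β))) ∘ₗ
          (inT 𝓡).toLinearMap)
        ((inH 𝓡).toLinearMap ∘ₗ orb 𝓡 ((ℛ k y).right α)) ∘ₗ
        (TensorProduct.comm k T T).toLinearMap) ∘ₗ
      (TensorProduct.leftComm k T T T).toLinearMap
  have h := congrArg Ψ 𝓡.comul_right_sum
  simp only [Ψ, map_sum, LinearMap.comp_apply, TensorProduct.map_tmul, LinearEquiv.coe_coe,
    TensorProduct.comm_tmul, TensorProduct.leftComm_tmul, LinearMap.mulLeft_apply,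
    AlgHom.toLinearMap_apply, orb_apply] at h
  simpa using h

lemma coassoc_right (y : H) :
    Algebra.TensorProduct.map (AlgHom.id k _) (comulHom 𝓡) (comH 𝓡 y) =
    ∑ α ∈ (ℛ k y).index, ∑ β ∈ (ℛ k ((ℛ k y).right α)).index, ∑ c ∈ 𝓡.supp,
      ∑ i ∈ 𝓡.supp, ∑ j ∈ 𝓡.supp,
        (inH 𝓡 ((ℛ k y).left α) * inT 𝓡 (c.2 * j.2)) ⊗ₜ[k]
          ((inH 𝓡 (act (𝓡 := 𝓡) c.1 ((ℛ k ((ℛ k y).right α)).left β)) * inT 𝓡 i.2) ⊗ₜ[k]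
            inH 𝓡 (act (𝓡 := 𝓡) (i.1 * j.1) ((ℛ k ((ℛ k y).right α)).right β))) := by
  rw [comH_expand]
  simp only [map_sum, Algebra.TensorProduct.map_tmul, AlgHom.coe_id, id_eq, comulHom_inH,
    comH_act, TensorProduct.tmul_sum]
  refine Finset.sum_congr rfl fun α _ => ?_
  have h : ∀ β l, _ := fun (β : H × H) (l : T × T) => congrArg (TensorProduct.map
      (LinearMap.mulLeft k (inH 𝓡 ((ℛ k y).left α)) ∘ₗ (inT 𝓡).toLinearMap)
      (TensorProduct.map (LinearMap.mulRight k (inT 𝓡 l.2) ∘ₗ (inH 𝓡).toLinearMap ∘ₗ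
        orb 𝓡 ((ℛ k ((ℛ k y).right α)).left β))
        ((inH 𝓡).toLinearMap ∘ₗ act (𝓡 := 𝓡) l.1 ∘ₗ
          orb 𝓡 ((ℛ k ((ℛ k y).right α)).right β))) ∘ₗ
      (TensorProduct.leftComm k T T T).toLinearMap ∘ₗ
      TensorProduct.map LinearMap.id (TensorProduct.comm k T T).toLinearMap) 𝓡.comul_left_sum
  simp only [map_sum, LinearMap.comp_apply, TensorProduct.map_tmul, LinearEquiv.coe_coe,
    TensorProduct.comm_tmul, TensorProduct.leftComm_tmul, LinearMap.mulLeft_apply,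
    LinearMap.mulRight_apply, LinearMap.id_apply,
    AlgHom.toLinearMap_apply, orb_apply] at h
  rw [Finset.sum_congr rfl fun _ _ => Finset.sum_comm, Finset.sum_comm]
  refine Finset.sum_congr rfl fun β _ => ?_
  rw [Finset.sum_congr rfl fun _ _ => Finset.sum_comm, Finset.sum_comm]
  rw [Finset.sum_congr rfl fun l _ => h β l, Finset.sum_comm]
  refine Finset.sum_congr rfl fun c _ => Finset.sum_congr rfl fun i _ => ?_
  simp only [map_mul, Module.End.mul_apply]

lemma coassoc_H (y : H) :
    (Algebra.TensorProduct.assoc k k k _ _ _)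
      (Algebra.TensorProduct.map (comulHom 𝓡) (AlgHom.id k _) (comH 𝓡 y)) =
    Algebra.TensorProduct.map (AlgHom.id k _) (comulHom 𝓡) (comH 𝓡 y) := by
  rw [coassoc_left, coassoc_right]
  let Χ (c i j : T × T) : H ⊗[k] (H ⊗[k] H) →ₗ[k]
      Bosonization 𝓡 H ⊗[k] (Bosonization 𝓡 H ⊗[k] Bosonization 𝓡 H) :=
    TensorProduct.map (LinearMap.mulRight k (inT 𝓡 (c.2 * j.2)) ∘ₗ (inH 𝓡).toLinearMap)
      (TensorProduct.map
        (LinearMap.mulRight k (inT 𝓡 i.2) ∘ₗ (inH 𝓡).toLinearMap ∘ₗ act (𝓡 := 𝓡) c.1)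
        ((inH 𝓡).toLinearMap ∘ₗ act (𝓡 := 𝓡) (i.1 * j.1)))
  let Χs : H ⊗[k] (H ⊗[k] H) →ₗ[k]
      Bosonization 𝓡 H ⊗[k] (Bosonization 𝓡 H ⊗[k] Bosonization 𝓡 H) :=
    ∑ c ∈ 𝓡.supp, ∑ i ∈ 𝓡.supp, ∑ j ∈ 𝓡.supp, Χ c i j
  have h := congrArg Χs
    (sum_tmul_tmul_eq (ℛ k y) (fun i => ℛ k ((ℛ k y).left i)) (fun i => ℛ k ((ℛ k y).right i)))
  simp only [Χs, Χ, map_sum, LinearMap.sum_apply, LinearMap.comp_apply, TensorProduct.map_tmul,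
    LinearMap.mulRight_apply, AlgHom.toLinearMap_apply] at h
  exact h

lemma coassoc_T (t : T) :
    (Algebra.TensorProduct.assoc k k k _ _ _)
      (Algebra.TensorProduct.map (comulHom 𝓡) (AlgHom.id k _) (comT 𝓡 (H := H) t)) =
    Algebra.TensorProduct.map (AlgHom.id k _) (comulHom 𝓡) (comT 𝓡 t) := by
  have h := congrArg (TensorProduct.map (inT 𝓡 (H := H)).toLinearMap
      (TensorProduct.map (inT 𝓡 (H := H)).toLinearMap (inT 𝓡 (H := H)).toLinearMap))
    (sum_tmul_tmul_eq (ℛ k t) (fun i => ℛ k ((ℛ k t).left i)) (fun i => ℛ k ((ℛ k t).right i)))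
  simp only [map_sum, TensorProduct.map_tmul, AlgHom.toLinearMap_apply] at h
  simpa [comT_sum, comulHom_inT, TensorProduct.sum_tmul, TensorProduct.tmul_sum] using h

lemma counit_comH_left (y : H) :
    Algebra.TensorProduct.map (counitHom 𝓡) (AlgHom.id k _) (comH 𝓡 y) =
      (1 : k) ⊗ₜ[k] inH 𝓡 y := by
  have h := congrArg (inH 𝓡) (sum_counit_smul (ℛ k y))
  have h2 := fun i => congrArg ((TensorProduct.mk k k (Bosonization 𝓡 H) 1) ∘ₗ
    (inH 𝓡).toLinearMap ∘ₗ orb 𝓡 ((ℛ k y).right i)) 𝓡.counit_right_sum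
  simp only [map_sum, map_smul, LinearMap.comp_apply, orb_apply, map_one, Module.End.one_apply,
    AlgHom.toLinearMap_apply, TensorProduct.mk_apply] at h h2
  simp only [comH_expand, map_sum, Algebra.TensorProduct.map_tmul, map_mul, counitHom_inH,
    counitHom_inT, AlgHom.coe_id, id_eq]
  rw [← h, TensorProduct.tmul_sum]
  refine Finset.sum_congr rfl fun i _ => ?_
  rw [TensorProduct.tmul_smul, ← h2, Finset.smul_sum]
  refine Finset.sum_congr rfl fun c _ => ?_
  rw [TensorProduct.smul_tmul', TensorProduct.smul_tmul']
  simp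

lemma counit_comH_right (y : H) :
    Algebra.TensorProduct.map (AlgHom.id k _) (counitHom 𝓡) (comH 𝓡 y) =
      inH 𝓡 y ⊗ₜ[k] (1 : k) := by
  have h := congrArg (TensorProduct.map (inH 𝓡).toLinearMap LinearMap.id)
    (sum_tmul_counit_eq (ℛ k y))
  have h2 := congrArg (inT 𝓡 (H := H)) 𝓡.counit_left_sum
  simp only [map_sum, map_smul, TensorProduct.map_tmul, LinearMap.id_apply, map_one,
    AlgHom.toLinearMap_apply] at h h2
  simp only [comH_expand, map_sum, Algebra.TensorProduct.map_tmul, counitHom_inH, counit_act,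
    AlgHom.coe_id, id_eq]
  rw [← h]
  refine Finset.sum_congr rfl fun i _ => ?_
  conv_rhs => rw [← mul_one (inH 𝓡 _), ← h2]
  rw [Finset.mul_sum, TensorProduct.sum_tmul]
  refine Finset.sum_congr rfl fun c _ => ?_
  rw [mul_smul_comm, TensorProduct.smul_tmul, smul_eq_mul]

noncomputable instance : Bialgebra k (Bosonization 𝓡 H) :=
  Bialgebra.ofAlgHom (comulHom 𝓡) (counitHom 𝓡)
    (algHom_ext (fun y => by simpa [comulHom_inH] using coassoc_H 𝓡 y)
      (fun t => by simpa [comulHom_inT] using coassoc_T 𝓡 t))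
    (algHom_ext
      (fun y => by simpa [comulHom_inH] using counit_comH_left 𝓡 y)
      (fun t => by
        have h := congrArg (TensorProduct.map LinearMap.id (inT 𝓡 (H := H)).toLinearMap)
          (sum_counit_tmul_eq (ℛ k t))
        simp only [map_sum, TensorProduct.map_tmul, LinearMap.id_apply,
          AlgHom.toLinearMap_apply] at h
        simp [comulHom_inT, comT_sum, counitHom_inT, h]))
    (algHom_ext
      (fun y => by simpa [comulHom_inH] using counit_comH_right 𝓡 y)
      (fun t => by
        have h := congrArg (TensorProduct.map (inT 𝓡 (H := H)).toLinearMap LinearMap.id)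
          (sum_tmul_counit_eq (ℛ k t))
        simp only [map_sum, TensorProduct.map_tmul, LinearMap.id_apply,
          AlgHom.toLinearMap_apply] at h
        simp [comulHom_inT, comT_sum, counitHom_inT, h]))

end Bosonization
end Boson
end CentralHopf

namespace CentralHopf
section Boson

variable {k : Type u} [Field k] {T : Type u} [Ring T] [HopfAlgebra k T]

namespace Bosonization
open BraidedHopfAlgebra Coalgebra

variable (𝓡 : RMatrix k T) {H : Type u} [Ring H] [Algebra k H] [Coalgebra k H]
  [BraidedHopfAlgebra 𝓡 H]

lemma comul_eq (x : Bosonization 𝓡 H) : comul (R := k) x = comulHom 𝓡 x := rfl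
lemma counit_eq (x : Bosonization 𝓡 H) : counit (R := k) x = counitHom 𝓡 x := rfl

/-- The antipode on `H`: `h ↦ (1 # S(R²)) (S(R¹ · h) # 1)`. -/
noncomputable def antH : H →ₗ[k] Bosonization 𝓡 H :=
  ∑ c ∈ 𝓡.supp, LinearMap.mulLeft k (inT 𝓡 (HopfAlgebra.antipode k c.2)) ∘ₗ
    (inH 𝓡).toLinearMap ∘ₗ BraidedHopfAlgebra.antipode 𝓡 ∘ₗ act (𝓡 := 𝓡) c.1

/-- The antipode of the bosonization:
`S(h # t) = (1 # S(R² t)) (S(R¹ · h) # 1)`. -/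
noncomputable def ant : Bosonization 𝓡 H →ₗ[k] Bosonization 𝓡 H :=
  LinearMap.mul' k _ ∘ₗ
    TensorProduct.map ((inT 𝓡).toLinearMap ∘ₗ HopfAlgebra.antipode k) (antH 𝓡) ∘ₗ
    (TensorProduct.comm k H T).toLinearMap ∘ₗ (equiv 𝓡).toLinearMap

lemma antH_apply (h : H) : antH 𝓡 h = ∑ c ∈ 𝓡.supp,
    inT 𝓡 (HopfAlgebra.antipode k c.2) *
      inH 𝓡 (BraidedHopfAlgebra.antipode 𝓡 (act (𝓡 := 𝓡) c.1 h)) := by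
  simp [antH]

lemma ant_mul (h : H) (t : T) : ant 𝓡 (inH 𝓡 h * inT 𝓡 t) =
    inT 𝓡 (HopfAlgebra.antipode k t) * antH 𝓡 h := by
  rw [← mk_eq]; simp [ant]

lemma ant_inH (h : H) : ant 𝓡 (inH 𝓡 h) = antH 𝓡 h := by
  have := ant_mul 𝓡 h 1
  simpa using this

lemma antH_left (h : H) : ∑ i ∈ (ℛ k h).index, ∑ c ∈ 𝓡.supp,
    inT 𝓡 (HopfAlgebra.antipode k c.2) * antH 𝓡 ((ℛ k h).left i) *
      inH 𝓡 (act (𝓡 := 𝓡) c.1 ((ℛ k h).right i)) =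
    algebraMap k _ (counit (R := k) h) := by
  let Φ (i : H × H) : T ⊗[k] (T ⊗[k] T) →ₗ[k] Bosonization 𝓡 H :=
    LinearMap.mul' k _ ∘ₗ (TensorProduct.comm k _ _).toLinearMap ∘ₗ
    TensorProduct.map ((inH 𝓡).toLinearMap ∘ₗ LinearMap.mul' k H)
      ((inT 𝓡).toLinearMap ∘ₗ HopfAlgebra.antipode k) ∘ₗ
    (TensorProduct.assoc k H H T).symm.toLinearMap ∘ₗ
    TensorProduct.map (BraidedHopfAlgebra.antipode 𝓡 ∘ₗ orb 𝓡 ((ℛ k h).left i))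
      (TensorProduct.map (orb 𝓡 ((ℛ k h).right i)) LinearMap.id)
  have h1 := fun i => congrArg (Φ i) 𝓡.comul_left_sum
  simp only [Φ, map_sum, LinearMap.comp_apply, TensorProduct.map_tmul, LinearEquiv.coe_coe,
    LinearMap.mul'_apply, AlgHom.toLinearMap_apply, orb_apply, LinearMap.id_apply,
    TensorProduct.comm_tmul, TensorProduct.assoc_symm_tmul, HopfAlgebra.antipode_mul_antidistrib,
    map_mul] at h1
  have h2 : ∀ t : T, ∑ i ∈ (ℛ k h).index, ∑ j ∈ (ℛ k t).index,
      BraidedHopfAlgebra.antipode 𝓡 (act (𝓡 := 𝓡) ((ℛ k t).left j) ((ℛ k h).left i)) *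
        act (𝓡 := 𝓡) ((ℛ k t).right j) ((ℛ k h).right i) =
        (counit (R := k) t * counit (R := k) h) • (1 : H) := by
    intro t
    have h3 := mul_antipode_left (𝓡 := 𝓡) (act (𝓡 := 𝓡) t h)
    rw [comul_act_sum, counit_act] at h3
    simp only [map_sum, LinearMap.rTensor_tmul, LinearMap.mul'_apply] at h3
    rw [← h3, Finset.sum_comm]
  have h4 := congrArg (fun x => inT 𝓡 (H := H) (HopfAlgebra.antipode k x)) 𝓡.counit_left_sum
  simp only [map_sum, map_smul, HopfAlgebra.antipode_one, map_one] at h4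
  simp only [antH_apply, Finset.mul_sum, Finset.sum_mul, mul_assoc, ← map_mul (inH 𝓡)]
  have h5 : ∀ i ∈ (ℛ k h).index, _ := fun i _ => (Finset.sum_comm.trans (h1 i).symm)
  simp only [map_mul, mul_assoc] at h5 ⊢
  rw [Finset.sum_congr rfl h5, Finset.sum_comm, Algebra.algebraMap_eq_smul_one, ← h4,
    Finset.smul_sum]
  refine Finset.sum_congr rfl fun c _ => ?_
  have h6 := congrArg (inH 𝓡) (h2 c.1)
  simp only [map_sum, map_smul, map_mul, map_one] at h6
  simp only [← Finset.mul_sum]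
  rw [h6, mul_smul_comm, mul_one, smul_smul, mul_comm]

lemma antH_right (h : H) : ∑ i ∈ (ℛ k h).index, ∑ c ∈ 𝓡.supp,
    inH 𝓡 ((ℛ k h).left i) * (inT 𝓡 c.2 * antH 𝓡 (act (𝓡 := 𝓡) c.1 ((ℛ k h).right i))) =
    algebraMap k _ (counit (R := k) h) := by
  let Φ (i : H × H) : T ⊗[k] T →ₗ[k] Bosonization 𝓡 H :=
    LinearMap.mul' k _ ∘ₗ (TensorProduct.comm k _ _).toLinearMap ∘ₗ
    TensorProduct.map ((inH 𝓡).toLinearMap ∘ₗ BraidedHopfAlgebra.antipode 𝓡 ∘ₗ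
      orb 𝓡 ((ℛ k h).right i)) (inT 𝓡).toLinearMap
  have h1 := fun i => congrArg (Φ i) 𝓡.sum_antipode
  rw [Algebra.TensorProduct.one_def] at h1
  simp only [Φ, map_sum, LinearMap.comp_apply, TensorProduct.map_tmul, LinearEquiv.coe_coe,
    LinearMap.mul'_apply, AlgHom.toLinearMap_apply, orb_apply,
    TensorProduct.comm_tmul, map_mul, map_one, one_mul, Module.End.mul_apply,
    Module.End.one_apply] at h1
  have h2 := congrArg (inH 𝓡) (mul_antipode_right (𝓡 := 𝓡) h)
  rw [← (ℛ k h).eq] at h2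
  simp only [map_sum, LinearMap.lTensor_tmul, LinearMap.mul'_apply, map_smul, map_one,
    map_mul] at h2
  rw [Algebra.algebraMap_eq_smul_one, ← h2]
  refine Finset.sum_congr rfl fun i _ => ?_
  rw [← h1 i, Finset.sum_comm, Finset.mul_sum]
  simp only [antH_apply, Finset.mul_sum, mul_assoc]

lemma ant_left (h : H) (t : T) :
    LinearMap.mul' k _ ((ant 𝓡).rTensor _ (comulHom 𝓡 (inH 𝓡 h * inT 𝓡 t))) =
      algebraMap k _ (counitHom 𝓡 (inH 𝓡 h * inT 𝓡 t)) := by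
  have h1 := congrArg (inT 𝓡 (H := H)) (HopfAlgebra.sum_antipode_mul_eq_smul (ℛ k t))
  simp only [map_sum, map_smul, map_mul, map_one] at h1
  rw [map_mul (comulHom 𝓡), map_mul (counitHom 𝓡), comulHom_inH, comulHom_inT, counitHom_inH, counitHom_inT,
    comH_mul_comT]
  simp only [map_sum, LinearMap.rTensor_tmul, LinearMap.mul'_apply, ant_mul,
    HopfAlgebra.antipode_mul_antidistrib]
  simp only [map_mul]
  have h2 := antH_left 𝓡 h
  have h3 : ∀ x y : Bosonization 𝓡 H, _ := fun x y => congrArg (fun z => x * z * y) h2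
  simp only [Finset.mul_sum, Finset.sum_mul, mul_assoc] at h3 ⊢
  rw [Finset.sum_congr rfl fun _ _ => Finset.sum_comm, Finset.sum_comm,
    Finset.sum_congr rfl fun _ _ => h3 _ _, Algebra.algebraMap_eq_smul_one (counit t), ← h1]
  rw [Finset.mul_sum]
  refine Finset.sum_congr rfl fun j _ => ?_
  rw [Algebra.left_comm]

lemma ant_right (h : H) (t : T) :
    LinearMap.mul' k _ ((ant 𝓡).lTensor _ (comulHom 𝓡 (inH 𝓡 h * inT 𝓡 t))) =
      algebraMap k _ (counitHom 𝓡 (inH 𝓡 h * inT 𝓡 t)) := by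
  have h1 := congrArg (inT 𝓡 (H := H)) (HopfAlgebra.sum_mul_antipode_eq_smul (ℛ k t))
  simp only [map_sum, map_smul, map_mul, map_one] at h1
  rw [map_mul (comulHom 𝓡), map_mul (counitHom 𝓡), comulHom_inH, comulHom_inT, counitHom_inH, counitHom_inT,
    comH_mul_comT, map_mul (algebraMap k (Bosonization 𝓡 H)), ← antH_right, Finset.sum_mul]
  simp only [map_sum, LinearMap.lTensor_tmul, LinearMap.mul'_apply, ant_mul]
  simp only [map_mul]
  refine Finset.sum_congr rfl fun i _ => ?_
  rw [Finset.sum_mul]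
  refine Finset.sum_congr rfl fun c _ => ?_
  have h3 : ∀ x y : Bosonization 𝓡 H, _ := fun x y => congrArg (fun z => x * z * y) h1
  simp only [Finset.mul_sum, Finset.sum_mul, mul_assoc] at h3 ⊢
  simp only [← mul_assoc (inH 𝓡 ((ℛ k h).left i)) (inT 𝓡 c.2)]
  rw [h3]
  simp only [Algebra.algebraMap_eq_smul_one, smul_mul_assoc, mul_smul_comm, one_mul, mul_one,
    mul_assoc]

noncomputable instance : HopfAlgebra k (Bosonization 𝓡 H) where
  antipode := ant 𝓡
  mul_antipode_rTensor_comul := by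
    ext x
    obtain ⟨x, rfl⟩ := (equiv 𝓡).symm.surjective x
    induction x using TensorProduct.induction_on with
    | zero => simp
    | add a b ha hb => simp only [map_add, ha, hb]
    | tmul h t => rw [equiv_symm_tmul, mk_eq]; exact ant_left 𝓡 h t
  mul_antipode_lTensor_comul := by
    ext x
    obtain ⟨x, rfl⟩ := (equiv 𝓡).symm.surjective x
    induction x using TensorProduct.induction_on with
    | zero => simp
    | add a b ha hb => simp only [map_add, ha, hb]
    | tmul h t => rw [equiv_symm_tmul, mk_eq]; exact ant_right 𝓡 h t

lemma proj_inH (h : H) : proj 𝓡 (inH 𝓡 h) = algebraMap k T (counit (R := k) h) := by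
  rw [proj, inH_apply, lift_mk, map_one, mul_one]; rfl

lemma proj_inT (t : T) : proj 𝓡 (H := H) (inT 𝓡 t) = t := by
  rw [proj, inT_apply, lift_mk, map_one, one_mul]; rfl

lemma counit_proj : (Bialgebra.counitAlgHom k T).comp (proj 𝓡) =
    Bialgebra.counitAlgHom k (Bosonization 𝓡 H) :=
  algHom_ext
    (fun y => by
      simp only [AlgHom.comp_apply, proj_inH, AlgHom.commutes]
      exact (counitHom_inH 𝓡 y).symm)
    (fun t => by
      simp only [AlgHom.comp_apply, proj_inT]
      exact (counitHom_inT 𝓡 t).symm)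

lemma proj_comH (y : H) :
    Algebra.TensorProduct.map (proj 𝓡) (proj 𝓡) (comH 𝓡 y) =
      algebraMap k _ (counit (R := k) y) := by
  have h := congrArg (counit (R := k)) (sum_counit_smul (ℛ k y))
  have h2 := 𝓡.counit_left_sum
  simp only [map_sum, map_smul, smul_eq_mul] at h h2
  rw [comH_expand, ← h, map_sum, map_sum]
  refine Finset.sum_congr rfl fun i _ => ?_
  rw [Algebra.algebraMap_eq_smul_one, Algebra.TensorProduct.one_def]
  conv_rhs => enter [2, 2]; rw [← h2]
  simp only [map_sum, Algebra.TensorProduct.map_tmul, map_mul, proj_inH, proj_inT, counit_act,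
    TensorProduct.sum_tmul, Finset.smul_sum]
  refine Finset.sum_congr rfl fun c _ => ?_
  simp only [Algebra.algebraMap_eq_smul_one, TensorProduct.tmul_smul, TensorProduct.smul_tmul',
    smul_mul_assoc, one_mul, mul_smul]
  rw [smul_comm (counit c.1)]
  simp only [smul_smul]
  congr 2
  ring

lemma comul_proj : (Algebra.TensorProduct.map (proj 𝓡) (proj 𝓡)).comp
      (Bialgebra.comulAlgHom k (Bosonization 𝓡 H)) =
    (Bialgebra.comulAlgHom k T).comp (proj 𝓡) :=
  algHom_ext
    (fun y => by
      simp only [AlgHom.comp_apply, proj_inH, AlgHom.commutes, ← proj_comH 𝓡, ← comulHom_inH]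
      rfl)
    (fun t => by
      simp only [AlgHom.comp_apply, proj_inT, Bialgebra.comulAlgHom_apply]
      rw [comul_eq, comulHom_inT, comT_sum]
      conv_rhs => rw [← (ℛ k t).eq]
      simp [proj_inT])

/-- The projection `π(h # t) = ε(h) t` is a map of bialgebras. -/
noncomputable def projBialg : Bosonization 𝓡 H →ₐc[k] T :=
  BialgHom.ofAlgHom (proj 𝓡) (counit_proj 𝓡) (comul_proj 𝓡)

end Bosonization
end Boson
end CentralHopf

namespace CentralHopf
section Rep

open Coalgebra

section Unbundled
variable {k : Type u} [Field k] {B : Type u} [Ring B] [HopfAlgebra k B]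
  {V W U : Type u} [AddCommGroup V] [Module k V] [AddCommGroup W] [Module k W]
  [AddCommGroup U] [Module k U]

/-- The tensor product of two representations, through the coproduct. -/
noncomputable def tρ (ρ : B →ₐ[k] Module.End k V) (σ : B →ₐ[k] Module.End k W) :
    B →ₐ[k] Module.End k (V ⊗[k] W) :=
  ((Module.endTensorEndAlgHom (R := k) (S := k) (A := k)).comp
    (Algebra.TensorProduct.map ρ σ)).comp (Bialgebra.comulAlgHom k B)

/-- The trivial representation. -/
noncomputable def uρ (k : Type u) [Field k] (B : Type u) [Ring B] [HopfAlgebra k B] :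
    B →ₐ[k] Module.End k k :=
  (Algebra.lmul k k).comp (Bialgebra.counitAlgHom k B)

/-- The dual representation, through the antipode. -/
noncomputable def dρ (ρ : B →ₐ[k] Module.End k V) : B →ₐ[k] Module.End k (Module.Dual k V) :=
  AlgHom.ofLinearMap (Module.Dual.transpose ∘ₗ ρ.toLinearMap ∘ₗ HopfAlgebra.antipode k)
    (by ext; simp [Module.Dual.transpose_apply]) (fun a b => by
      ext; simp [HopfAlgebra.antipode_mul_antidistrib, Module.Dual.transpose_apply])

variable (ρ : B →ₐ[k] Module.End k V) (σ : B →ₐ[k] Module.End k W)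
  (τ : B →ₐ[k] Module.End k U)

lemma tρ_sum (b : B) (v : V) (w : W) : tρ ρ σ b (v ⊗ₜ[k] w) =
    ∑ i ∈ (ℛ k b).index, ρ ((ℛ k b).left i) v ⊗ₜ[k] σ ((ℛ k b).right i) w := by
  simp only [tρ, AlgHom.comp_apply, Bialgebra.comulAlgHom_apply]
  conv_lhs => rw [← (ℛ k b).eq]
  simp [Module.endTensorEndAlgHom_apply]

@[simp] lemma uρ_apply (b : B) (x : k) : uρ k B b x = counit (R := k) b * x := rfl

@[simp] lemma dρ_apply (b : B) (f : Module.Dual k V) (v : V) :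
    dρ ρ b f v = f (ρ (HopfAlgebra.antipode k b) v) := rfl

/-- Evaluation of a representation at a vector. -/
noncomputable def evAt (v : V) : B →ₗ[k] V := ρ.toLinearMap.flip v

@[simp] lemma evAt_apply (v : V) (b : B) : evAt ρ v b = ρ b v := rfl

lemma assoc_comm (b : B) : (TensorProduct.assoc k V W U).toLinearMap ∘ₗ tρ (tρ ρ σ) τ b =
    tρ ρ (tρ σ τ) b ∘ₗ (TensorProduct.assoc k V W U).toLinearMap := by
  refine TensorProduct.ext_threefold fun v w u => ?_
  have h := congrArg (TensorProduct.map (evAt ρ v) (TensorProduct.map (evAt σ w) (evAt τ u)))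
    (sum_tmul_tmul_eq (ℛ k b) (fun i => ℛ k ((ℛ k b).left i)) (fun i => ℛ k ((ℛ k b).right i)))
  simpa [tρ_sum, TensorProduct.sum_tmul, TensorProduct.tmul_sum] using h

lemma lid_comm (b : B) : (TensorProduct.lid k V).toLinearMap ∘ₗ tρ (uρ k B) ρ b =
    ρ b ∘ₗ (TensorProduct.lid k V).toLinearMap := by
  refine TensorProduct.ext' fun x v => ?_
  have h := congrArg (evAt ρ v) (sum_counit_smul (ℛ k b))
  simp only [map_sum, map_smul, evAt_apply] at h
  simp [tρ_sum, ← h, Finset.smul_sum, mul_comm, smul_smul]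

lemma rid_comm (b : B) : (TensorProduct.rid k V).toLinearMap ∘ₗ tρ ρ (uρ k B) b =
    ρ b ∘ₗ (TensorProduct.rid k V).toLinearMap := by
  refine TensorProduct.ext' fun v x => ?_
  have h := congrArg ((TensorProduct.rid k V).toLinearMap ∘ₗ (evAt ρ v).rTensor k)
    (sum_tmul_counit_eq (ℛ k b))
  simp only [map_sum, LinearMap.comp_apply, LinearMap.rTensor_tmul, evAt_apply,
    LinearEquiv.coe_coe, TensorProduct.rid_tmul, one_smul] at h
  simp [tρ_sum, ← h, Finset.smul_sum, mul_comm, smul_smul]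

variable {ρ σ τ} in
lemma map_comm {V' W' : Type u} [AddCommGroup V'] [Module k V'] [AddCommGroup W'] [Module k W']
    {ρ' : B →ₐ[k] Module.End k V'} {σ' : B →ₐ[k] Module.End k W'}
    {f : V →ₗ[k] V'} {g : W →ₗ[k] W'} (hf : ∀ b, f ∘ₗ ρ b = ρ' b ∘ₗ f)
    (hg : ∀ b, g ∘ₗ σ b = σ' b ∘ₗ g) (b : B) :
    TensorProduct.map f g ∘ₗ tρ ρ σ b = tρ ρ' σ' b ∘ₗ TensorProduct.map f g := by
  refine TensorProduct.ext' fun v w => ?_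
  have hf' : ∀ b v, f (ρ b v) = ρ' b (f v) := fun b v => LinearMap.congr_fun (hf b) v
  have hg' : ∀ b v, g (σ b v) = σ' b (g v) := fun b v => LinearMap.congr_fun (hg b) v
  simp [tρ_sum, hf', hg']

lemma contract_comm (b : B) : contractLeft k V ∘ₗ tρ (dρ ρ) ρ b =
    uρ k B b ∘ₗ contractLeft k V := by
  refine TensorProduct.ext' fun f v => ?_
  have h := congrArg (f ∘ₗ evAt ρ v) (HopfAlgebra.sum_antipode_mul_eq_smul (ℛ k b))
  simpa [tρ_sum] using h

lemma coev_comm [Module.Finite k V] (b : B) : coevaluation k V ∘ₗ uρ k B b =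
    tρ ρ (dρ ρ) b ∘ₗ coevaluation k V := by
  let D : V ⊗[k] Module.Dual k V →ₗ[k] V →ₗ[k] V :=
    dualTensorHom k V V ∘ₗ (TensorProduct.comm k V (Module.Dual k V)).toLinearMap
  have key : Function.Injective D := by
    rw [LinearMap.coe_comp]
    exact dualTensorHom_bijective.1.comp (LinearEquiv.injective _)
  have hD : ∀ z, D (tρ ρ (dρ ρ) b z) = ∑ i ∈ (ℛ k b).index,
      ρ ((ℛ k b).left i) ∘ₗ D z ∘ₗ ρ (HopfAlgebra.antipode k ((ℛ k b).right i)) := by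
    intro z
    induction z using TensorProduct.induction_on with
    | zero => simp
    | add x y hx hy => simp [hx, hy, LinearMap.comp_add, LinearMap.add_comp, Finset.sum_add_distrib]
    | tmul v f =>
      ext w
      simp [tρ_sum, D, LinearMap.sum_apply]
  have h1 : D (coevaluation k V 1) = LinearMap.id := by
    ext w
    rw [coevaluation_apply_one]
    simp only [D, map_sum, LinearMap.comp_apply, LinearEquiv.coe_coe, TensorProduct.comm_tmul,
      LinearMap.sum_apply, dualTensorHom_apply, Module.Basis.coord_apply, LinearMap.id_apply]
    exact (Module.Basis.ofVectorSpace k V).sum_repr w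
  refine LinearMap.ext_ring (key ?_)
  have h := congrArg ρ (HopfAlgebra.sum_mul_antipode_eq_smul (ℛ k b))
  simp only [map_sum, map_smul, map_mul, map_one] at h
  change D (coevaluation k V (uρ k B b 1)) = D (tρ ρ (dρ ρ) b (coevaluation k V 1))
  rw [hD, h1]
  simp only [LinearMap.id_comp]
  refine Eq.trans ?_ h.symm
  rw [uρ_apply, ← smul_eq_mul, map_smul, map_smul, h1]
  rfl

end Unbundled


/-- Finite-dimensional representations of the `k`-algebra `B`. -/
structure FRep (k : Type u) [Field k] (B : Type u) [Ring B] [Algebra k B] where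
  V : Type u
  [addCommGroup : AddCommGroup V]
  [module : Module k V]
  [finite : Module.Finite k V]
  ρ : B →ₐ[k] Module.End k V

attribute [instance] FRep.addCommGroup FRep.module FRep.finite

namespace FRep

section Cat
variable {k : Type u} [Field k] {B : Type u} [Ring B] [Algebra k B]

/-- `B`-linear maps. -/
@[ext]
structure Hom (X Y : FRep k B) where
  hom : X.V →ₗ[k] Y.V
  comm : ∀ b : B, hom ∘ₗ X.ρ b = Y.ρ b ∘ₗ hom

instance : Category (FRep k B) where
  Hom X Y := Hom X Y
  id X := ⟨LinearMap.id, fun _ => rfl⟩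
  comp f g := ⟨g.hom ∘ₗ f.hom, fun b => by
    rw [LinearMap.comp_assoc, f.comm, ← LinearMap.comp_assoc, g.comm, LinearMap.comp_assoc]⟩

@[ext]
lemma hom_ext {X Y : FRep k B} {f g : X ⟶ Y} (h : f.hom = g.hom) : f = g := Hom.ext h

@[simp] lemma id_hom (X : FRep k B) : Hom.hom (𝟙 X) = LinearMap.id := rfl
@[simp] lemma comp_hom {X Y Z : FRep k B} (f : X ⟶ Y) (g : Y ⟶ Z) :
    (f ≫ g).hom = g.hom ∘ₗ f.hom := rfl

lemma hom_comm {X Y : FRep k B} (f : X ⟶ Y) (b : B) (x : X.V) :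
    f.hom (X.ρ b x) = Y.ρ b (f.hom x) := LinearMap.congr_fun (f.comm b) x

/-- A `B`-linear bijection is an isomorphism of representations. -/
def mkIso {X Y : FRep k B} (e : X.V ≃ₗ[k] Y.V)
    (h : ∀ b, e.toLinearMap ∘ₗ X.ρ b = Y.ρ b ∘ₗ e.toLinearMap) : X ≅ Y where
  hom := ⟨e.toLinearMap, h⟩
  inv := ⟨e.symm.toLinearMap, fun b => LinearMap.ext fun y => e.injective (by
    have := LinearMap.congr_fun (h b) (e.symm y)
    simpa using this.symm)⟩
  hom_inv_id := by ext; simp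
  inv_hom_id := by ext; simp

@[simp] lemma mkIso_hom_hom {X Y : FRep k B} (e : X.V ≃ₗ[k] Y.V) (h) :
    (mkIso e h : X ≅ Y).hom.hom = e.toLinearMap := rfl
@[simp] lemma mkIso_inv_hom {X Y : FRep k B} (e : X.V ≃ₗ[k] Y.V) (h) :
    (mkIso e h : X ≅ Y).inv.hom = e.symm.toLinearMap := rfl

end Cat

variable {k : Type u} [Field k] {B : Type u} [Ring B] [HopfAlgebra k B]

noncomputable instance : MonoidalCategoryStruct (FRep k B) where
  tensorObj X Y := { V := X.V ⊗[k] Y.V, ρ := tρ X.ρ Y.ρ }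
  tensorUnit := { V := k, ρ := uρ k B }
  whiskerLeft X _ _ f := ⟨f.hom.lTensor X.V, map_comm (fun _ => rfl) f.comm⟩
  whiskerRight f Y := ⟨f.hom.rTensor Y.V, map_comm f.comm (fun _ => rfl)⟩
  tensorHom f g := ⟨TensorProduct.map f.hom g.hom, map_comm f.comm g.comm⟩
  associator X Y Z := mkIso (TensorProduct.assoc k X.V Y.V Z.V) (assoc_comm X.ρ Y.ρ Z.ρ)
  leftUnitor X := mkIso (TensorProduct.lid k X.V) (lid_comm X.ρ)
  rightUnitor X := mkIso (TensorProduct.rid k X.V) (rid_comm X.ρ)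

noncomputable instance : MonoidalCategory (FRep k B) where
  tensorHom_def f g := Hom.ext (TensorProduct.ext' fun _ _ => rfl)
  id_tensorHom_id X Y := Hom.ext (TensorProduct.ext' fun _ _ => rfl)
  tensorHom_comp_tensorHom f₁ f₂ g₁ g₂ := Hom.ext (TensorProduct.ext' fun _ _ => rfl)
  whiskerLeft_id X Y := Hom.ext (TensorProduct.ext' fun _ _ => rfl)
  id_whiskerRight X Y := Hom.ext (TensorProduct.ext' fun _ _ => rfl)
  associator_naturality f g h := Hom.ext (TensorProduct.ext_threefold fun _ _ _ => rfl)
  leftUnitor_naturality f := Hom.ext (TensorProduct.ext' fun x y => (map_smul f.hom x y).symm)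
  rightUnitor_naturality f := Hom.ext (TensorProduct.ext' fun x y => (map_smul f.hom y x).symm)
  pentagon W X Y Z := Hom.ext (TensorProduct.ext_fourfold fun _ _ _ _ => rfl)
  triangle X Y := Hom.ext (TensorProduct.ext_threefold fun x r y =>
    (TensorProduct.smul_tmul r x y).symm)

noncomputable instance (X : FRep k B) : HasRightDual X where
  rightDual := { V := Module.Dual k X.V, ρ := dρ X.ρ }
  exact :=
    { coevaluation' := ⟨coevaluation k X.V, coev_comm X.ρ⟩
      evaluation' := ⟨contractLeft k X.V, contract_comm X.ρ⟩
      coevaluation_evaluation' := Hom.ext (contractLeft_assoc_coevaluation k X.V)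
      evaluation_coevaluation' := Hom.ext (contractLeft_assoc_coevaluation' k X.V) }

noncomputable instance : RightRigidCategory (FRep k B) where

end FRep
end Rep
end CentralHopf

namespace CentralHopf
section Center

open Coalgebra

variable {k : Type u} [Field k] {T : Type u} [Ring T] [HopfAlgebra k T]

namespace RMatrix
variable (𝓡 : RMatrix k T) {V W : Type u}
    [AddCommGroup V] [Module k V] [AddCommGroup W] [Module k W]
    (ρV : T →ₐ[k] Module.End k V) (ρW : T →ₐ[k] Module.End k W)

/-- The braiding as a linear isomorphism. -/
noncomputable def braidEquiv : V ⊗[k] W ≃ₗ[k] W ⊗[k] V :=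
  (LinearMap.GeneralLinearGroup.generalLinearEquiv k (V ⊗[k] W)
    (Units.map ((Module.endTensorEndAlgHom (R := k) (S := k) (A := k)).comp
      (Algebra.TensorProduct.map ρV ρW)).toRingHom.toMonoidHom 𝓡.R)).trans
    (TensorProduct.comm k V W)

lemma braidEquiv_eq : (𝓡.braidEquiv ρV ρW).toLinearMap = 𝓡.braid ρV ρW := rfl

lemma braidEquiv_tmul (v : V) (w : W) : 𝓡.braidEquiv ρV ρW (v ⊗ₜ[k] w) =
    ∑ i ∈ 𝓡.supp, ρW i.2 w ⊗ₜ[k] ρV i.1 v := by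
  change 𝓡.braid ρV ρW (v ⊗ₜ[k] w) = _
  simp [braid, 𝓡.R_eq, Module.endTensorEndAlgHom_apply]

end RMatrix

variable (𝓡 : RMatrix k T) {H : Type u} [Ring H] [Algebra k H] [Coalgebra k H]
  [BraidedHopfAlgebra 𝓡 H]

open BraidedHopfAlgebra Bosonization

section
variable {V W V' W' : Type u}
    [AddCommGroup V] [Module k V] [AddCommGroup W] [Module k W]
    [AddCommGroup V'] [Module k V'] [AddCommGroup W'] [Module k W']
    (ρV : T →ₐ[k] Module.End k V) (ρV' : T →ₐ[k] Module.End k V')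
    (ρW : Bosonization 𝓡 H →ₐ[k] Module.End k W) (ρW' : Bosonization 𝓡 H →ₐ[k] Module.End k W')

lemma tρ_inT (ρ : Bosonization 𝓡 H →ₐ[k] Module.End k V)
    (σ : Bosonization 𝓡 H →ₐ[k] Module.End k W) (t : T) :
    tρ ρ σ (inT 𝓡 t) = tρ (ρ.comp (inT 𝓡)) (σ.comp (inT 𝓡)) t := by
  refine TensorProduct.ext' fun v w => ?_
  rw [tρ_sum (ρ.comp (inT 𝓡)), tρ, AlgHom.comp_apply, Bialgebra.comulAlgHom_apply, comul_eq,
    comulHom_inT, comT_sum]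
  simp [Module.endTensorEndAlgHom_apply]

lemma tρ_inH (ρ : Bosonization 𝓡 H →ₐ[k] Module.End k V)
    (σ : Bosonization 𝓡 H →ₐ[k] Module.End k W) (y : H) (v : V) (w : W) :
    tρ ρ σ (inH 𝓡 y) (v ⊗ₜ[k] w) = ∑ i ∈ (ℛ k y).index, ∑ c ∈ 𝓡.supp,
      ρ (inH 𝓡 ((ℛ k y).left i)) (ρ (inT 𝓡 c.2) v) ⊗ₜ[k]
        σ (inH 𝓡 (act (𝓡 := 𝓡) c.1 ((ℛ k y).right i))) w := by
  rw [tρ, AlgHom.comp_apply, Bialgebra.comulAlgHom_apply, comul_eq, comulHom_inH, comH_expand]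
  simp [Module.endTensorEndAlgHom_apply]

lemma tρ_inH_left (ρ : T →ₐ[k] Module.End k V)
    (σ : Bosonization 𝓡 H →ₐ[k] Module.End k W) (y : H) (v : V) (w : W) :
    tρ (ρ.comp (proj 𝓡)) σ (inH 𝓡 y) (v ⊗ₜ[k] w) = ∑ c ∈ 𝓡.supp,
      ρ c.2 v ⊗ₜ[k] σ (inH 𝓡 (act (𝓡 := 𝓡) c.1 y)) w := by
  rw [tρ_inH, Finset.sum_comm]
  refine Finset.sum_congr rfl fun c _ => ?_
  have h := congrArg (fun z => ρ c.2 v ⊗ₜ[k] σ (inH 𝓡 (act (𝓡 := 𝓡) c.1 z)) w)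
    (sum_counit_smul (ℛ k y))
  simp only [map_sum, map_smul, LinearMap.sum_apply, LinearMap.smul_apply,
    TensorProduct.tmul_sum, TensorProduct.tmul_smul] at h
  rw [← h]
  refine Finset.sum_congr rfl fun i _ => ?_
  simp [proj_inH, proj_inT, Algebra.algebraMap_eq_smul_one, TensorProduct.smul_tmul']

lemma tρ_inH_right (ρ : Bosonization 𝓡 H →ₐ[k] Module.End k V)
    (σ : T →ₐ[k] Module.End k W) (y : H) (v : V) (w : W) :
    tρ ρ (σ.comp (proj 𝓡)) (inH 𝓡 y) (v ⊗ₜ[k] w) = ρ (inH 𝓡 y) v ⊗ₜ[k] w := by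
  rw [tρ_inH]
  have h := congrArg ((TensorProduct.rid k _).toLinearMap ∘ₗ
    TensorProduct.map (inH 𝓡).toLinearMap LinearMap.id) (sum_tmul_counit_eq (ℛ k y))
  simp only [map_sum, TensorProduct.map_tmul, LinearMap.comp_apply, LinearEquiv.coe_coe,
    TensorProduct.rid_tmul, LinearMap.id_apply, AlgHom.toLinearMap_apply, one_smul] at h
  have h2 := congrArg (fun x => ρ (inT 𝓡 x) v) 𝓡.counit_left_sum
  simp only [map_sum, map_smul, map_one, LinearMap.sum_apply, LinearMap.smul_apply,
    Module.End.one_apply] at h2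
  rw [← h]
  simp only [map_sum, map_smul, LinearMap.sum_apply, LinearMap.smul_apply, TensorProduct.sum_tmul]
  refine Finset.sum_congr rfl fun i _ => ?_
  conv_rhs => rw [← h2]
  simp only [map_sum, map_smul, TensorProduct.sum_tmul, Finset.smul_sum]
  refine Finset.sum_congr rfl fun c _ => ?_
  simp [proj_inH, counit_act, Algebra.algebraMap_eq_smul_one, TensorProduct.smul_tmul', smul_smul,
    mul_comm]

lemma hb_inT (t : T) :
    (𝓡.braidEquiv (ρW.comp (inT 𝓡)) ρV).toLinearMap ∘ₗ tρ ρW (ρV.comp (proj 𝓡)) (inT 𝓡 t) =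
      tρ (ρV.comp (proj 𝓡)) ρW (inT 𝓡 t) ∘ₗ (𝓡.braidEquiv (ρW.comp (inT 𝓡)) ρV).toLinearMap := by
  refine TensorProduct.ext' fun w v => ?_
  let Φ : T ⊗[k] T →ₗ[k] V ⊗[k] W :=
    TensorProduct.map (evAt ρV v) (evAt (ρW.comp (inT 𝓡)) w) ∘ₗ
      (TensorProduct.comm k T T).toLinearMap
  have h := congrArg Φ (𝓡.cocomm_sum t)
  simp only [Φ, map_sum, LinearMap.comp_apply, LinearEquiv.coe_coe, TensorProduct.comm_tmul,
    TensorProduct.map_tmul, evAt_apply, map_mul, Module.End.mul_apply, AlgHom.comp_apply] at h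
  simp only [tρ_inT, LinearMap.comp_apply, LinearEquiv.coe_coe, tρ_sum, map_sum,
    RMatrix.braidEquiv_tmul, AlgHom.comp_apply, proj_inT]
  rw [Finset.sum_comm (s := 𝓡.supp), h]

lemma hb_inH (y : H) :
    (𝓡.braidEquiv (ρW.comp (inT 𝓡)) ρV).toLinearMap ∘ₗ tρ ρW (ρV.comp (proj 𝓡)) (inH 𝓡 y) =
      tρ (ρV.comp (proj 𝓡)) ρW (inH 𝓡 y) ∘ₗ (𝓡.braidEquiv (ρW.comp (inT 𝓡)) ρV).toLinearMap := by
  refine TensorProduct.ext' fun w v => ?_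
  let Φ : T ⊗[k] (T ⊗[k] T) →ₗ[k] V ⊗[k] W :=
    TensorProduct.map (evAt ρV v)
      (evAt ρW w ∘ₗ LinearMap.mul' k _ ∘ₗ TensorProduct.map ((inH 𝓡).toLinearMap ∘ₗ orb 𝓡 y)
        (inT 𝓡).toLinearMap) ∘ₗ
      (TensorProduct.comm k (T ⊗[k] T) T).toLinearMap ∘ₗ
      (TensorProduct.assoc k T T T).symm.toLinearMap
  have h := congrArg Φ 𝓡.comul_left_sum
  simp only [Φ, map_sum, LinearMap.comp_apply, LinearEquiv.coe_coe, TensorProduct.comm_tmul,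
    TensorProduct.assoc_symm_tmul, LinearMap.mul'_apply, orb_apply, AlgHom.toLinearMap_apply,
    TensorProduct.map_tmul, evAt_apply, map_mul, Module.End.mul_apply] at h
  simp only [LinearMap.comp_apply, LinearEquiv.coe_coe, tρ_inH_left, tρ_inH_right, map_sum,
    RMatrix.braidEquiv_tmul, AlgHom.comp_apply]
  rw [Finset.sum_comm (s := 𝓡.supp), ← h]
  refine Finset.sum_congr rfl fun i _ => ?_
  rw [← Module.End.mul_apply, ← map_mul, inT_mul_inH]
  simp only [map_sum, map_mul, LinearMap.sum_apply, TensorProduct.tmul_sum, Module.End.mul_apply]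

lemma hb_comm (b : Bosonization 𝓡 H) :
    (𝓡.braidEquiv (ρW.comp (inT 𝓡)) ρV).toLinearMap ∘ₗ tρ ρW (ρV.comp (proj 𝓡)) b =
      tρ (ρV.comp (proj 𝓡)) ρW b ∘ₗ (𝓡.braidEquiv (ρW.comp (inT 𝓡)) ρV).toLinearMap := by
  obtain ⟨x, rfl⟩ := (Bosonization.equiv 𝓡).symm.surjective b
  induction x using TensorProduct.induction_on with
  | zero => simp
  | add a b ha hb => simp only [map_add, ha, hb, LinearMap.comp_add, LinearMap.add_comp]
  | tmul h t =>
    rw [equiv_symm_tmul, mk_eq, map_mul, map_mul, Module.End.mul_eq_comp, Module.End.mul_eq_comp,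
      ← LinearMap.comp_assoc, hb_inH, LinearMap.comp_assoc, hb_inT, LinearMap.comp_assoc]

end

/-- The representation of `H # T` on `V` through `π : H # T → T`. -/
noncomputable abbrev pull (V : FRep k T) : FRep k (Bosonization 𝓡 H) where
  V := V.V
  ρ := V.ρ.comp (proj 𝓡)

/-- The restriction of a representation of `H # T` to `T`. -/
noncomputable abbrev res (W : FRep k (Bosonization 𝓡 H)) : FRep k T where
  V := W.V
  ρ := W.ρ.comp (inT 𝓡)

/-- The isomorphism `W ⊗ V ≅ V ⊗ W`, `w ⊗ v ↦ R² v ⊗ R¹ w`, of representations of `H # T`. -/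
noncomputable def hbIso (V : FRep k T) (W : FRep k (Bosonization 𝓡 H)) :
    W ⊗ pull 𝓡 V ≅ pull 𝓡 V ⊗ W :=
  FRep.mkIso (X := W ⊗ pull 𝓡 V) (Y := pull 𝓡 V ⊗ W) (𝓡.braidEquiv (W.ρ.comp (inT 𝓡)) V.ρ)
    (hb_comm 𝓡 V.ρ W.ρ)

lemma hbIso_tmul (V : FRep k T) (W : FRep k (Bosonization 𝓡 H)) (w : W.V) (v : V.V) :
    (hbIso 𝓡 V W).hom.hom (w ⊗ₜ[k] v : W.V ⊗[k] V.V) =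
      (∑ i ∈ 𝓡.supp, V.ρ i.2 v ⊗ₜ[k] W.ρ (inT 𝓡 i.1) w : V.V ⊗[k] W.V) :=
  𝓡.braidEquiv_tmul _ _ _ _

lemma hbIso_monoidal (V : FRep k T) (W W' : FRep k (Bosonization 𝓡 H)) :
    (hbIso 𝓡 V (W ⊗ W')).hom = (α_ W W' (pull 𝓡 V)).hom ≫ W ◁ (hbIso 𝓡 V W').hom ≫
      (α_ W (pull 𝓡 V) W').inv ≫ (hbIso 𝓡 V W).hom ▷ W' ≫ (α_ (pull 𝓡 V) W W').hom := by
  refine FRep.Hom.ext (TensorProduct.ext_threefold fun w w' v => ?_)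
  have hl : ∀ z : W.V ⊗[k] (W'.V ⊗[k] V.V),
      ((α_ W (pull 𝓡 V) W').inv ≫ (hbIso 𝓡 V W).hom ▷ W' ≫ (α_ (pull 𝓡 V) W W').hom).hom
        (LinearMap.lTensor W.V (𝓡.braidEquiv (W'.ρ.comp (inT 𝓡)) V.ρ).toLinearMap z) =
      (TensorProduct.assoc k V.V W.V W'.V) (LinearMap.rTensor W'.V
        (𝓡.braidEquiv (W.ρ.comp (inT 𝓡)) V.ρ).toLinearMap
        ((TensorProduct.assoc k W.V V.V W'.V).symm (LinearMap.lTensor W.V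
          (𝓡.braidEquiv (W'.ρ.comp (inT 𝓡)) V.ρ).toLinearMap z))) := fun _ => rfl
  refine Eq.trans ?_ (hl (w ⊗ₜ[k] (w' ⊗ₜ[k] v))).symm
  change 𝓡.braidEquiv ((tρ W.ρ W'.ρ).comp (inT 𝓡)) V.ρ ((w ⊗ₜ[k] w') ⊗ₜ[k] v) = _
  let Φ : T ⊗[k] (T ⊗[k] T) →ₗ[k] V.V ⊗[k] (W.V ⊗[k] W'.V) :=
    TensorProduct.map (evAt V.ρ v)
      (TensorProduct.map (evAt (W.ρ.comp (inT 𝓡)) w) (evAt (W'.ρ.comp (inT 𝓡)) w')) ∘ₗ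
      (TensorProduct.comm k (T ⊗[k] T) T).toLinearMap ∘ₗ
      (TensorProduct.assoc k T T T).symm.toLinearMap
  have h := congrArg Φ 𝓡.comul_left_sum
  simp only [Φ, map_sum, LinearMap.comp_apply, LinearEquiv.coe_coe, TensorProduct.comm_tmul,
    TensorProduct.assoc_symm_tmul, TensorProduct.map_tmul, evAt_apply, map_mul,
    Module.End.mul_apply, AlgHom.comp_apply] at h
  simp only [RMatrix.braidEquiv_tmul, AlgHom.comp_apply, tρ_inT, tρ_sum, LinearMap.lTensor_tmul,
    LinearMap.rTensor_tmul, LinearEquiv.coe_coe, TensorProduct.tmul_sum, TensorProduct.sum_tmul,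
    map_sum, TensorProduct.assoc_symm_tmul, TensorProduct.assoc_tmul]
  rw [h, Finset.sum_comm]

lemma hbIso_natural (V : FRep k T) {W W' : FRep k (Bosonization 𝓡 H)} (f : W ⟶ W') :
    (hbIso 𝓡 V W).hom ≫ pull 𝓡 V ◁ f = f ▷ pull 𝓡 V ≫ (hbIso 𝓡 V W').hom := by
  refine FRep.Hom.ext (TensorProduct.ext' fun w v => ?_)
  change LinearMap.lTensor V.V f.hom (𝓡.braidEquiv (W.ρ.comp (inT 𝓡)) V.ρ (w ⊗ₜ[k] v)) =
    𝓡.braidEquiv (W'.ρ.comp (inT 𝓡)) V.ρ (f.hom w ⊗ₜ[k] v)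
  simp [RMatrix.braidEquiv_tmul, FRep.hom_comm]

/-- A `T`-linear map as an `H # T`-linear map. -/
noncomputable def pullMap {V V' : FRep k T} (f : V ⟶ V') : pull 𝓡 (H := H) V ⟶ pull 𝓡 V' :=
  ⟨f.hom, fun b => f.comm (proj 𝓡 b)⟩

lemma hbIso_natural_left {V V' : FRep k T} (f : V ⟶ V') (W : FRep k (Bosonization 𝓡 H)) :
    (hbIso 𝓡 V W).hom ≫ pullMap 𝓡 f ▷ W = W ◁ pullMap 𝓡 f ≫ (hbIso 𝓡 V' W).hom := by
  refine FRep.Hom.ext (TensorProduct.ext' fun w v => ?_)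
  change LinearMap.rTensor W.V f.hom (𝓡.braidEquiv (W.ρ.comp (inT 𝓡)) V.ρ (w ⊗ₜ[k] v)) =
    𝓡.braidEquiv (W.ρ.comp (inT 𝓡)) V'.ρ (w ⊗ₜ[k] f.hom v)
  simp [RMatrix.braidEquiv_tmul, FRep.hom_comm]

lemma hbIso_natural_inv {V V' : FRep k T} (f : V ⟶ V') (W : FRep k (Bosonization 𝓡 H)) :
    pullMap 𝓡 f ▷ W ≫ (hbIso 𝓡 V' W).inv = (hbIso 𝓡 V W).inv ≫ W ◁ pullMap 𝓡 f := by
  rw [Iso.comp_inv_eq, Category.assoc, Iso.eq_inv_comp]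
  exact hbIso_natural_left 𝓡 f W

/-- The functor `V ↦ (V, σ^V)` from representations of `T` to the centre of the representations
of `H # T`; `σ^V_W : V ⊗ W → W ⊗ V` is the inverse of the braiding `W ⊗ V → V ⊗ W` of
representations of `T`. -/
noncomputable def toCenterObj (V : FRep k T) : Center (FRep k (Bosonization 𝓡 H)) :=
  ⟨pull 𝓡 V,
    { β := fun W => (hbIso 𝓡 V W).symm
      monoidal := fun W W' => by
        rw [← cancel_epi (hbIso 𝓡 V (W ⊗ W')).hom, Iso.symm_hom, Iso.hom_inv_id, hbIso_monoidal]
        simp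
      naturality := fun {W W'} f => by
        rw [Iso.symm_hom, Iso.symm_hom, Iso.comp_inv_eq, Category.assoc, Iso.eq_inv_comp]
        exact hbIso_natural 𝓡 V f }⟩

lemma tρ_proj (V V' : FRep k T) (b : Bosonization 𝓡 H) :
    tρ (V.ρ.comp (proj 𝓡)) (V'.ρ.comp (proj 𝓡)) b = tρ V.ρ V'.ρ (proj 𝓡 b) := by
  have h := AlgHom.congr_fun (comul_proj (H := H) 𝓡) b
  simp only [AlgHom.comp_apply] at h
  rw [tρ, tρ, AlgHom.comp_apply, AlgHom.comp_apply, AlgHom.comp_apply, AlgHom.comp_apply,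
    ← h, Algebra.TensorProduct.map_comp]
  rfl

lemma uρ_proj (b : Bosonization 𝓡 H) : uρ k T (proj 𝓡 b) = uρ k (Bosonization 𝓡 H) b := by
  have h := AlgHom.congr_fun (counit_proj (H := H) 𝓡) b
  simp only [AlgHom.comp_apply] at h
  rw [uρ, uρ, AlgHom.comp_apply, AlgHom.comp_apply, h]

/-- The identity of `V ⊗ V'`. -/
noncomputable def pullTensor (V V' : FRep k T) :
    pull 𝓡 (H := H) V ⊗ pull 𝓡 V' ≅ pull 𝓡 (V ⊗ V') :=
  FRep.mkIso (LinearEquiv.refl k (V.V ⊗[k] V'.V)) (fun b => tρ_proj 𝓡 V V' b)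

/-- The identity of `k`. -/
noncomputable def pullUnit : 𝟙_ (FRep k (Bosonization 𝓡 H)) ≅ pull 𝓡 (𝟙_ (FRep k T)) :=
  FRep.mkIso (LinearEquiv.refl k k) (fun b => (uρ_proj 𝓡 b).symm)

variable (H) in
/-- The functor `V ↦ (V_π, σ^V)`. -/
noncomputable def toCenter : FRep k T ⥤ Center (FRep k (Bosonization 𝓡 H)) where
  obj V := toCenterObj 𝓡 V
  map {V V'} f :=
    { f := pullMap 𝓡 f
      comm := fun W => (hbIso_natural_inv 𝓡 f W :
        pullMap 𝓡 f ▷ W ≫ (hbIso 𝓡 V' W).inv = (hbIso 𝓡 V W).inv ≫ W ◁ pullMap 𝓡 f) }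
  map_id V := rfl
  map_comp f g := rfl

lemma hbIso_tensor (V V' : FRep k T) (W : FRep k (Bosonization 𝓡 H)) :
    W ◁ (pullTensor 𝓡 V V').hom ≫ (hbIso 𝓡 (V ⊗ V') W).hom =
      (α_ W (pull 𝓡 V) (pull 𝓡 V')).inv ≫ (hbIso 𝓡 V W).hom ▷ pull 𝓡 V' ≫
      (α_ (pull 𝓡 V) W (pull 𝓡 V')).hom ≫ pull 𝓡 V ◁ (hbIso 𝓡 V' W).hom ≫
      (α_ (pull 𝓡 V) (pull 𝓡 V') W).inv ≫ (pullTensor 𝓡 V V').hom ▷ W := by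
  refine FRep.Hom.ext (TensorProduct.ext (LinearMap.ext fun w =>
    TensorProduct.ext' fun v v' => ?_))
  change 𝓡.braidEquiv (W.ρ.comp (inT 𝓡)) (tρ V.ρ V'.ρ) (w ⊗ₜ[k] (v ⊗ₜ[k] v')) =
    LinearMap.rTensor W.V (LinearMap.id (M := V.V ⊗[k] V'.V))
    ((TensorProduct.assoc k V.V V'.V W.V).symm (LinearMap.lTensor V.V
      (𝓡.braidEquiv (W.ρ.comp (inT 𝓡)) V'.ρ).toLinearMap
      ((TensorProduct.assoc k V.V W.V V'.V) (LinearMap.rTensor V'.V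
        (𝓡.braidEquiv (W.ρ.comp (inT 𝓡)) V.ρ).toLinearMap ((w ⊗ₜ[k] v) ⊗ₜ[k] v')))))
  rw [LinearMap.rTensor_id, LinearMap.id_apply]
  let Φ : T ⊗[k] (T ⊗[k] T) →ₗ[k] (V.V ⊗[k] V'.V) ⊗[k] W.V :=
    TensorProduct.map (TensorProduct.map (evAt V.ρ v) (evAt V'.ρ v'))
      (evAt (W.ρ.comp (inT 𝓡)) w) ∘ₗ (TensorProduct.comm k T (T ⊗[k] T)).toLinearMap
  have h := congrArg Φ 𝓡.comul_right_sum
  simp only [Φ, map_sum, LinearMap.comp_apply, LinearEquiv.coe_coe, TensorProduct.comm_tmul,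
    TensorProduct.map_tmul, evAt_apply, map_mul,
    Module.End.mul_apply, AlgHom.comp_apply] at h
  simp only [RMatrix.braidEquiv_tmul, AlgHom.comp_apply, tρ_sum, LinearMap.lTensor_tmul,
    LinearMap.rTensor_tmul, LinearEquiv.coe_coe, TensorProduct.tmul_sum, TensorProduct.sum_tmul,
    map_sum, TensorProduct.assoc_symm_tmul, TensorProduct.assoc_tmul]
  rw [h, Finset.sum_comm]

lemma hbIso_unit (W : FRep k (Bosonization 𝓡 H)) :
    W ◁ (pullUnit 𝓡).hom ≫ (hbIso 𝓡 (𝟙_ (FRep k T)) W).hom =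
      (ρ_ W).hom ≫ (λ_ W).inv ≫ (pullUnit 𝓡).hom ▷ W := by
  refine FRep.Hom.ext (TensorProduct.ext' fun w x => ?_)
  change 𝓡.braidEquiv (W.ρ.comp (inT 𝓡)) (uρ k T) (w ⊗ₜ[k] x) =
    (TensorProduct.lid k W.V).symm (TensorProduct.rid k W.V (w ⊗ₜ[k] x))
  have h2 := congrArg (fun x => W.ρ (inT 𝓡 x) w) 𝓡.counit_right_sum
  simp only [map_sum, map_smul, map_one, LinearMap.sum_apply, LinearMap.smul_apply,
    Module.End.one_apply] at h2
  rw [RMatrix.braidEquiv_tmul, TensorProduct.rid_tmul, TensorProduct.lid_symm_apply,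
    ← TensorProduct.smul_tmul]
  conv_rhs => rw [← h2]
  rw [TensorProduct.tmul_sum]
  refine Finset.sum_congr rfl fun c _ => ?_
  rw [← TensorProduct.smul_tmul]
  simp [mul_comm]

lemma hbIso_tensor_inv (V V' : FRep k T) (W : FRep k (Bosonization 𝓡 H)) :
    (pullTensor 𝓡 V V').hom ▷ W ≫ (hbIso 𝓡 (V ⊗ V') W).inv =
      ((α_ _ _ _).hom ≫ pull 𝓡 V ◁ (hbIso 𝓡 V' W).inv ≫
        (α_ _ _ _).inv ≫ (hbIso 𝓡 V W).inv ▷ pull 𝓡 V' ≫ (α_ _ _ _).hom) ≫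
      W ◁ (pullTensor 𝓡 V V').hom := by
  rw [Iso.comp_inv_eq]
  simp only [Category.assoc, hbIso_tensor]
  simp

lemma hbIso_unit_inv (W : FRep k (Bosonization 𝓡 H)) :
    (pullUnit 𝓡).hom ▷ W ≫ (hbIso 𝓡 (𝟙_ (FRep k T)) W).inv =
      ((λ_ W).hom ≫ (ρ_ W).inv) ≫ W ◁ (pullUnit 𝓡).hom := by
  rw [Iso.comp_inv_eq]
  simp only [Category.assoc, hbIso_unit]
  simp

noncomputable def toCenterμ (V V' : FRep k T) :
    (toCenter 𝓡 H).obj V ⊗ (toCenter 𝓡 H).obj V' ≅ (toCenter 𝓡 H).obj (V ⊗ V') :=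
  @Center.isoMk _ _ _ ((toCenter 𝓡 H).obj V ⊗ (toCenter 𝓡 H).obj V') _
    ⟨(pullTensor 𝓡 V V').hom, hbIso_tensor_inv 𝓡 V V'⟩
    (inferInstance : IsIso (pullTensor 𝓡 V V').hom)

noncomputable def toCenterε :
    𝟙_ (Center (FRep k (Bosonization 𝓡 H))) ≅ (toCenter 𝓡 H).obj (𝟙_ (FRep k T)) :=
  @Center.isoMk _ _ _ (𝟙_ (Center (FRep k (Bosonization 𝓡 H)))) _
    ⟨(pullUnit 𝓡).hom, hbIso_unit_inv 𝓡⟩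
    (inferInstance : IsIso (pullUnit 𝓡).hom)

noncomputable instance : (toCenter 𝓡 H).Monoidal :=
  Functor.CoreMonoidal.toMonoidal
    { εIso := toCenterε 𝓡
      μIso := toCenterμ 𝓡
      μIso_hom_natural_left := fun f V =>
        Center.ext _ _ (FRep.Hom.ext (TensorProduct.ext' fun _ _ => rfl))
      μIso_hom_natural_right := fun V f =>
        Center.ext _ _ (FRep.Hom.ext (TensorProduct.ext' fun _ _ => rfl))
      associativity := fun V V' V'' =>
        Center.ext _ _ (FRep.Hom.ext (TensorProduct.ext_threefold fun _ _ _ => rfl))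
      left_unitality := fun V =>
        Center.ext _ _ (FRep.Hom.ext (TensorProduct.ext' fun _ _ => rfl))
      right_unitality := fun V =>
        Center.ext _ _ (FRep.Hom.ext (TensorProduct.ext' fun _ _ => rfl)) }

end Center
end CentralHopf

namespace CentralHopf
section General

open MonoidalLeftAction

variable {𝒱 C M : Type*} [Category* 𝒱] [MonoidalCategory 𝒱] [RightRigidCategory 𝒱]
  [Category* C] [MonoidalCategory C] [Category* M] [MonoidalLeftAction C M]

variable (C M) in
/-- Internal Homs of a module category: for each `m`, a right adjoint `n ↦ hom m n` of
`X ↦ X ⊙ m`. -/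
structure InternalHom where
  hom : M → M ⥤ C
  adj : ∀ m : M, actionRight C m ⊣ hom m

namespace InternalHom
variable (ih : InternalHom C M)

/-- The bijection `Hom(X, hom(m, n)) → Hom(X ⊙ m, n)`. -/
def φ {X : C} {m n : M} (f : X ⟶ (ih.hom m).obj n) : X ⊙ₗ m ⟶ n :=
  ((ih.adj m).homEquiv X n).symm f

/-- The bijection `Hom(X ⊙ m, n) → Hom(X, hom(m, n))`. -/
def ψ {X : C} {m n : M} (f : X ⊙ₗ m ⟶ n) : X ⟶ (ih.hom m).obj n :=
  (ih.adj m).homEquiv X n f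

/-- Evaluation `hom(m, n) ⊙ m ⟶ n`. -/
def ev (m n : M) : (ih.hom m).obj n ⊙ₗ m ⟶ n := ih.φ (𝟙 _)

/-- Coevaluation `X ⟶ hom(m, X ⊙ m)`. -/
def coev (X : C) (m : M) : X ⟶ (ih.hom m).obj (X ⊙ₗ m) := ih.ψ (𝟙 _)

/-- The contravariant action `hom(m, n) ⟶ hom(m', n)` of `f : m' ⟶ m`. -/
def pre {m' m : M} (f : m' ⟶ m) (n : M) : (ih.hom m).obj n ⟶ (ih.hom m').obj n :=
  ih.ψ ((ih.hom m).obj n ⊴ₗ f ≫ ih.ev m n)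

/-- Composition `hom(m₂, m₃) ⊗ hom(m₁, m₂) ⟶ hom(m₁, m₃)`. -/
def comp (m₁ m₂ m₃ : M) :
    (ih.hom m₂).obj m₃ ⊗ (ih.hom m₁).obj m₂ ⟶ (ih.hom m₁).obj m₃ :=
  ih.ψ ((αₗ _ _ _).hom ≫ (ih.hom m₂).obj m₃ ⊴ₗ ih.ev m₁ m₂ ≫ ih.ev m₂ m₃)

/-- The morphism `X ⊗ hom(m, n) ⟶ hom(m, X ⊙ n)`. -/
def aInv (X : C) (m n : M) : X ⊗ (ih.hom m).obj n ⟶ (ih.hom m).obj (X ⊙ₗ n) :=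
  ih.coev (X ⊗ (ih.hom m).obj n) m ≫
    (ih.hom m).map ((αₗ _ _ _).hom ≫ X ⊴ₗ ih.ev m n)

/-- The morphism `hom(X ⊙ m, n) ⊗ X ⟶ hom(m, n)`. -/
def b (X : C) (m n : M) : (ih.hom (X ⊙ₗ m)).obj n ⊗ X ⟶ (ih.hom m).obj n :=
  ih.coev ((ih.hom (X ⊙ₗ m)).obj n ⊗ X) m ≫
    (ih.hom m).map ((αₗ _ _ _).hom ≫ ih.ev (X ⊙ₗ m) n)

end InternalHom

variable (G : 𝒱 ⥤ Center C)

/-- The action of `𝒱` on `M` through `G`, on objects. -/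
abbrev restr (V : 𝒱) (m : M) : M := (G.obj V).1 ⊙ₗ m

/-- The inverse half-braiding `X ⊗ G(V) ⟶ G(V) ⊗ X`. -/
def unbraid (V : 𝒱) (X : C) : X ⊗ (G.obj V).1 ⟶ (G.obj V).1 ⊗ X := ((G.obj V).2.β X).inv

variable [G.Monoidal]

/-- Evaluation `G(V*) ⊗ G(V) ⟶ 1`. -/
noncomputable def evG (V : 𝒱) : (G.obj (Vᘁ)).1 ⊗ (G.obj V).1 ⟶ 𝟙_ C :=
  Center.Hom.f
    (Functor.LaxMonoidal.μ G (Vᘁ) V ≫ G.map (ε_ V (Vᘁ)) ≫ Functor.OplaxMonoidal.η G)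

/-- `ev_V ⊙ id_m : V* ⊙ (V ⊙ m) ⟶ m`. -/
noncomputable def evAct (V : 𝒱) (m : M) : restr G (Vᘁ) (restr G V m) ⟶ m :=
  (αₗ _ _ _).inv ≫ evG G V ⊵ₗ m ≫ (λₗ m).hom

/-- The map `Hom(X ⊙ m, V ⊙ n) → Hom(X ⊙ (V* ⊙ m), n)`,
`f ↦ (ev_V ⊙ n) (V* ⊙ f) ((σ^{V*}_X)⁻¹ ⊙ m)`. -/
noncomputable def γ {X : C} {V : 𝒱} {m n : M} (f : X ⊙ₗ m ⟶ restr G V n) :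
    X ⊙ₗ restr G (Vᘁ) m ⟶ n :=
  (αₗ _ _ _).inv ≫ unbraid G (Vᘁ) X ⊵ₗ m ≫ (αₗ _ _ _).hom ≫ (G.obj (Vᘁ)).1 ⊴ₗ f ≫ evAct G V n

variable (ih : InternalHom C M)

/-- The prebalancing `hom(m, V ⊙ n) ⟶ hom(V* ⊙ m, n)` of the internal Hom bifunctor. -/
noncomputable def prebal (V : 𝒱) (m n : M) :
    (ih.hom m).obj (restr G V n) ⟶ (ih.hom (restr G (Vᘁ) m)).obj n :=
  ih.ψ (γ G (ih.φ (𝟙 ((ih.hom m).obj (restr G V n)))))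

/-- A dinatural family `ξ m : E ⟶ hom(m, m)` that is compatible with the prebalancing. -/
structure IsRelativeDinatural (E : C) (ξ : ∀ m : M, E ⟶ (ih.hom m).obj m) : Prop where
  dinatural : ∀ {m n : M} (f : m ⟶ n), ξ m ≫ (ih.hom m).map f = ξ n ≫ ih.pre f n
  balanced : ∀ (V : 𝒱) (m : M), ξ m ≫ ih.pre (evAct G V m) m =
    ξ (restr G V m) ≫ prebal G ih V (restr G V m) m

/-- The universal property of the relative end of the internal Hom bifunctor. -/
structure IsRelativeEnd (E : C) (π : ∀ m : M, E ⟶ (ih.hom m).obj m) : Prop where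
  isRelativeDinatural : IsRelativeDinatural G ih E π
  universal : ∀ (E' : C) (ξ : ∀ m : M, E' ⟶ (ih.hom m).obj m), IsRelativeDinatural G ih E' ξ →
    ∃! h : E' ⟶ E, ∀ m, h ≫ π m = ξ m

/-- The adjoint algebra `A_{𝒱, M}`: the relative end of `hom(m, m)`, with the half-braiding and
the multiplication that it carries. -/
structure AdjointAlgebra where
  A : Center C
  [mon : MonObj A]
  π : ∀ m : M, A.1 ⟶ (ih.hom m).obj m
  isRelativeEnd : IsRelativeEnd G ih A.1 π
  halfBraiding : ∀ (X : C) (m : M),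
    π (X ⊙ₗ m) ▷ X ≫ ih.b X m (X ⊙ₗ m) = (A.2.β X).hom ≫ X ◁ π m ≫ ih.aInv X m m
  mul : ∀ m : M, (MonObj.mul (X := A)).f ≫ π m = (π m ⊗ₘ π m) ≫ ih.comp m m m
  one : ∀ m : M, (MonObj.one (X := A)).f ≫ π m = ih.coev (𝟙_ C) m ≫ (ih.hom m).map (λₗ m).hom

attribute [instance] AdjointAlgebra.mon

end General

section RelativeCenter

lemma double_braiding_tensor {D : Type*} [Category* D] [MonoidalCategory D] [BraidedCategory D]
    (V A B : D) (hA : (β_ V A).hom ≫ (β_ A V).hom = 𝟙 _)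
    (hB : (β_ V B).hom ≫ (β_ B V).hom = 𝟙 _) :
    (β_ V (A ⊗ B)).hom ≫ (β_ (A ⊗ B) V).hom = 𝟙 _ := by
  rw [BraidedCategory.braiding_tensor_right_hom, BraidedCategory.braiding_tensor_left_hom]
  simp only [Category.assoc, Iso.inv_hom_id_assoc]
  rw [← whiskerLeft_comp_assoc A, hB, whiskerLeft_id, Category.id_comp, Iso.hom_inv_id_assoc,
    ← comp_whiskerRight_assoc, hA, id_whiskerRight, Category.id_comp, Iso.inv_hom_id]

variable {𝒱 C : Type*} [Category* 𝒱] [Category* C] [MonoidalCategory C] (G : 𝒱 ⥤ Center C)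

/-- The relative centre: the objects of the centre whose double braiding with every `G(V)` is
trivial. -/
def relativeCenter : ObjectProperty (Center C) :=
  fun A => ∀ V : 𝒱, (β_ (G.obj V) A).hom ≫ (β_ A (G.obj V)).hom = 𝟙 (G.obj V ⊗ A)

instance : (relativeCenter G).IsMonoidal where
  prop_unit V := by
    simp
  prop_tensor A B hA hB V := by
    exact double_braiding_tensor (G.obj V) A B (hA V) (hB V)

/-- An algebra in the centre that lies in the relative centre, as an algebra there. -/
noncomputable abbrev relativeMonObj (A : Center C) [i : MonObj A] (h : relativeCenter G A) :
    MonObj (⟨A, h⟩ : (relativeCenter G).FullSubcategory) :=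
  letI : MonObj ((relativeCenter G).ι.obj ⟨A, h⟩) := i
  (relativeCenter G).fullyFaithfulι.monObj ⟨A, h⟩

/-- `A` is a commutative algebra in the relative centre. -/
def IsRelativelyCommutative (A : Center C) [MonObj A] : Prop :=
  ∃ h : relativeCenter G A,
    letI := relativeMonObj G A h
    IsCommMonObj (⟨A, h⟩ : (relativeCenter G).FullSubcategory)

end RelativeCenter
end CentralHopf

namespace CentralHopf
section Comodule

open Coalgebra

/-- A left `B`-comodule algebra `K`, with coaction `κ ↦ κ₋₁ ⊗ κ₀`. -/
class LeftComoduleAlgebra (k : Type u) [Field k] (B : Type u) [Ring B] [HopfAlgebra k B]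
    (K : Type u) [Ring K] [Algebra k K] where
  coact : K →ₐ[k] B ⊗[k] K
  coassoc : ∀ κ : K, TensorProduct.assoc k B B K ((comul (R := k) (A := B)).rTensor K (coact κ)) =
    coact.toLinearMap.lTensor B (coact κ)
  counit_coact : ∀ κ : K,
    TensorProduct.lid k K ((counit (R := k) (A := B)).rTensor K (coact κ)) = κ

/-- A nonzero left `B`-comodule algebra without nontrivial `B`-costable right ideals. -/
structure IsRightSimple (k : Type u) [Field k] (B : Type u) [Ring B] [HopfAlgebra k B]
    (K : Type u) [Ring K] [Algebra k K] [LeftComoduleAlgebra k B K] : Prop where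
  nontrivial : Nontrivial K
  simple : ∀ J : Submodule k K, (∀ x ∈ J, ∀ y : K, x * y ∈ J) →
    (∀ x ∈ J, LeftComoduleAlgebra.coact (k := k) (B := B) x ∈
      LinearMap.range (J.subtype.lTensor B)) → J = ⊥ ∨ J = ⊤

variable {k : Type u} [Field k] {B : Type u} [Ring B] [HopfAlgebra k B]
  {K : Type u} [Ring K] [Algebra k K] [LeftComoduleAlgebra k B K]

section Unbundled
variable {V W M : Type u} [AddCommGroup V] [Module k V] [AddCommGroup W] [Module k W]
  [AddCommGroup M] [Module k M]

/-- The action of `K` on `V ⊗ M`, through the coaction. -/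
noncomputable def aρ (ρ : B →ₐ[k] Module.End k V) (τ : K →ₐ[k] Module.End k M) :
    K →ₐ[k] Module.End k (V ⊗[k] M) :=
  ((Module.endTensorEndAlgHom (R := k) (S := k) (A := k)).comp
    (Algebra.TensorProduct.map ρ τ)).comp (LeftComoduleAlgebra.coact (k := k) (B := B))

variable (ρ : B →ₐ[k] Module.End k V) (σ : B →ₐ[k] Module.End k W) (τ : K →ₐ[k] Module.End k M)

lemma aρ_tmul (κ : K) (v : V) (m : M) : aρ ρ τ κ (v ⊗ₜ[k] m) =
    TensorProduct.map (evAt ρ v) (τ.toLinearMap.flip m)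
      (LeftComoduleAlgebra.coact (k := k) (B := B) κ) := by
  simp only [aρ, AlgHom.comp_apply]
  induction LeftComoduleAlgebra.coact (k := k) (B := B) κ using TensorProduct.induction_on with
  | zero => simp
  | tmul a b => simp [Module.endTensorEndAlgHom_apply]
  | add a b ha hb => simp only [map_add, LinearMap.add_apply, ha, hb]

lemma tρ_tmul (b : B) (v : V) (w : W) : tρ ρ σ b (v ⊗ₜ[k] w) =
    TensorProduct.map (evAt ρ v) (evAt σ w) (comul (R := k) b) := by
  rw [tρ_sum]; conv_rhs => rw [← (ℛ k b).eq]
  simp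

lemma assoc_aρ (κ : K) : (TensorProduct.assoc k V W M).toLinearMap ∘ₗ aρ (tρ ρ σ) τ κ =
    aρ ρ (aρ σ τ) κ ∘ₗ (TensorProduct.assoc k V W M).toLinearMap := by
  refine TensorProduct.ext_threefold fun v w m => ?_
  have h := congrArg (TensorProduct.map (evAt ρ v)
    (TensorProduct.map (evAt σ w) (τ.toLinearMap.flip m)))
    (LeftComoduleAlgebra.coassoc (k := k) (B := B) κ)
  simp only [LinearMap.comp_apply, LinearEquiv.coe_coe, TensorProduct.assoc_tmul, aρ_tmul]
  refine Eq.trans (Eq.trans ?_ h) ?_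
  · induction LeftComoduleAlgebra.coact (k := k) (B := B) κ using TensorProduct.induction_on with
    | zero => simp
    | add a b ha hb => simp only [map_add, ha, hb]
    | tmul a b =>
      simp only [TensorProduct.map_tmul, evAt_apply, tρ_tmul, LinearMap.rTensor_tmul]
      induction comul (R := k) a using TensorProduct.induction_on with
      | zero => simp
      | add a b ha hb => simp only [map_add, ha, hb, TensorProduct.add_tmul]
      | tmul a b => simp
  · induction LeftComoduleAlgebra.coact (k := k) (B := B) κ using TensorProduct.induction_on with
    | zero => simp
    | add a b ha hb => simp only [map_add, ha, hb]
    | tmul a b => simp [aρ_tmul]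

lemma lid_aρ (κ : K) : (TensorProduct.lid k M).toLinearMap ∘ₗ aρ (uρ k B) τ κ =
    τ κ ∘ₗ (TensorProduct.lid k M).toLinearMap := by
  refine TensorProduct.ext' fun x m => ?_
  have h := congrArg (fun κ => x • τ κ m)
    (LeftComoduleAlgebra.counit_coact (k := k) (B := B) κ)
  simp only [LinearMap.comp_apply, LinearEquiv.coe_coe, TensorProduct.lid_tmul, aρ_tmul, map_smul]
  refine Eq.trans ?_ h
  induction LeftComoduleAlgebra.coact (k := k) (B := B) κ using TensorProduct.induction_on with
  | zero => simp
  | add a b ha hb => simp only [map_add, ha, hb, LinearMap.add_apply, smul_add]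
  | tmul a b => simp [smul_smul, mul_comm]

variable {ρ τ} in
lemma map_aρ {V' M' : Type u} [AddCommGroup V'] [Module k V'] [AddCommGroup M'] [Module k M']
    {ρ' : B →ₐ[k] Module.End k V'} {τ' : K →ₐ[k] Module.End k M'}
    {f : V →ₗ[k] V'} {g : M →ₗ[k] M'} (hf : ∀ b, f ∘ₗ ρ b = ρ' b ∘ₗ f)
    (hg : ∀ b, g ∘ₗ τ b = τ' b ∘ₗ g) (κ : K) :
    TensorProduct.map f g ∘ₗ aρ ρ τ κ = aρ ρ' τ' κ ∘ₗ TensorProduct.map f g := by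
  refine TensorProduct.ext' fun v m => ?_
  have hf' : ∀ b v, f (ρ b v) = ρ' b (f v) := fun b v => LinearMap.congr_fun (hf b) v
  have hg' : ∀ b v, g (τ b v) = τ' b (g v) := fun b v => LinearMap.congr_fun (hg b) v
  simp only [LinearMap.comp_apply, TensorProduct.map_tmul, aρ_tmul]
  induction LeftComoduleAlgebra.coact (k := k) (B := B) κ using TensorProduct.induction_on with
  | zero => simp
  | add a b ha hb => simp only [map_add, ha, hb]
  | tmul a b => simp [hf', hg']

end Unbundled

namespace FRep

variable (k B K) in
/-- The action `(X, M) ↦ X ⊗ M` of the representations of `B` on those of `K`. -/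
noncomputable instance actStruct : MonoidalLeftActionStruct (FRep k B) (FRep k K) where
  actionObj X M := { V := X.V ⊗[k] M.V, ρ := aρ X.ρ M.ρ }
  actionHomLeft f M := ⟨f.hom.rTensor M.V, map_aρ f.comm (fun _ => rfl)⟩
  actionHomRight X _ _ g := ⟨g.hom.lTensor X.V, map_aρ (fun _ => rfl) g.comm⟩
  actionHom f g := ⟨TensorProduct.map f.hom g.hom, map_aρ f.comm g.comm⟩
  actionAssocIso X Y M := mkIso (TensorProduct.assoc k X.V Y.V M.V) (assoc_aρ X.ρ Y.ρ M.ρ)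
  actionUnitIso M := mkIso (TensorProduct.lid k M.V) (lid_aρ M.ρ)

noncomputable instance : MonoidalLeftAction (FRep k B) (FRep k K) where
  actionHom_def f g := Hom.ext (TensorProduct.ext' fun _ _ => rfl)
  actionHomRight_id X M := Hom.ext (TensorProduct.ext' fun _ _ => rfl)
  id_actionHomLeft X M := Hom.ext (TensorProduct.ext' fun _ _ => rfl)
  actionHom_comp f₁ f₂ g₁ g₂ := Hom.ext (TensorProduct.ext' fun _ _ => rfl)
  actionAssocIso_hom_naturality f g h := Hom.ext (TensorProduct.ext_threefold fun _ _ _ => rfl)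
  actionUnitIso_hom_naturality f := Hom.ext (TensorProduct.ext' fun x y => map_smul f.hom x y)
  whiskerLeft_actionHomLeft X _ _ f M := Hom.ext (TensorProduct.ext_threefold fun _ _ _ => rfl)
  whiskerRight_actionHomLeft X f M := Hom.ext (TensorProduct.ext_threefold fun _ _ _ => rfl)
  associator_actionHom X Y Z M := Hom.ext (TensorProduct.ext_fourfold fun _ _ _ _ => rfl)
  leftUnitor_actionHom X M := Hom.ext (TensorProduct.ext_threefold fun x y m =>
    (TensorProduct.smul_tmul' x y m))
  rightUnitor_actionHom X M := Hom.ext (TensorProduct.ext_threefold fun y x m =>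
    (TensorProduct.smul_tmul x y m))

variable (B)

/-- The `K`-linear maps `B ⊗ M → N`. -/
def homK (M N : FRep k K) : Submodule k (B ⊗[k] M.V →ₗ[k] N.V) where
  carrier := {α | ∀ κ : K, α ∘ₗ aρ (Algebra.lmul k B) M.ρ κ = N.ρ κ ∘ₗ α}
  add_mem' {α β} hα hβ κ := by rw [LinearMap.add_comp, hα, hβ, LinearMap.comp_add]
  zero_mem' κ := by rw [LinearMap.zero_comp, LinearMap.comp_zero]
  smul_mem' c α hα κ := by rw [LinearMap.smul_comp, hα, LinearMap.comp_smul]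

lemma mulRight_aρ (M : FRep k K) (h : B) (κ : K) :
    (LinearMap.mulRight k h).rTensor M.V ∘ₗ aρ (Algebra.lmul k B) M.ρ κ =
      aρ (Algebra.lmul k B) M.ρ κ ∘ₗ (LinearMap.mulRight k h).rTensor M.V :=
  map_aρ (fun b => LinearMap.ext fun x => mul_assoc b x h) (fun _ => rfl) κ

/-- The action `(h · α)(g ⊗ m) = α(g h ⊗ m)`. -/
noncomputable def homAct (M N : FRep k K) : B →ₐ[k] Module.End k (homK B M N) where
  toFun h :=
    { toFun := fun α => ⟨α.1 ∘ₗ (LinearMap.mulRight k h).rTensor M.V, fun κ => by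
        rw [LinearMap.comp_assoc, mulRight_aρ, ← LinearMap.comp_assoc, α.2, LinearMap.comp_assoc]⟩
      map_add' := fun _ _ => rfl
      map_smul' := fun _ _ => rfl }
  map_one' := LinearMap.ext fun α => Subtype.ext (TensorProduct.ext' fun g m => by
    simp)
  map_mul' x y := LinearMap.ext fun α => Subtype.ext (TensorProduct.ext' fun g m => by
    simp [mul_assoc])
  map_zero' := LinearMap.ext fun α => Subtype.ext (TensorProduct.ext' fun g m => by
    simp)
  map_add' x y := LinearMap.ext fun α => Subtype.ext (TensorProduct.ext' fun g m => by
    simp [mul_add, TensorProduct.add_tmul])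
  commutes' r := LinearMap.ext fun α => Subtype.ext (TensorProduct.ext' fun g m => by
    simp [Algebra.algebraMap_eq_smul_one, ← TensorProduct.smul_tmul'])

@[simp] lemma homAct_apply (M N : FRep k K) (h : B) (α : homK B M N) :
    (homAct B M N h α).1 = α.1 ∘ₗ (LinearMap.mulRight k h).rTensor M.V := rfl

variable [Module.Finite k B]

/-- The internal Hom functor `N ↦ Hom_K(B ⊗ M, N)`. -/
noncomputable def homFunctor (M : FRep k K) : FRep k K ⥤ FRep k B where
  obj N := { V := homK B M N, ρ := homAct B M N }
  map {N N'} f := ⟨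
    { toFun := fun α => ⟨f.hom ∘ₗ α.1, fun κ => by
        rw [LinearMap.comp_assoc, α.2, ← LinearMap.comp_assoc, f.comm, LinearMap.comp_assoc]⟩
      map_add' := fun α β => Subtype.ext (LinearMap.comp_add _ _ _)
      map_smul' := fun c α => Subtype.ext (LinearMap.comp_smul _ _ _) }, fun _ => rfl⟩
  map_id N := rfl
  map_comp f g := rfl

open MonoidalLeftAction

/-- `φ(α)(x ⊗ m) = α(x)(1 ⊗ m)`. -/
noncomputable def homφ {X : FRep k B} {M N : FRep k K} (α : X ⟶ (homFunctor B M).obj N) :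
    X ⊙ₗ M ⟶ N where
  hom := TensorProduct.lift ((TensorProduct.mk k B M.V 1).lcomp k N.V ∘ₗ
    (homK B M N).subtype ∘ₗ α.hom)
  comm κ := by
    refine TensorProduct.ext' fun x m => ?_
    have h := LinearMap.congr_fun ((α.hom x).2 κ) (1 ⊗ₜ[k] m)
    have hα : ∀ b g m, (α.hom (X.ρ b x)).1 (g ⊗ₜ[k] m) = (α.hom x).1 ((g * b) ⊗ₜ[k] m) :=
      fun b g m => congrArg (fun z : homK B M N => z.1 (g ⊗ₜ[k] m)) (hom_comm α b x)
    change _ = N.ρ κ ((α.hom x).1 (1 ⊗ₜ[k] m))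
    refine Eq.trans ?_ h
    change TensorProduct.lift _ (aρ X.ρ M.ρ κ (x ⊗ₜ[k] m)) = _
    simp only [LinearMap.comp_apply, aρ_tmul]
    induction LeftComoduleAlgebra.coact (k := k) (B := B) κ using TensorProduct.induction_on with
    | zero => simp
    | add a b ha hb => simp only [map_add, ha, hb]
    | tmul a b =>
      have := hα a 1 (M.ρ b m)
      rw [one_mul] at this
      simp only [TensorProduct.map_tmul, TensorProduct.lift.tmul, evAt_apply, LinearMap.flip_apply,
        AlgHom.toLinearMap_apply] at this ⊢
      exact this.trans (by simp)

/-- `ψ(β)(x)(h ⊗ m) = β(h x ⊗ m)`. -/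
noncomputable def homψ {X : FRep k B} {M N : FRep k K} (β : X ⊙ₗ M ⟶ N) :
    X ⟶ (homFunctor B M).obj N where
  hom :=
    { toFun := fun x => ⟨β.hom ∘ₗ (evAt X.ρ x).rTensor M.V, fun κ => by
        have h := map_aρ (K := K) (ρ := Algebra.lmul k B) (ρ' := X.ρ) (τ := M.ρ) (τ' := M.ρ)
          (f := evAt X.ρ x) (g := LinearMap.id)
          (fun b => LinearMap.ext fun g => by simp) (fun _ => rfl) κ
        change (β.hom ∘ₗ TensorProduct.map (evAt X.ρ x) LinearMap.id) ∘ₗ _ =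
          N.ρ κ ∘ₗ (β.hom ∘ₗ TensorProduct.map (evAt X.ρ x) LinearMap.id)
        rw [LinearMap.comp_assoc, h, ← LinearMap.comp_assoc]
        exact congrArg (fun z => z ∘ₗ TensorProduct.map (evAt X.ρ x) LinearMap.id) (β.comm κ)⟩
      map_add' := fun x y => Subtype.ext (TensorProduct.ext' fun g m => by
        change β.hom (X.ρ g (x + y) ⊗ₜ[k] m) = β.hom (X.ρ g x ⊗ₜ[k] m) + β.hom (X.ρ g y ⊗ₜ[k] m)
        rw [map_add, TensorProduct.add_tmul, map_add])
      map_smul' := fun c x => Subtype.ext (TensorProduct.ext' fun g m => by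
        change β.hom (X.ρ g (c • x) ⊗ₜ[k] m) = c • β.hom (X.ρ g x ⊗ₜ[k] m)
        rw [map_smul, ← TensorProduct.smul_tmul', map_smul]) }
  comm b := LinearMap.ext fun x => Subtype.ext (TensorProduct.ext' fun g m => by
    change β.hom (X.ρ g (X.ρ b x) ⊗ₜ[k] m) = β.hom (X.ρ (g * b) x ⊗ₜ[k] m)
    rw [map_mul, Module.End.mul_apply])

/-- The internal Homs `Hom_K(B ⊗ M, N)` of the module category of representations of `K`. -/
noncomputable def hopfInternalHom : InternalHom (FRep k B) (FRep k K) where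
  hom M := homFunctor B M
  adj M := Adjunction.mkOfHomEquiv
    { homEquiv := fun X N =>
        { toFun := homψ B
          invFun := homφ B
          left_inv := fun β => Hom.ext (TensorProduct.ext' fun x m => by
            change β.hom (X.ρ 1 x ⊗ₜ[k] m) = β.hom (x ⊗ₜ[k] m)
            rw [map_one, Module.End.one_apply])
          right_inv := fun α => Hom.ext (LinearMap.ext fun x => Subtype.ext
            (TensorProduct.ext' fun g m => by
              have := congrArg (fun z : homK B M N => z.1 (1 ⊗ₜ[k] m)) (hom_comm α g x)
              change (α.hom (X.ρ g x)).1 (1 ⊗ₜ[k] m) = (α.hom x).1 (g ⊗ₜ[k] m)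
              refine this.trans ?_
              change (α.hom x).1 ((1 * g) ⊗ₜ[k] m) = _
              rw [one_mul])) }
      homEquiv_naturality_left_symm := fun f g => Hom.ext (TensorProduct.ext' fun _ _ => rfl)
      homEquiv_naturality_right := fun f g => rfl }

end FRep
end Comodule
end CentralHopf

namespace CentralHopf
section ST

open Coalgebra Bosonization LeftComoduleAlgebra

variable {k : Type u} [Field k] {T : Type u} [Ring T] [HopfAlgebra k T] (𝓡 : RMatrix k T)
  (H : Type u) [Ring H] [Algebra k H] [Coalgebra k H] [BraidedHopfAlgebra 𝓡 H]
  (K : Type u) [Ring K] [Algebra k K] [LeftComoduleAlgebra k (Bosonization 𝓡 H) K]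

instance [Module.Finite k H] [Module.Finite k T] : Module.Finite k (Bosonization 𝓡 H) :=
  Module.Finite.equiv (Bosonization.equiv 𝓡 (H := H)).symm

/-- The coaction of `T` on `K`, `κ ↦ π(κ₋₁) ⊗ κ₀`. -/
noncomputable def coactK : K →ₗ[k] T ⊗[k] K :=
  (proj 𝓡).toLinearMap.rTensor K ∘ₗ (coact (k := k) (B := Bosonization 𝓡 H)).toLinearMap

/-- The coaction of `T` on `(H # T) ⊗ K`, `x ⊗ κ ↦ R² π(κ₋₁) ⊗ ((1 # R¹) x ⊗ κ₀)`. -/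
noncomputable def coactT :
    Bosonization 𝓡 H ⊗[k] K →ₗ[k] T ⊗[k] (Bosonization 𝓡 H ⊗[k] K) :=
  (∑ c ∈ 𝓡.supp, TensorProduct.map (LinearMap.mulLeft k c.2)
      ((LinearMap.mulLeft k (inT 𝓡 c.1)).rTensor K)) ∘ₗ
    (TensorProduct.leftComm k (Bosonization 𝓡 H) T K).toLinearMap ∘ₗ
    (coactK 𝓡 H K).lTensor (Bosonization 𝓡 H)

lemma coactT_mul (h x : Bosonization 𝓡 H) (κ : K) : coactT 𝓡 H K ((x * h) ⊗ₜ[k] κ) =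
    ((LinearMap.mulRight k h).rTensor K).lTensor T (coactT 𝓡 H K (x ⊗ₜ[k] κ)) := by
  simp only [coactT, LinearMap.comp_apply, LinearMap.lTensor_tmul, LinearMap.sum_apply, map_sum,
    LinearEquiv.coe_coe]
  refine Finset.sum_congr rfl fun c _ => ?_
  induction coactK 𝓡 H K κ using TensorProduct.induction_on with
  | zero => simp
  | add a b ha hb => simp only [TensorProduct.tmul_add, map_add, ha, hb]
  | tmul a b => simp [mul_assoc]

/-- The space `S^T(H, K)` of the linear maps `α : (H # T) ⊗ K → K` that are left `K`-linear,
right `K`-linear and `T`-colinear. -/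
noncomputable def ST : Submodule k (Bosonization 𝓡 H ⊗[k] K →ₗ[k] K) where
  carrier := {α |
    (∀ (κ : K) (z : Bosonization 𝓡 H ⊗[k] K), α (coact κ * z) = κ * α z) ∧
    (∀ (x : Bosonization 𝓡 H) (κ : K), α (x ⊗ₜ κ) = α (x ⊗ₜ 1) * κ) ∧
    α.lTensor T ∘ₗ coactT 𝓡 H K = coactK 𝓡 H K ∘ₗ α}
  add_mem' {α β} hα hβ := ⟨fun κ z => by simp [hα.1, hβ.1, mul_add],
    fun x κ => by simp only [LinearMap.add_apply, hα.2.1 x κ, hβ.2.1 x κ, add_mul],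
    by rw [LinearMap.lTensor_add, LinearMap.add_comp, hα.2.2, hβ.2.2, LinearMap.comp_add]⟩
  zero_mem' := ⟨by simp, by simp, by simp⟩
  smul_mem' c α hα := ⟨fun κ z => by simp [hα.1],
    fun x κ => by simp only [LinearMap.smul_apply, hα.2.1 x κ, smul_mul_assoc],
    by rw [LinearMap.lTensor_smul, LinearMap.smul_comp, hα.2.2, LinearMap.comp_smul]⟩

/-- The action `(h · α)(x ⊗ κ) = α(x h ⊗ κ)` of `H # T` on `S^T(H, K)`. -/
noncomputable def stAct : Bosonization 𝓡 H →ₐ[k] Module.End k (ST 𝓡 H K) where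
  toFun h :=
    { toFun := fun α => ⟨α.1 ∘ₗ (LinearMap.mulRight k h).rTensor K, by
        refine ⟨fun κ z => ?_, fun x κ => by simpa using α.2.2.1 (x * h) κ, ?_⟩
        · have e : ∀ w, (LinearMap.mulRight k h).rTensor K w = w * (h ⊗ₜ[k] (1 : K)) := fun w => by
            induction w using TensorProduct.induction_on with
            | zero => simp
            | add a b ha hb => simp only [map_add, ha, hb, add_mul]
            | tmul a b => simp
          simp only [LinearMap.comp_apply, e, mul_assoc, α.2.1]
        · refine TensorProduct.ext' fun x κ => ?_
          have h1 := LinearMap.congr_fun α.2.2.2 ((x * h) ⊗ₜ[k] κ)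
          simp only [LinearMap.comp_apply, coactT_mul, LinearMap.lTensor_comp] at h1 ⊢
          simpa using h1⟩
      map_add' := fun _ _ => rfl
      map_smul' := fun _ _ => rfl }
  map_one' := LinearMap.ext fun α => Subtype.ext (TensorProduct.ext' fun g m => by
    simp)
  map_mul' x y := LinearMap.ext fun α => Subtype.ext (TensorProduct.ext' fun g m => by
    simp [mul_assoc])
  map_zero' := LinearMap.ext fun α => Subtype.ext (TensorProduct.ext' fun g m => by
    simp)
  map_add' x y := LinearMap.ext fun α => Subtype.ext (TensorProduct.ext' fun g m => by
    simp [mul_add, TensorProduct.add_tmul])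
  commutes' r := LinearMap.ext fun α => Subtype.ext (TensorProduct.ext' fun g m => by
    simp [Algebra.algebraMap_eq_smul_one, ← TensorProduct.smul_tmul'])

variable [Module.Finite k H] [Module.Finite k T] [Module.Finite k K]

/-- `S^T(H, K)` as a representation of `H # T`. -/
noncomputable abbrev STRep : FRep k (Bosonization 𝓡 H) where
  V := ST 𝓡 H K
  ρ := stAct 𝓡 H K

variable {H K}

/-- Evaluation of the elements of `S^T(H, K)`. -/
noncomputable def stEval (z : Bosonization 𝓡 H ⊗[k] K) : ST 𝓡 H K →ₗ[k] K :=
  LinearMap.applyₗ z ∘ₗ (ST 𝓡 H K).subtype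

/-- The map `x ↦ S(x₁) α(x₂ ⊗ 1)₋₁ x₃ ⊗ α(x₂ ⊗ 1)₀ κ`. -/
noncomputable def adCoact (α : Bosonization 𝓡 H ⊗[k] K →ₗ[k] K) (κ : K) :
    Bosonization 𝓡 H →ₗ[k] Bosonization 𝓡 H ⊗[k] K :=
  LinearMap.mul' k (Bosonization 𝓡 H ⊗[k] K) ∘ₗ
    TensorProduct.map
      ((TensorProduct.mk k (Bosonization 𝓡 H) K).flip 1 ∘ₗ HopfAlgebra.antipode k)
      (LinearMap.mul' k (Bosonization 𝓡 H ⊗[k] K) ∘ₗ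
        TensorProduct.map
          ((coact (k := k) (B := Bosonization 𝓡 H)).toLinearMap ∘ₗ α ∘ₗ
            (TensorProduct.mk k (Bosonization 𝓡 H) K).flip 1)
          ((TensorProduct.mk k (Bosonization 𝓡 H) K).flip κ) ∘ₗ
        comul (R := k)) ∘ₗ
    comul (R := k)

/-- `S^T(H, K)` with a half-braiding, as an object of the centre. -/
noncomputable abbrev stCenter (hb : HalfBraiding (STRep 𝓡 H K)) :
    Center (FRep k (Bosonization 𝓡 H)) :=
  ⟨STRep 𝓡 H K, hb⟩

variable (H K) in
/-- The structure of an algebra in the centre on `S^T(H, K)`: the half-braiding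
`α ⊗ y ↦ α₋₁ y ⊗ α₀` of the coaction `α₋₁ ⊗ α₀(x ⊗ κ) = S(x₁) α(x₂ ⊗ 1)₋₁ x₃ ⊗ α(x₂ ⊗ 1)₀ κ`,
the product `(α β)(x ⊗ κ) = α(x₁ ⊗ β(x₂ ⊗ κ))` and the unit `x ⊗ κ ↦ ε(x) κ`. These formulas
determine all the data. -/
structure STStructure where
  δ : ST 𝓡 H K →ₗ[k] Bosonization 𝓡 H ⊗[k] ST 𝓡 H K
  δ_spec : ∀ (α : ST 𝓡 H K) (x : Bosonization 𝓡 H) (κ : K),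
    (stEval 𝓡 (x ⊗ₜ κ)).lTensor (Bosonization 𝓡 H) (δ α) = adCoact 𝓡 α.1 κ x
  hb : HalfBraiding (STRep 𝓡 H K)
  hb_spec : ∀ (X : FRep k (Bosonization 𝓡 H)) (α : ST 𝓡 H K) (y : X.V),
    (hb.β X).hom.hom (α ⊗ₜ[k] y : ST 𝓡 H K ⊗[k] X.V) =
      ((evAt X.ρ y).rTensor (ST 𝓡 H K) (δ α) : X.V ⊗[k] ST 𝓡 H K)
  [mon : MonObj (stCenter 𝓡 hb)]
  mul_spec : ∀ (α β : ST 𝓡 H K) (x : Bosonization 𝓡 H) (κ : K),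
    stEval 𝓡 (x ⊗ₜ κ) ((MonObj.mul (X := stCenter 𝓡 hb)).f.hom
      (α ⊗ₜ[k] β : ST 𝓡 H K ⊗[k] ST 𝓡 H K)) =
    α.1 ((β.1 ∘ₗ (TensorProduct.mk k _ K).flip κ).lTensor (Bosonization 𝓡 H) (comul (R := k) x))
  one_spec : ∀ (x : Bosonization 𝓡 H) (κ : K),
    stEval 𝓡 (x ⊗ₜ κ) ((MonObj.one (X := stCenter 𝓡 hb)).f.hom (1 : k)) = counit (R := k) x • κ

attribute [instance] STStructure.mon

/-- `S^T(H, K)` as an object of the centre. -/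
noncomputable abbrev STStructure.obj (S : STStructure 𝓡 H K) : Center (FRep k (Bosonization 𝓡 H)) :=
  stCenter 𝓡 S.hb

end ST
end CentralHopf

/-! By condition 2 an element `α` of `S^T(H, K)` is the same thing as the function `a(x) = α(x ⊗ 1)`
from `B = H # T` to `K`, and in these terms everything takes place in convolution algebras.
Condition 1 becomes `a(κ₋₁ x) κ₀ = κ a(x)` (`IsCoactLinear`). Condition 3 says that two ring
homomorphisms agree on `a`: the map `translateR`, which is multiplicative because `(Δ ⊗ id)R =
R₁₃R₂₃`, and composition with the `T`-coaction of `K`. The product of `S^T(H, K)` is convolution.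
Its coaction is conjugation: with `ι(x) = x ⊗ 1`, `ι⁻¹ = ι ∘ S` and `δ` the coaction of `K`, it is
`ad(a) = ι⁻¹ * (δ ∘ a) * ι` in `Hom(B, B ⊗ K)` (`adConv`).

Multiplicativity of the coaction, coassociativity and the Yetter–Drinfeld condition are then formal
properties of conjugation. The point with content is that the coefficients of `ad(a)` satisfy
conditions 1 and 3 again. Condition 1 survives because each of the three factors of `ad(a)`
intertwines two ways of moving `κ` across it (`coactPair_mul`). Condition 3 survives because `R² ⊗
(1 # R¹)` exchanges `π(x₂) ⊗ x₁` and `π(x₁) ⊗ x₂` (`flipR_mul`, `translateR_adConv`). A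
Yetter–Drinfeld module gives a half-braiding only if the latter is invertible, which is where
bijectivity of the antipode of `B` enters (`antipode_injective`); it is derived from a nonzero
integral that is written down as a trace.

For the relative end, a dinatural family `ξ` is determined by its component at the regular module:
dinaturality along `K → M`, `κ ↦ κ m`, forces `ξ_M(e)(x ⊗ m) = a(x) m` with `a(x) = ξ_K(e)(x ⊗ 1)`
(`component_tmul`). `K`-linearity of `ξ_K(e)` is condition 1 for `a`, and the balancing condition at
`V = T`, `M = K` is condition 3 (`translateR_regFun`). Conversely every `a` in `S^T(H, K)` acts on
all modules by this formula. So `S^T(H, K)` is the relative end (`stHom_isRelativeEnd`), and its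
half-braiding, product and unit are the ones prescribed for the adjoint algebra. A second adjoint
algebra is isomorphic by universality; the comparison map respects the half-braidings because `X ⊗
S^T(H, K) → Hom(K, X ⊗ K)` is injective (`sum_antipode_aInv`).

For the second part, condition 3 gives `π(a₋₁) ⊗ a₀(x) = R² ⊗ a(x R¹)` (`proj_adConv`). Hence the
half-braiding of `S^T(H, K)` with `V_π` is the inverse of `σ^V`, and the double braiding is trivial.
Commutativity is `b(x₁ a₋₁) a₀(x₂) = a(x₁) b(x₂)` (`IsCoactLinear.sum_adConv`): this is `ι * ad(a) =
(δ ∘ a) * ι`, fed into condition 1 for `b`. -/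

namespace CentralHopf
-- Convolution algebras and the convolution inverse of an algebra map
section Convolution

open Coalgebra WithConv

variable {k : Type*} [Field k] {C D A A' : Type*} [AddCommGroup C] [Module k C] [Coalgebra k C]
  [AddCommGroup D] [Module k D] [Coalgebra k D] [Ring A] [Algebra k A] [Ring A'] [Algebra k A']

/-- Composition with an algebra map, as a map of convolution rings. -/
def convPost (C : Type*) [AddCommGroup C] [Module k C] [Coalgebra k C] (h : A →ₐ[k] A') :
    WithConv (C →ₗ[k] A) →+* WithConv (C →ₗ[k] A') where
  toFun f := toConv (h.toLinearMap ∘ₗ f.ofConv)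
  map_one' := by ext; simp [LinearMap.convOne_def]
  map_mul' f g := congrArg toConv (LinearMap.algHom_comp_convMul_distrib h f g)
  map_zero' := by ext; simp
  map_add' f g := by ext; simp

@[simp] lemma convPost_apply (h : A →ₐ[k] A') (f : WithConv (C →ₗ[k] A)) (x : C) :
    convPost C h f x = h (f x) := rfl

/-- Composition with a coalgebra map, as a map of convolution rings. -/
def convPre (A : Type*) [Ring A] [Algebra k A] (h : D →ₗc[k] C) :
    WithConv (C →ₗ[k] A) →+* WithConv (D →ₗ[k] A) where
  toFun f := toConv (f.ofConv ∘ₗ h.toLinearMap)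
  map_one' := by ext; simp [LinearMap.convOne_def]
  map_mul' f g := congrArg toConv (LinearMap.convMul_comp_coalgHom_distrib f g h)
  map_zero' := by ext; simp
  map_add' f g := by ext; simp

@[simp] lemma convPre_apply (h : D →ₗc[k] C) (f : WithConv (C →ₗ[k] A)) (x : D) :
    convPre A h f x = f (h x) := rfl

/-- The map `x ↦ ε(x) c`. -/
def convConst (k C : Type*) [Field k] [Algebra k A] [AddCommGroup C] [Module k C] [Coalgebra k C]
    (c : A) :
    WithConv (C →ₗ[k] A) := toConv ((LinearMap.toSpanSingleton k A c) ∘ₗ counit)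

@[simp] lemma convConst_apply (c : A) (x : C) :
    convConst k C c x = counit (R := k) x • c := rfl

@[simp] lemma convConst_mul_apply (c : A) (f : WithConv (C →ₗ[k] A)) (x : C) :
    (convConst k C c * f) x = c * f x := by
  have h := congrArg f.ofConv (sum_counit_smul (ℛ k x))
  simp only [map_sum, map_smul] at h
  rw [(ℛ k x).convMul_apply, ← h, Finset.mul_sum]
  simp

@[simp] lemma mul_convConst_apply (c : A) (f : WithConv (C →ₗ[k] A)) (x : C) :
    (f * convConst k C c) x = f x * c := by
  have h := congrArg ((TensorProduct.rid k A).toLinearMap ∘ₗ f.ofConv.rTensor k) (sum_tmul_counit_eq (ℛ k x))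
  simp only [map_sum, LinearMap.comp_apply, LinearMap.rTensor_tmul, LinearEquiv.coe_coe,
    TensorProduct.rid_tmul, one_smul] at h
  rw [(ℛ k x).convMul_apply, ← h, Finset.sum_mul]
  simp

/-- An algebra map, as an element of a convolution ring. -/
abbrev convHom {B : Type*} [Ring B] [Bialgebra k B] (f : B →ₐ[k] A) : WithConv (B →ₗ[k] A) :=
  toConv f.toLinearMap

/-- The convolution inverse of an algebra map. -/
abbrev convInv {B : Type*} [Ring B] [HopfAlgebra k B] (f : B →ₐ[k] A) : WithConv (B →ₗ[k] A) :=
  toConv (f.toLinearMap ∘ₗ HopfAlgebra.antipode k)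

/-- The relation `id * S = 1` is pushed forward along the algebra map. -/
lemma convHom_mul_convInv {B : Type*} [Ring B] [HopfAlgebra k B] (f : B →ₐ[k] A) :
    convHom f * convInv f = 1 := by
  rw [← map_one (convPost B f), ← LinearMap.id_mul_antipode, map_mul]
  rfl

lemma convInv_mul_convHom {B : Type*} [Ring B] [HopfAlgebra k B] (f : B →ₐ[k] A) :
    convInv f * convHom f = 1 := by
  rw [← map_one (convPost B f), ← LinearMap.antipode_mul_id, map_mul]
  rfl

lemma convHom_mul_convInv_assoc {B : Type*} [Ring B] [HopfAlgebra k B] (f : B →ₐ[k] A)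
    (g : WithConv (B →ₗ[k] A)) : convHom f * (convInv f * g) = g := by
  rw [← mul_assoc, convHom_mul_convInv, one_mul]

lemma convInv_mul_convHom_assoc {B : Type*} [Ring B] [HopfAlgebra k B] (f : B →ₐ[k] A)
    (g : WithConv (B →ₗ[k] A)) : convInv f * (convHom f * g) = g := by
  rw [← mul_assoc, convInv_mul_convHom, one_mul]

/-- Uniqueness of inverses: this is how `f ∘ S` is computed for a composite `f` without expanding
`S`. -/
lemma convInv_eq_of_mul {B : Type*} [Ring B] [HopfAlgebra k B] {f : B →ₐ[k] A}
    {g : WithConv (B →ₗ[k] A)} (h : convHom f * g = 1) : convInv f = g :=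
  left_inv_eq_right_inv (convInv_mul_convHom f) h

end Convolution

/-! ### Bijectivity of the antipode of a finite-dimensional Hopf algebra -/

section Antipode
open Coalgebra WithConv HopfAlgebra

variable {k : Type*} [Field k] {B : Type*} [Ring B] [HopfAlgebra k B]

/-- The factorization `Δ(x) = (x₁ ⊗ 1)(1 ⊗ x₂)`; inverting the two factors in reverse order shows
how `Δ` interacts with `S`. -/
lemma convHom_comulAlgHom :
    convHom (Bialgebra.comulAlgHom k B) =
      convHom (Algebra.TensorProduct.includeLeft (R := k) (S := k) (A := B) (B := B)) *
        convHom Algebra.TensorProduct.includeRight := by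
  ext x
  rw [(ℛ k x).convMul_apply]
  simpa using (ℛ k x).eq.symm

lemma convInv_comulAlgHom : convInv (Bialgebra.comulAlgHom k B) =
    convInv (Algebra.TensorProduct.includeRight) *
      convInv (Algebra.TensorProduct.includeLeft (R := k) (S := k) (A := B) (B := B)) := by
  refine convInv_eq_of_mul ?_
  rw [convHom_comulAlgHom, mul_assoc, convHom_mul_convInv_assoc, convHom_mul_convInv]

lemma comul_antipode (x : B) : comul (R := k) (antipode k x) =
    ∑ i ∈ (ℛ k x).index, antipode k ((ℛ k x).right i) ⊗ₜ[k] antipode k ((ℛ k x).left i) := by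
  have h := congrArg (fun f => f x) (convInv_comulAlgHom (k := k) (B := B))
  simp only [(ℛ k x).convMul_apply] at h
  simpa using h

/-- Expanding, the first leg is `S²(y₂) S(y₁) = S(y₁ S(y₂))`, which collapses to a counit. The
square of the antipode appears because `y₂ S⁻¹(y₁)`, the usual expression, is not available before
`S` is known to be invertible. -/
lemma comul_sq_antipode_mul (y : B) :
    ∑ i ∈ (ℛ k y).index, comul (R := k) (antipode k (antipode k ((ℛ k y).right i))) *
      (antipode k ((ℛ k y).left i) ⊗ₜ[k] (1 : B)) =
    (1 : B) ⊗ₜ[k] antipode k (antipode k y) := by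
  -- `S` reverses the coproduct, so `S²` preserves it.
  have h1 : ∀ z : B, comul (R := k) (antipode k (antipode k z)) = ∑ i ∈ (ℛ k z).index,
      antipode k (antipode k ((ℛ k z).left i)) ⊗ₜ[k] antipode k (antipode k ((ℛ k z).right i)) := by
    intro z
    have h := congrArg (TensorProduct.map (antipode k) (antipode k) ∘ₗ
      (TensorProduct.comm k B B).toLinearMap) (comul_antipode (k := k) z)
    rw [map_sum] at h
    simp only [LinearMap.comp_apply, LinearEquiv.coe_coe, TensorProduct.comm_tmul,
      TensorProduct.map_tmul] at h
    rw [← h, comul_antipode]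
    conv_rhs => rw [← (ℛ k (antipode k z)).eq]
    simp
  let Φ : B ⊗[k] (B ⊗[k] B) →ₗ[k] B ⊗[k] B :=
    TensorProduct.map (antipode k ∘ₗ LinearMap.mul' k B ∘ₗ (antipode k).lTensor B)
      (antipode k ∘ₗ antipode k) ∘ₗ (TensorProduct.assoc k B B B).symm.toLinearMap
  have h := congrArg Φ
    (sum_tmul_tmul_eq (ℛ k y) (fun i => ℛ k ((ℛ k y).left i)) (fun i => ℛ k ((ℛ k y).right i)))
  simp only [Φ, map_sum, LinearMap.comp_apply, TensorProduct.map_tmul, LinearEquiv.coe_coe,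
    TensorProduct.assoc_symm_tmul, LinearMap.mul'_apply, LinearMap.lTensor_tmul,
    ← TensorProduct.sum_tmul] at h
  simp only [← map_sum, sum_mul_antipode_eq_smul] at h
  simp only [map_smul, antipode_one, TensorProduct.smul_tmul] at h
  rw [← TensorProduct.tmul_sum] at h
  simp only [← map_smul, ← map_sum, sum_counit_smul] at h
  rw [h]
  simp only [h1, Finset.sum_mul, Algebra.TensorProduct.tmul_mul_tmul, mul_one,
    antipode_mul_antidistrib]

/-- `g ⊗ id` applied to the coproduct, `z ↦ g(z₁) z₂`. -/
noncomputable def contractComul (g : B →ₗ[k] k) : B →ₗ[k] B :=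
  (TensorProduct.lid k B).toLinearMap ∘ₗ g.rTensor B ∘ₗ comul

lemma contractComul_sum (g : B →ₗ[k] k) (z : B) :
    contractComul g z = ∑ i ∈ (ℛ k z).index, g ((ℛ k z).left i) • (ℛ k z).right i := by
  rw [contractComul, LinearMap.comp_apply, LinearMap.comp_apply]
  conv_lhs => rw [← (ℛ k z).eq]
  simp

section Integral

/-- `y ↦ S²(y₁) f(y₂)`. -/
noncomputable def sqTwist (f : B →ₗ[k] k) : B →ₗ[k] B :=
  (TensorProduct.rid k B).toLinearMap ∘ₗ
    TensorProduct.map (antipode k ∘ₗ antipode k) f ∘ₗ comul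

lemma sqTwist_sum (f : B →ₗ[k] k) (z : B) : sqTwist f z = ∑ i ∈ (ℛ k z).index,
    f ((ℛ k z).right i) • antipode k (antipode k ((ℛ k z).left i)) := by
  rw [sqTwist, LinearMap.comp_apply, LinearMap.comp_apply]
  conv_lhs => rw [← (ℛ k z).eq]
  simp

/-- The functional `x ↦ tr(y ↦ x S²(y₁) f(y₂))`. -/
noncomputable def traceIntegral (f : B →ₗ[k] k) : B →ₗ[k] k :=
  LinearMap.trace k B ∘ₗ LinearMap.lcomp k B (sqTwist f) ∘ₗ LinearMap.mul k B

lemma traceIntegral_apply (f : B →ₗ[k] k) (x : B) : traceIntegral f x =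
    LinearMap.trace k B (LinearMap.mulLeft k x ∘ₗ sqTwist f) := rfl

variable [Module.Finite k B]

/-- The preceding identity with the functional `f` carried along on one more leg of the coproduct;
coassociativity is all that is added. -/
lemma comul_sqTwist_mul (f : B →ₗ[k] k) (y : B) :
    ∑ i ∈ (ℛ k y).index, comul (R := k) (sqTwist f ((ℛ k y).right i)) *
      (antipode k ((ℛ k y).left i) ⊗ₜ[k] (1 : B)) = (1 : B) ⊗ₜ[k] sqTwist f y := by
  let Ψ : B ⊗[k] B →ₗ[k] B ⊗[k] B := LinearMap.mul' k (B ⊗[k] B) ∘ₗ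
    TensorProduct.map (comul ∘ₗ antipode k ∘ₗ antipode k)
      ((TensorProduct.mk k B B).flip 1 ∘ₗ antipode k) ∘ₗ (TensorProduct.comm k B B).toLinearMap
  let Φ : B ⊗[k] (B ⊗[k] B) →ₗ[k] B ⊗[k] B :=
    (TensorProduct.rid k (B ⊗[k] B)).toLinearMap ∘ₗ TensorProduct.map Ψ f ∘ₗ
      (TensorProduct.assoc k B B B).symm.toLinearMap
  have h := congrArg Φ
    (sum_tmul_tmul_eq (ℛ k y) (fun i => ℛ k ((ℛ k y).left i)) (fun i => ℛ k ((ℛ k y).right i)))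
  simp only [Φ, Ψ, map_sum, LinearMap.comp_apply, TensorProduct.map_tmul, LinearEquiv.coe_coe,
    TensorProduct.assoc_symm_tmul, LinearMap.mul'_apply, TensorProduct.comm_tmul,
    LinearMap.flip_apply, TensorProduct.mk_apply, TensorProduct.rid_tmul, ← Finset.smul_sum,
    comul_sq_antipode_mul] at h
  simp only [sqTwist_sum, map_sum, map_smul, Finset.sum_mul, smul_mul_assoc,
    TensorProduct.tmul_sum, TensorProduct.tmul_smul]
  exact h.symm

/-- `traceIntegral f` is an integral. -/
lemma traceIntegral_contractComul (f g : B →ₗ[k] k) (x : B) :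
    traceIntegral f (contractComul g x) = g 1 * traceIntegral f x := by
  let e := Module.finBasis k B
  -- `U i` sends `y` to `g(e_i S(y₁)) y₂`. Together with the maps `z ↦ eⁱ(z₁) z₂` it splits the
  -- operator under the trace so that cyclicity applies.
  let U (i) : B →ₗ[k] B := (TensorProduct.lid k B).toLinearMap ∘ₗ
    (g ∘ₗ LinearMap.mulLeft k (e i) ∘ₗ antipode k).rTensor B ∘ₗ comul
  have hU : ∀ i y, U i y = ∑ j ∈ (ℛ k y).index,
      g (e i * antipode k ((ℛ k y).left j)) • (ℛ k y).right j := by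
    intro i y
    simp only [U, LinearMap.comp_apply]
    conv_lhs => rw [← (ℛ k y).eq]
    simp
  -- In the opposite order the composites add up to `g(z₁ S(z₂)) z₃ = g(1) z`.
  have hUT : ∀ z, ∑ i, U i (contractComul (e.coord i) z) = g 1 • z := by
    intro z
    let Φ : B ⊗[k] (B ⊗[k] B) →ₗ[k] B := (TensorProduct.lid k B).toLinearMap ∘ₗ
      TensorProduct.map (g ∘ₗ LinearMap.mul' k B ∘ₗ (antipode k).lTensor B) LinearMap.id ∘ₗ
      (TensorProduct.assoc k B B B).symm.toLinearMap
    have h := congrArg Φ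
      (sum_tmul_tmul_eq (ℛ k z) (fun i => ℛ k ((ℛ k z).left i)) (fun i => ℛ k ((ℛ k z).right i)))
    simp only [Φ, map_sum, LinearMap.comp_apply, TensorProduct.map_tmul, LinearEquiv.coe_coe,
      TensorProduct.assoc_symm_tmul, LinearMap.mul'_apply, LinearMap.lTensor_tmul,
      TensorProduct.lid_tmul, LinearMap.id_apply] at h
    simp only [← Finset.sum_smul, ← map_sum g, sum_mul_antipode_eq_smul, map_smul,
      smul_assoc] at h
    simp only [smul_comm _ (g 1), ← Finset.smul_sum, sum_counit_smul] at h
    rw [h]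
    have h2 : ∀ u w : B, ∑ i, e.repr u i * g (e i * w) = g (u * w) := by
      intro u w
      conv_rhs => rw [← e.sum_repr u, Finset.sum_mul, map_sum]
      simp
    simp only [contractComul_sum, map_sum, map_smul]
    simp only [hU, Module.Basis.coord_apply, Finset.smul_sum, smul_smul]
    rw [Finset.sum_comm]
    refine Finset.sum_congr rfl fun a _ => ?_
    rw [Finset.sum_comm]
    refine Finset.sum_congr rfl fun b _ => ?_
    rw [← Finset.sum_smul, h2]
  -- Expanding `w₁` in the basis separates the dependence on `w` from that on `c`.
  have hT : ∀ w c : B, (TensorProduct.lid k B) (g.rTensor B (comul (R := k) w * (c ⊗ₜ[k] 1))) =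
      ∑ i, g (e i * c) • contractComul (e.coord i) w := by
    intro w c
    simp only [contractComul_sum, Finset.smul_sum, smul_smul, Module.Basis.coord_apply]
    rw [Finset.sum_comm]
    conv_lhs => rw [← (ℛ k w).eq]
    simp only [Finset.sum_mul, map_sum, Algebra.TensorProduct.tmul_mul_tmul, mul_one,
      LinearMap.rTensor_tmul, TensorProduct.lid_tmul, ← Finset.sum_smul]
    refine Finset.sum_congr rfl fun a _ => ?_
    congr 1
    conv_lhs => rw [← e.sum_repr ((ℛ k w).left a)]
    rw [Finset.sum_mul, map_sum]
    exact Finset.sum_congr rfl fun i _ => by rw [smul_mul_assoc, map_smul, smul_eq_mul, mul_comm]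
  -- Obtained by multiplying `comul_sqTwist_mul` by `Δ(x)` on the left and applying `g ⊗ id`.
  have key : LinearMap.mulLeft k (contractComul g x) ∘ₗ sqTwist f =
      ∑ i, contractComul (e.coord i) ∘ₗ (LinearMap.mulLeft k x ∘ₗ sqTwist f) ∘ₗ U i := by
    ext y
    have h1 := congrArg (fun z => TensorProduct.lid k B (g.rTensor B (comul x * z)))
      (comul_sqTwist_mul f y)
    simp only [Finset.mul_sum, ← mul_assoc, ← Bialgebra.comul_mul, map_sum, hT] at h1
    have h2 : TensorProduct.lid k B (g.rTensor B (comul x * ((1 : B) ⊗ₜ[k] sqTwist f y))) =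
        contractComul g x * sqTwist f y := by
      rw [contractComul_sum]
      conv_lhs => rw [← (ℛ k x).eq]
      simp [Finset.sum_mul]
    rw [h2] at h1
    simp only [LinearMap.comp_apply, LinearMap.mulLeft_apply, LinearMap.sum_apply, hU]
    simp only [map_sum, map_smul, Finset.mul_sum, mul_smul_comm]
    rw [← h1, Finset.sum_comm]
  rw [traceIntegral_apply, key, map_sum]
  -- Cyclicity of the trace brings `U i` next to the contraction with `eⁱ`, where `hUT` applies.
  have h3 : ∀ i, LinearMap.trace k B (contractComul (e.coord i) ∘ₗ
      (LinearMap.mulLeft k x ∘ₗ sqTwist f) ∘ₗ U i) = LinearMap.trace k B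
        ((LinearMap.mulLeft k x ∘ₗ sqTwist f) ∘ₗ (U i ∘ₗ contractComul (e.coord i))) := fun i => by
    rw [LinearMap.trace_comp_comm', LinearMap.comp_assoc]
  rw [Finset.sum_congr rfl fun i _ => h3 i, ← map_sum, show ∑ i, (LinearMap.mulLeft k x ∘ₗ sqTwist f) ∘ₗ (U i ∘ₗ contractComul (e.coord i)) =
      (LinearMap.mulLeft k x ∘ₗ sqTwist f) ∘ₗ ∑ i, U i ∘ₗ contractComul (e.coord i) from
      (map_sum (LinearMap.llcomp k B B B (LinearMap.mulLeft k x ∘ₗ sqTwist f)) _ _).symm,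
    show ∑ i, U i ∘ₗ contractComul (e.coord i) = g 1 • LinearMap.id from
      LinearMap.ext fun z => by simpa [LinearMap.sum_apply] using hUT z]
  rw [LinearMap.comp_smul, LinearMap.comp_id, map_smul, traceIntegral_apply, smul_eq_mul]

/-- If all these functionals vanished, so would the sum over a dual basis of their values at
`S(e_i)`. That sum is the trace of `y ↦ S(y₂) S²(y₁) = S(S(y₁) y₂) = ε(y) 1`, which equals `ε(1) =
1`. -/
lemma exists_traceIntegral_ne_zero [Nontrivial B] : ∃ f : B →ₗ[k] k, traceIntegral f ≠ 0 := by
  by_contra! h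
  let e := Module.finBasis k B
  -- The functional is taken to be `eⁱ` and the argument `S(e_i)`; summing over `i` restores
  -- `S(y₂)`.
  have h1 : ∑ i, LinearMap.mulLeft k (antipode k (e i)) ∘ₗ sqTwist (e.coord i) =
      LinearMap.toSpanSingleton k B 1 ∘ₗ counit := by
    ext y
    have h2 : ∀ a : B, ∑ i, e.repr a i • antipode k (e i) = antipode k a := by
      intro a
      conv_rhs => rw [← e.sum_repr a]
      simp only [map_sum, map_smul]
    have h3 := congrArg (antipode k) (sum_antipode_mul_eq_smul (ℛ k y))
    simp only [map_sum, antipode_mul_antidistrib, map_smul, antipode_one] at h3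
    simp only [LinearMap.sum_apply, LinearMap.comp_apply, LinearMap.mulLeft_apply, sqTwist_sum,
      Finset.mul_sum, Module.Basis.coord_apply, LinearMap.toSpanSingleton_apply]
    rw [Finset.sum_comm, ← h3]
    refine Finset.sum_congr rfl fun j _ => ?_
    rw [← h2 ((ℛ k y).right j), Finset.sum_mul]
    simp
  have h2 := congrArg (LinearMap.trace k B) h1
  rw [map_sum, Finset.sum_eq_zero fun i _ => by rw [← traceIntegral_apply, h]; rfl] at h2
  rw [LinearMap.trace_comp_comm'] at h2
  have h3 : counit ∘ₗ LinearMap.toSpanSingleton k B (1 : B) = LinearMap.id := by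
    ext; simp
  rw [h3] at h2
  simp at h2

/-- Let `l` be a nonzero integral and `S(b) = 0`. Then `l(x S(b₁)) b₂ = 0` for all `x`, by
invariance of `l`. As this holds for every `x`, the argument of `l` may be changed to involve a
further leg of `b`, which gives `l(x S(b₁ S(b₂))) b₃ = l(x) b = 0`. -/
lemma antipode_injective : Function.Injective (antipode k (A := B)) := by
  nontriviality B
  obtain ⟨f, hf⟩ := exists_traceIntegral_ne_zero (k := k) (B := B)
  set l := traceIntegral f with hl
  -- Invariance in the form `x₁ l(x₂) = l(x) 1`, tested against all functionals `g`.
  have hint : ∀ x, TensorProduct.rid k B (l.lTensor B (comul x)) = l x • 1 := by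
    intro x
    refine sub_eq_zero.1 ((Module.forall_dual_apply_eq_zero_iff k _).1 fun g => ?_)
    have h := traceIntegral_contractComul f g x
    rw [contractComul_sum, map_sum] at h
    simp only [map_smul, smul_eq_mul, ← hl] at h
    rw [map_sub, map_smul, smul_eq_mul, mul_comm, ← h, sub_eq_zero, ← (ℛ k x).eq]
    simp [mul_comm]
  rw [injective_iff_map_eq_zero]
  intro b hb
  -- The left side is `S(b₂) b₃ ⊗ S(b₁) = 1 ⊗ S(b)`, the only place where `S(b) = 0` is used.
  have hb1 : ∑ i ∈ (ℛ k b).index, comul (R := k) (antipode k ((ℛ k b).left i)) *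
      ((ℛ k b).right i ⊗ₜ[k] (1 : B)) = 0 := by
    have h1 := convInv_comulAlgHom (k := k) (B := B)
    have h2 : convInv (Bialgebra.comulAlgHom k B) * convHom Algebra.TensorProduct.includeLeft =
        convInv Algebra.TensorProduct.includeRight := by
      rw [h1, mul_assoc, convInv_mul_convHom, mul_one]
    have h3 := congrArg (fun f => f b) h2
    rw [(ℛ k b).convMul_apply] at h3
    simpa [hb] using h3
  let φ : B →ₗ[k] Module.Dual k B := ((LinearMap.mul k B).compr₂ l).flip ∘ₗ antipode k
  -- Multiplying `hb1` by `Δ(x)` and integrating the second leg leaves `l(x S(b₁)) b₂`. Keeping `x`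
  -- free turns this into the vanishing of a tensor in the dual of `B` tensored with `B`.
  have ht : ∑ i ∈ (ℛ k b).index, φ ((ℛ k b).left i) ⊗ₜ[k] (ℛ k b).right i = 0 := by
    refine dualTensorHom_bijective.1 (LinearMap.ext fun x => ?_)
    have h1 := congrArg (fun z => TensorProduct.rid k B (l.lTensor B (comul x * z))) hb1
    have h2 : ∀ (z : B ⊗[k] B) (c : B), TensorProduct.rid k B (l.lTensor B (z * (c ⊗ₜ[k] 1))) =
        TensorProduct.rid k B (l.lTensor B z) * c := by
      intro z c
      induction z using TensorProduct.induction_on with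
      | zero => simp
      | add z w hz hw => simp only [add_mul, map_add, hz, hw]
      | tmul u v => simp
    simp only [Finset.mul_sum, ← mul_assoc, ← Bialgebra.comul_mul, map_sum, h2, hint] at h1
    simpa [LinearMap.sum_apply, φ] using h1
  obtain ⟨x, hx⟩ : ∃ x, l x ≠ 0 := by
    by_contra! h
    exact hf (LinearMap.ext h)
  -- `Ω(g ⊗ c) = g(x S²(c₁)) c₂`: it feeds part of the second leg back into the functional, so that
  -- `S²(b₂) S(b₁)` can form.
  let Ω : Module.Dual k B ⊗[k] B →ₗ[k] B := (TensorProduct.lid k B).toLinearMap ∘ₗ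
    (contractLeft k B).rTensor B ∘ₗ (TensorProduct.assoc k _ B B).symm.toLinearMap ∘ₗ
    ((LinearMap.mulLeft k x ∘ₗ antipode k ∘ₗ antipode k).rTensor B ∘ₗ comul).lTensor _
  have hΩ : ∀ g c, Ω (g ⊗ₜ c) = ∑ i ∈ (ℛ k c).index,
      g (x * antipode k (antipode k ((ℛ k c).left i))) • (ℛ k c).right i := by
    intro g c
    simp only [Ω, LinearMap.comp_apply, LinearMap.lTensor_tmul]
    conv_lhs => rw [← (ℛ k c).eq]
    simp [TensorProduct.tmul_sum]
  have h4 := congrArg Ω ht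
  rw [map_sum, map_zero] at h4
  simp only [hΩ, φ, LinearMap.comp_apply, LinearMap.flip_apply, LinearMap.compr₂_apply,
    LinearMap.mul_apply', mul_assoc, ← antipode_mul_antidistrib] at h4
  let Φ : B ⊗[k] (B ⊗[k] B) →ₗ[k] B := (TensorProduct.lid k B).toLinearMap ∘ₗ
      (l ∘ₗ LinearMap.mulLeft k x ∘ₗ antipode k ∘ₗ LinearMap.mul' k B ∘ₗ
        (antipode k).lTensor B).rTensor B ∘ₗ (TensorProduct.assoc k B B B).symm.toLinearMap
  have h5 := congrArg Φ
    (sum_tmul_tmul_eq (ℛ k b) (fun i => ℛ k ((ℛ k b).left i)) (fun i => ℛ k ((ℛ k b).right i)))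
  simp only [Φ, map_sum, LinearMap.comp_apply, LinearMap.rTensor_tmul, LinearEquiv.coe_coe,
    TensorProduct.assoc_symm_tmul, LinearMap.mul'_apply, LinearMap.lTensor_tmul,
    TensorProduct.lid_tmul, LinearMap.mulLeft_apply] at h5
  rw [h4] at h5
  simp only [← Finset.sum_smul, ← map_sum l, ← Finset.mul_sum, ← map_sum (antipode k),
    sum_mul_antipode_eq_smul, map_smul, antipode_one, mul_smul_comm, mul_one, smul_assoc] at h5
  simp only [smul_comm _ (l x), ← Finset.smul_sum, sum_counit_smul] at h5
  exact (smul_eq_zero.1 h5).resolve_left hx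

lemma antipode_bijective : Function.Bijective (antipode k (A := B)) :=
  ⟨antipode_injective, LinearMap.injective_iff_surjective.1 antipode_injective⟩

/-- The inverse of the antipode. -/
noncomputable def antipodeInv : B →ₗ[k] B :=
  (LinearEquiv.ofBijective (antipode k) antipode_bijective).symm.toLinearMap

@[simp] lemma antipode_antipodeInv (x : B) : antipode k (antipodeInv (k := k) x) = x :=
  (LinearEquiv.ofBijective (antipode k) antipode_bijective).apply_symm_apply x

/-- Applying the injective map `S` turns the claim into `S(x₁) x₂ = ε(x)`. -/
lemma sum_antipodeInv_mul (x : B) : ∑ i ∈ (ℛ k x).index,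
    antipodeInv (k := k) ((ℛ k x).right i) * (ℛ k x).left i = counit (R := k) x • 1 := by
  apply antipode_injective (k := k)
  simp [antipode_mul_antidistrib, sum_antipode_mul_eq_smul]

end Integral
end Antipode
end CentralHopf

/-! ### Comodule algebras: the coaction as a conjugation in a convolution algebra -/

namespace CentralHopf
section ComodulePairing

open Coalgebra WithConv LeftComoduleAlgebra

variable {k : Type u} [Field k] {B : Type u} [Ring B] [HopfAlgebra k B]
  {K : Type u} [Ring K] [Algebra k K] [LeftComoduleAlgebra k B K] {A : Type u} [Ring A]
  [Algebra k A]

/-- `Σ f(κ₋₁ x) θ(κ₀)`. -/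
noncomputable def coactPair (f : B →ₗ[k] A) (θ : K →ₗ[k] A) (x : B) : K →ₗ[k] A :=
  LinearMap.mul' k A ∘ₗ TensorProduct.map (f ∘ₗ LinearMap.mulRight k x) θ ∘ₗ
    (coact (k := k) (B := B)).toLinearMap

/-- Intertwiners compose: by coassociativity `κ` first crosses `g`, where `θ` becomes `θ'`, and then
`f`, where `θ'` becomes `θ''`. Different maps `θ` are allowed at the two ends because the factors of
`adConv` relate `κ ↦ 1 ⊗ κ` to the coaction. -/
lemma coactPair_mul {f g : WithConv (B →ₗ[k] A)} {θ θ' θ'' : K →ₗ[k] A}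
    (hg : ∀ x κ, coactPair g.ofConv θ x κ = θ' κ * g x)
    (hf : ∀ x κ, coactPair f.ofConv θ' x κ = θ'' κ * f x) (x : B) (κ : K) :
    coactPair (f * g).ofConv θ x κ = θ'' κ * (f * g) x := by
  let Ξ (y z : B) : B ⊗[k] (B ⊗[k] K) →ₗ[k] A := LinearMap.mul' k A ∘ₗ
    TensorProduct.map (f.ofConv ∘ₗ LinearMap.mulRight k y) (LinearMap.mul' k A ∘ₗ
      TensorProduct.map (g.ofConv ∘ₗ LinearMap.mulRight k z) θ)
  have h1 : ∀ w : B ⊗[k] K, LinearMap.mul' k A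
      (TensorProduct.map ((f * g).ofConv ∘ₗ LinearMap.mulRight k x) θ w) =
      ∑ i ∈ (ℛ k x).index, Ξ ((ℛ k x).left i) ((ℛ k x).right i)
        (TensorProduct.assoc k B B K ((comul (R := k) (A := B)).rTensor K w)) := by
    intro w
    induction w using TensorProduct.induction_on with
    | zero => simp
    | add a b ha hb => simp only [map_add, ha, hb, Finset.sum_add_distrib]
    | tmul b m =>
      simp only [TensorProduct.map_tmul, LinearMap.mul'_apply, LinearMap.comp_apply,
        LinearMap.mulRight_apply, LinearMap.rTensor_tmul]
      rw [((ℛ k b).mul (ℛ k x)).convMul_apply]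
      conv_rhs => rw [← (ℛ k b).eq]
      simp only [TensorProduct.sum_tmul, map_sum, Finset.sum_mul]
      rw [Finset.sum_comm]
      simp [Coalgebra.Repr.mul, Finset.sum_product, Ξ, mul_assoc]
  have h2 : ∀ (y z : B) (w : B ⊗[k] K), Ξ y z ((coact (k := k) (B := B)).toLinearMap.lTensor B w) =
      LinearMap.mul' k A (TensorProduct.map (f.ofConv ∘ₗ LinearMap.mulRight k y) θ' w) * g z := by
    intro y z w
    induction w using TensorProduct.induction_on with
    | zero => simp
    | add a b ha hb => simp only [map_add, ha, hb, add_mul]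
    | tmul b m =>
      have := hg z m
      simp only [coactPair, LinearMap.comp_apply] at this
      simp only [Ξ, LinearMap.lTensor_tmul, LinearMap.comp_apply, TensorProduct.map_tmul, this,
        LinearMap.mul'_apply, mul_assoc]
  rw [coactPair, LinearMap.comp_apply, LinearMap.comp_apply, AlgHom.toLinearMap_apply, h1,
    LeftComoduleAlgebra.coassoc,
    (ℛ k x).convMul_apply, Finset.mul_sum]
  refine Finset.sum_congr rfl fun i _ => ?_
  rw [h2, ← mul_assoc, ← hf]
  rfl

/-- `κ ↦ 1 ⊗ κ`. -/
abbrev inclK (k B K : Type u) [Field k] [Ring B] [HopfAlgebra k B] [Ring K] [Algebra k K] :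
    K →ₐ[k] B ⊗[k] K := Algebra.TensorProduct.includeRight

/-- `x ↦ x ⊗ 1`. -/
abbrev inclB (k B K : Type u) [Field k] [Ring B] [HopfAlgebra k B] [Ring K] [Algebra k K] :
    B →ₐ[k] B ⊗[k] K := Algebra.TensorProduct.includeLeft

lemma coactPair_inclB (x : B) (κ : K) :
    coactPair (convHom (inclB k B K)).ofConv (inclK k B K).toLinearMap x κ =
      (coact (k := k) (B := B)).toLinearMap κ * convHom (inclB k B K) x := by
  simp only [coactPair, LinearMap.comp_apply, AlgHom.toLinearMap_apply]
  induction coact (k := k) (B := B) κ using TensorProduct.induction_on with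
  | zero => simp
  | add a b ha hb => simp only [map_add, ha, hb, add_mul]
  | tmul b m => simp

/-- Moving `κ` across `ι⁻¹` turns the coaction back into `1 ⊗ κ`, since `S(κ₋₂ x) κ₋₁ ⊗ κ₀ = S(x)
S(κ₋₂) κ₋₁ ⊗ κ₀` collapses. -/
lemma coactPair_convInv_inclB (x : B) (κ : K) :
    coactPair (convInv (inclB k B K)).ofConv (coact (k := k) (B := B)).toLinearMap x κ =
      (inclK k B K).toLinearMap κ * convInv (inclB k B K) x := by
  let Ξ : B ⊗[k] (B ⊗[k] K) →ₗ[k] B ⊗[k] K := (LinearMap.mul' k B ∘ₗ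
    (LinearMap.mulLeft k (HopfAlgebra.antipode k x) ∘ₗ HopfAlgebra.antipode k).rTensor B).rTensor K
      ∘ₗ (TensorProduct.assoc k B B K).symm.toLinearMap
  have h := congrArg Ξ (LeftComoduleAlgebra.coassoc (k := k) (B := B) κ)
  have h1 : ∀ w : B ⊗[k] K, Ξ (TensorProduct.assoc k B B K
      ((comul (R := k) (A := B)).rTensor K w)) = HopfAlgebra.antipode k x ⊗ₜ[k]
        TensorProduct.lid k K ((counit (R := k) (A := B)).rTensor K w) := by
    intro w
    induction w using TensorProduct.induction_on with
    | zero => simp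
    | add a b ha hb => simp only [map_add, ha, hb, TensorProduct.tmul_add]
    | tmul b m =>
      have h2 := congrArg (fun z => (HopfAlgebra.antipode k x * z) ⊗ₜ[k] m)
        (HopfAlgebra.sum_antipode_mul_eq_smul (ℛ k b))
      simp only [LinearMap.rTensor_tmul]
      conv_lhs => rw [← (ℛ k b).eq]
      simpa [Ξ, TensorProduct.sum_tmul, Finset.mul_sum, mul_assoc, TensorProduct.smul_tmul] using h2
  have h3 : ∀ w : B ⊗[k] K, LinearMap.mul' k (B ⊗[k] K) (TensorProduct.map
      ((convInv (inclB k B K)).ofConv ∘ₗ LinearMap.mulRight k x)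
      (coact (k := k) (B := B)).toLinearMap w) =
      Ξ ((coact (k := k) (B := B)).toLinearMap.lTensor B w) := by
    intro w
    induction w using TensorProduct.induction_on with
    | zero => simp
    | add a b ha hb => simp only [map_add, ha, hb]
    | tmul b m =>
      simp only [TensorProduct.map_tmul, LinearMap.lTensor_tmul, AlgHom.toLinearMap_apply]
      induction coact (k := k) (B := B) m using TensorProduct.induction_on with
      | zero => simp
      | add a b ha hb => simp only [TensorProduct.tmul_add, map_add, ha, hb]
      | tmul c m => simp [Ξ, HopfAlgebra.antipode_mul_antidistrib]
  rw [coactPair, LinearMap.comp_apply, LinearMap.comp_apply, h3, AlgHom.toLinearMap_apply, ← h, h1,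
    counit_coact]
  simp

/-- `x ↦ S(x₁) a(x₂)₋₁ x₃ ⊗ a(x₂)₀`. -/
noncomputable def adConv (a : WithConv (B →ₗ[k] K)) : WithConv (B →ₗ[k] B ⊗[k] K) :=
  convInv (inclB k B K) * convPost B (coact (k := k) (B := B)) a * convHom (inclB k B K)

/-- The condition `a(κ₋₁ x) κ₀ = κ a(x)`. -/
def IsCoactLinear (a : WithConv (B →ₗ[k] K)) : Prop :=
  ∀ x κ, coactPair a.ofConv LinearMap.id x κ = κ * a x

lemma IsCoactLinear.mul {a b : WithConv (B →ₗ[k] K)} (ha : IsCoactLinear a)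
    (hb : IsCoactLinear b) : IsCoactLinear (a * b) :=
  coactPair_mul (θ' := LinearMap.id) (θ'' := LinearMap.id) hb ha

/-- The coaction is an algebra map, so it can be applied to the defining identity of `a`. -/
lemma IsCoactLinear.coactPair_coact {a : WithConv (B →ₗ[k] K)} (ha : IsCoactLinear a) (x : B)
    (κ : K) : coactPair (convPost B (coact (k := k) (B := B)) a).ofConv
      (coact (k := k) (B := B)).toLinearMap x κ =
      (coact (k := k) (B := B)).toLinearMap κ * convPost B (coact (k := k) (B := B)) a x := by
  have h := congrArg (coact (k := k) (B := B)) (ha x κ)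
  rw [map_mul] at h
  refine Eq.trans ?_ h
  simp only [coactPair, LinearMap.comp_apply]
  induction (coact (k := k) (B := B)).toLinearMap κ using TensorProduct.induction_on with
  | zero => simp
  | add a b ha hb => simp only [map_add, ha, hb]
  | tmul c m => simp [convPost]

/-- Across the three factors of `adConv a`, read from the right, `1 ⊗ κ` becomes the coaction of
`κ`, stays so, and returns to `1 ⊗ κ`. -/
lemma IsCoactLinear.adConv {a : WithConv (B →ₗ[k] K)} (ha : IsCoactLinear a) (x : B) (κ : K) :
    coactPair (adConv a).ofConv (inclK k B K).toLinearMap x κ =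
      (inclK k B K).toLinearMap κ * adConv a x :=
  coactPair_mul coactPair_inclB (coactPair_mul ha.coactPair_coact coactPair_convInv_inclB) x κ

/-- A conjugation is multiplicative. -/
lemma adConv_mul (a b : WithConv (B →ₗ[k] K)) : adConv (a * b) = adConv a * adConv b := by
  simp only [adConv, map_mul, mul_assoc, convHom_mul_convInv_assoc]

lemma adConv_one : adConv (1 : WithConv (B →ₗ[k] K)) = 1 := by
  rw [adConv, map_one, mul_one, convInv_mul_convHom]

/-- The description of `adConv a` without the antipode. It is the form in which the Yetter–Drinfeld
condition, the compatibility of half-braidings and commutativity are read off. -/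
lemma inclB_mul_adConv (a : WithConv (B →ₗ[k] K)) : convHom (inclB k B K) * adConv a =
    convPost B (coact (k := k) (B := B)) a * convHom (inclB k B K) := by
  rw [adConv, mul_assoc, convHom_mul_convInv_assoc]

/-- The counit on the first leg is an algebra map that sends `ι` and `ι⁻¹` to `1`, so the
conjugation disappears. -/
lemma counit_adConv (a : WithConv (B →ₗ[k] K)) (x : B) :
    TensorProduct.lid k K ((counit (R := k) (A := B)).rTensor K (adConv a x)) = a x := by
  let e : B ⊗[k] K →ₐ[k] K := (Algebra.TensorProduct.lid k K).toAlgHom.comp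
    (Algebra.TensorProduct.map (Bialgebra.counitAlgHom k B) (AlgHom.id k K))
  have h1 : convPost B e (adConv a) = a := by
    have e1 : convPost B e (convInv (inclB k B K)) = 1 := by
      ext x; simp [e, convInv, Algebra.algebraMap_eq_smul_one]
    have e2 : convPost B e (convHom (inclB k B K)) = 1 := by
      ext x; simp [e, Algebra.algebraMap_eq_smul_one]
    have e3 : convPost B e (convPost B (coact (k := k) (B := B)) a) = a := by
      ext x; exact counit_coact (k := k) (B := B) (a x)
    rw [adConv, map_mul, map_mul, e1, e2, e3, one_mul, mul_one]
  exact congrArg (fun f => f x) h1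

/-- `x ↦ 1 ⊗ (x ⊗ 1)`. -/
abbrev inclMid (k A B K : Type u) [Field k] [Ring A] [Algebra k A] [Ring B] [HopfAlgebra k B]
    [Ring K] [Algebra k K] : B →ₐ[k] A ⊗[k] (B ⊗[k] K) :=
  Algebra.TensorProduct.includeRight.comp (inclB k B K)

/-- Write `D = Δ ⊗ id` and `c = id ⊗ δ`. Then `D ∘ ι` is the product of `j(x) = x ⊗ 1 ⊗ 1` and the
middle inclusion, `D ∘ δ = c ∘ δ` by coassociativity, and `j = c ∘ ι`. Conjugating by `D ∘ ι` is
thus conjugating by `j`, which gives `c ∘ ad(a)`, and then by the middle inclusion. -/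
lemma comul_adConv (a : WithConv (B →ₗ[k] K)) (x : B) :
    TensorProduct.assoc k B B K ((comul (R := k) (A := B)).rTensor K (adConv a x)) =
    (convInv (inclMid k B B K) * convPost B (Algebra.TensorProduct.map (AlgHom.id k B)
      (coact (k := k) (B := B))) (adConv a) * convHom (inclMid k B B K)) x := by
  let D : B ⊗[k] K →ₐ[k] B ⊗[k] (B ⊗[k] K) :=
    (Algebra.TensorProduct.assoc k k k B B K).toAlgHom.comp
      (Algebra.TensorProduct.map (Bialgebra.comulAlgHom k B) (AlgHom.id k K))
  let j : B →ₐ[k] B ⊗[k] (B ⊗[k] K) := Algebra.TensorProduct.includeLeft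
  have hD : ∀ z, D z = TensorProduct.assoc k B B K ((comul (R := k) (A := B)).rTensor K z) :=
    fun z => rfl
  rw [← hD, ← convPost_apply]
  refine congrArg (fun f : WithConv (B →ₗ[k] B ⊗[k] (B ⊗[k] K)) => f x) ?_
  have e1 : convHom (D.comp (inclB k B K)) = convHom j * convHom (inclMid k B B K) := by
    ext x
    rw [(ℛ k x).convMul_apply]
    simp only [AlgHom.toLinearMap_apply, AlgHom.comp_apply, hD, inclB,
      Algebra.TensorProduct.includeLeft_apply, LinearMap.rTensor_tmul]
    conv_lhs => rw [← (ℛ k x).eq]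
    simp [TensorProduct.sum_tmul, j]
  -- The inverse of a product of two convolution units is the product of the inverses in reverse
  -- order.
  have e2 : convInv (D.comp (inclB k B K)) = convInv (inclMid k B B K) * convInv j := by
    refine convInv_eq_of_mul ?_
    rw [e1, mul_assoc, convHom_mul_convInv_assoc, convHom_mul_convInv]
  set c := Algebra.TensorProduct.map (AlgHom.id k B) (coact (k := k) (B := B) (K := K)) with hc
  have e3 : c.comp (inclB k B K) = j := by
    ext x; simp [c, j, Algebra.TensorProduct.one_def]
  have e4 : D.comp (coact (k := k) (B := B) (K := K)) = c.comp (coact (k := k) (B := B)) :=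
    AlgHom.ext fun κ => LeftComoduleAlgebra.coassoc (k := k) (B := B) κ
  calc convPost B D (adConv a)
      = convInv (D.comp (inclB k B K)) * convPost B (D.comp (coact (k := k) (B := B))) a *
          convHom (D.comp (inclB k B K)) := by rw [adConv, map_mul, map_mul]; rfl
    _ = convInv (inclMid k B B K) * (convInv (c.comp (inclB k B K)) *
          convPost B (c.comp (coact (k := k) (B := B))) a * convHom (c.comp (inclB k B K))) *
          convHom (inclMid k B B K) := by rw [e1, e2, e3, e4]; simp only [mul_assoc]
    _ = _ := by rw [adConv, map_mul, map_mul]; rfl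

/-- A relation between `R` and the two orders of `Δ` passes from `B` to any comodule algebra: by
coassociativity both sides come from `κ₋₂ ⊗ κ₋₁ ⊗ κ₀`, with the map `p` on the first or on the
second leg. The `K`-leg commutes with `R`, which has entry `1` there. -/
lemma coact_mul_of_comul_mul {T : Type u} [Ring T] [Algebra k T] (p : B →ₐ[k] T) {R : T ⊗[k] B}
    (hR : ∀ x : B, R * ∑ i ∈ (ℛ k x).index, p ((ℛ k x).right i) ⊗ₜ[k] (ℛ k x).left i =
      (∑ i ∈ (ℛ k x).index, p ((ℛ k x).left i) ⊗ₜ[k] (ℛ k x).right i) * R) (κ : K) :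
    Algebra.TensorProduct.map (AlgHom.id k T) (coact (k := k) (B := B))
        (Algebra.TensorProduct.map p (AlgHom.id k K) (coact (k := k) (B := B) κ)) *
      Algebra.TensorProduct.map (AlgHom.id k T) (inclB k B K) R =
    Algebra.TensorProduct.map (AlgHom.id k T) (inclB k B K) R *
      Algebra.TensorProduct.leftComm k B T K (Algebra.TensorProduct.map (AlgHom.id k B)
        ((Algebra.TensorProduct.map p (AlgHom.id k K)).comp (coact (k := k) (B := B)))
          (coact κ)) := by
  have h0 : ∀ (R : T ⊗[k] B) (m : K),
      Algebra.TensorProduct.map (AlgHom.id k T) (inclB k B K) R *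
        ((1 : T) ⊗ₜ[k] ((1 : B) ⊗ₜ[k] m)) =
      ((1 : T) ⊗ₜ[k] ((1 : B) ⊗ₜ[k] m)) *
        Algebra.TensorProduct.map (AlgHom.id k T) (inclB k B K) R := by
    intro R m
    induction R using TensorProduct.induction_on with
    | zero => simp
    | add a b ha hb => simp only [map_add, add_mul, mul_add, ha, hb]
    | tmul a b => simp
  set R' := Algebra.TensorProduct.map (AlgHom.id k T) (inclB k B K) R with hR'
  let P : B ⊗[k] (B ⊗[k] K) →ₗ[k] T ⊗[k] (B ⊗[k] K) := p.toLinearMap.rTensor _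
  let P' : B ⊗[k] (B ⊗[k] K) →ₗ[k] T ⊗[k] (B ⊗[k] K) :=
    (TensorProduct.leftComm k B T K).toLinearMap ∘ₗ
      TensorProduct.map LinearMap.id (p.toLinearMap.rTensor K)
  have h1 : ∀ w : B ⊗[k] K, P (TensorProduct.assoc k _ _ K
      ((comul (R := k) (A := B)).rTensor K w)) * R' =
      R' * P' (TensorProduct.assoc k _ _ K
      ((comul (R := k) (A := B)).rTensor K w)) := by
    intro w
    induction w using TensorProduct.induction_on with
    | zero => simp
    | add a b ha hb => simp only [map_add, add_mul, mul_add, ha, hb]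
    | tmul b m =>
      have h2 := congrArg (fun z => Algebra.TensorProduct.map (AlgHom.id k T)
        (inclB k B K) z * ((1 : T) ⊗ₜ[k] ((1 : B) ⊗ₜ[k] m))) (hR b)
      simp only [map_mul, mul_assoc] at h2
      change R' * _ = _ * (R' * _) at h2
      rw [hR', h0 R, ← hR', map_sum, map_sum] at h2
      simp only [LinearMap.rTensor_tmul]
      rw [← (ℛ k b).eq]
      simpa [P, P', TensorProduct.sum_tmul, Finset.sum_mul, Finset.mul_sum,
        ← mul_assoc] using h2.symm
  have h2 : Algebra.TensorProduct.map (AlgHom.id k T) (coact (k := k) (B := B))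
        (Algebra.TensorProduct.map p (AlgHom.id k K) (coact (k := k) (B := B) κ)) =
      P ((coact (k := k) (B := B)).toLinearMap.lTensor _ (coact κ)) := by
    induction coact (k := k) (B := B) κ using TensorProduct.induction_on with
    | zero => simp
    | add a b ha hb => simp only [map_add, ha, hb]
    | tmul b m => simp [P]
  have h3 : ∀ w : B ⊗[k] K, Algebra.TensorProduct.leftComm k B T K
      (Algebra.TensorProduct.map (AlgHom.id k B)
        ((Algebra.TensorProduct.map p (AlgHom.id k K)).comp (coact (k := k) (B := B))) w) =
      P' ((coact (k := k) (B := B)).toLinearMap.lTensor _ w) := by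
    intro w
    induction w using TensorProduct.induction_on with
    | zero => simp
    | add a b ha hb => simp only [map_add, ha, hb]
    | tmul b m => rfl
  rw [h2, h3, ← LeftComoduleAlgebra.coassoc, h1]

end ComodulePairing

/-! ### Colinearity over `T` as an equality of ring homomorphisms -/

section Translation

open Coalgebra WithConv LeftComoduleAlgebra Bosonization

variable {k : Type u} [Field k] {T : Type u} [Ring T] [HopfAlgebra k T] (𝓡 : RMatrix k T)
  {H : Type u} [Ring H] [Algebra k H] [Coalgebra k H] [BraidedHopfAlgebra 𝓡 H]
  {A : Type u} [Ring A] [Algebra k A]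

variable (H) in
/-- The element `R² ⊗ (1 # R¹)`. -/
noncomputable def flipR : T ⊗[k] Bosonization 𝓡 H := ∑ c ∈ 𝓡.supp, c.2 ⊗ₜ[k] inT 𝓡 c.1

/-- `R² π(x₂) ⊗ R¹ x₁ = π(x₁) R² ⊗ x₂ R¹`. -/
lemma flipR_mul (x : Bosonization 𝓡 H) :
    flipR 𝓡 H * ∑ i ∈ (ℛ k x).index, proj 𝓡 ((ℛ k x).right i) ⊗ₜ[k] (ℛ k x).left i =
      (∑ i ∈ (ℛ k x).index, proj 𝓡 ((ℛ k x).left i) ⊗ₜ[k] (ℛ k x).right i) * flipR 𝓡 H := by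
  -- The `B`-linearity of the braiding `W ⊗ V_π → V_π ⊗ W` for the two regular representations,
  -- evaluated at `1 ⊗ 1`.
  have h := LinearMap.congr_fun (hb_comm 𝓡 (Algebra.lmul k T)
    (Algebra.lmul k (Bosonization 𝓡 H)) x) (1 ⊗ₜ[k] 1)
  simp only [LinearMap.comp_apply, tρ_sum, LinearEquiv.coe_coe, map_sum,
    RMatrix.braidEquiv_tmul, AlgHom.comp_apply, Algebra.coe_lmul_eq_mul, LinearMap.mul_apply',
    mul_one] at h
  simp only [flipR, Finset.mul_sum, Finset.sum_mul, Algebra.TensorProduct.tmul_mul_tmul]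
  rw [h, Finset.sum_comm]

lemma comul_inT_mul (t : T) (x : Bosonization 𝓡 H) : comul (R := k) (inT 𝓡 t * x) =
    ∑ i ∈ (ℛ k t).index, ∑ j ∈ (ℛ k x).index,
      (inT 𝓡 ((ℛ k t).left i) * (ℛ k x).left j) ⊗ₜ[k]
        (inT 𝓡 ((ℛ k t).right i) * (ℛ k x).right j) := by
  rw [Bialgebra.comul_mul, comul_eq, comulHom_inT, comT_sum, ← (ℛ k x).eq, Finset.sum_mul_sum]
  simp

lemma counit_inT (t : T) : counit (R := k) (inT 𝓡 (H := H) t) = counit (R := k) t :=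
  counitHom_inT 𝓡 t

/-- `f ↦ (x ↦ R² ⊗ f(R¹ x))`, a map of convolution rings. -/
noncomputable def translateR : WithConv (Bosonization 𝓡 H →ₗ[k] A) →+*
    WithConv (Bosonization 𝓡 H →ₗ[k] T ⊗[k] A) where
  toFun f := toConv (∑ c ∈ 𝓡.supp, TensorProduct.mk k T A c.2 ∘ₗ f.ofConv ∘ₗ
    LinearMap.mulLeft k (inT 𝓡 c.1))
  map_zero' := by ext; simp
  map_add' f g := by ext; simp [TensorProduct.tmul_add, Finset.sum_add_distrib, LinearMap.sum_apply]
  map_one' := by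
    ext x
    -- The unit is preserved because `ε(R¹) R² = 1`.
    have h := congrArg (fun z => counit (R := k) x • (z ⊗ₜ[k] (1 : A))) 𝓡.counit_left_sum
    simp only [TensorProduct.sum_tmul, Finset.smul_sum] at h
    simpa [LinearMap.sum_apply, counit_inT, Algebra.algebraMap_eq_smul_one, smul_smul, mul_comm,
      TensorProduct.smul_tmul', Algebra.TensorProduct.one_def] using h
  map_mul' f g := by
    ext x
    let Φ (y z : Bosonization 𝓡 H) : T ⊗[k] (T ⊗[k] T) →ₗ[k] T ⊗[k] A :=
      TensorProduct.map LinearMap.id (LinearMap.mul' k A ∘ₗ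
        TensorProduct.map (f.ofConv ∘ₗ LinearMap.mulRight k y ∘ₗ (inT 𝓡).toLinearMap)
          (g.ofConv ∘ₗ LinearMap.mulRight k z ∘ₗ (inT 𝓡).toLinearMap)) ∘ₗ
      (TensorProduct.comm k (T ⊗[k] T) T).toLinearMap ∘ₗ
      (TensorProduct.assoc k T T T).symm.toLinearMap
    -- Multiplicativity is `(Δ ⊗ id)R = R₁₃R₂₃`: the two legs of `Δ(R¹)` translate `f` and `g`, and
    -- the second components multiply in `T`.
    have h := fun y z => congrArg (Φ y z) 𝓡.comul_left_sum
    simp only [Φ, map_sum, LinearMap.comp_apply, TensorProduct.map_tmul, LinearEquiv.coe_coe,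
      TensorProduct.comm_tmul, TensorProduct.assoc_symm_tmul, LinearMap.mul'_apply,
      LinearMap.id_apply, AlgHom.toLinearMap_apply, LinearMap.mulRight_apply] at h
    rw [(ℛ k x).convMul_apply]
    simp only [LinearMap.sum_apply, LinearMap.comp_apply, TensorProduct.mk_apply,
      LinearMap.mulLeft_apply, LinearMap.convMul_apply, comul_inT_mul, map_sum,
      TensorProduct.map_tmul, LinearMap.mul'_apply, Finset.sum_mul_sum,
      Algebra.TensorProduct.tmul_mul_tmul]
    rw [Finset.sum_congr rfl fun _ _ => Finset.sum_comm, Finset.sum_comm]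
    exact Finset.sum_congr rfl fun j _ => h _ _

lemma translateR_apply (f : WithConv (Bosonization 𝓡 H →ₗ[k] A)) (x : Bosonization 𝓡 H) :
    translateR 𝓡 f x = ∑ c ∈ 𝓡.supp, c.2 ⊗ₜ[k] f (inT 𝓡 c.1 * x) := by
  simp [translateR, LinearMap.sum_apply]

variable {K : Type u} [Ring K] [Algebra k K] [LeftComoduleAlgebra k (Bosonization 𝓡 H) K]

variable (H K) in
/-- The coaction of `T` on `K` as an algebra map. -/
noncomputable def coactKHom : K →ₐ[k] T ⊗[k] K :=
  (Algebra.TensorProduct.map (proj 𝓡) (AlgHom.id k K)).comp (coact (k := k) (B := Bosonization 𝓡 H))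

variable (H K) in
/-- The diagonal coaction `b ⊗ κ ↦ π(κ₋₁) ⊗ b ⊗ κ₀`. -/
noncomputable def coactMid : Bosonization 𝓡 H ⊗[k] K →ₐ[k] T ⊗[k] (Bosonization 𝓡 H ⊗[k] K) :=
  (Algebra.TensorProduct.leftComm k (Bosonization 𝓡 H) T K).toAlgHom.comp
    (Algebra.TensorProduct.map (AlgHom.id k _) (coactKHom 𝓡 H K))

lemma coactKHom_mul_flipR (κ : K) :
    Algebra.TensorProduct.map (AlgHom.id k T) (coact (k := k) (B := Bosonization 𝓡 H))
        (coactKHom 𝓡 H K κ) *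
      Algebra.TensorProduct.map (AlgHom.id k T) (inclB k (Bosonization 𝓡 H) K) (flipR 𝓡 H) =
    Algebra.TensorProduct.map (AlgHom.id k T) (inclB k (Bosonization 𝓡 H) K) (flipR 𝓡 H) *
      coactMid 𝓡 H K (coact κ) :=
  coact_mul_of_comul_mul (proj 𝓡) (flipR_mul 𝓡) κ

/-- Translation changes `ι` only by a constant left factor, which the conjugation in `adConv` can
absorb. -/
lemma translateR_inclB : translateR 𝓡 (convHom (inclB k (Bosonization 𝓡 H) K)) =
    convConst k _ (Algebra.TensorProduct.map (AlgHom.id k T)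
      (inclB k (Bosonization 𝓡 H) K) (flipR 𝓡 H)) * convHom (inclMid k T (Bosonization 𝓡 H) K) := by
  ext x
  rw [translateR_apply, convConst_mul_apply]
  simp [flipR, Finset.sum_mul]

lemma convPost_coactMid_inclB (f : Bosonization 𝓡 H →ₗ[k] Bosonization 𝓡 H) :
    convPost _ (coactMid 𝓡 H K) (toConv ((inclB k (Bosonization 𝓡 H) K).toLinearMap ∘ₗ f)) =
      toConv ((inclMid k T (Bosonization 𝓡 H) K).toLinearMap ∘ₗ f) := by
  ext x
  simp [coactMid, Algebra.TensorProduct.one_def]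

/-- `translateR` is a ring homomorphism, so it conjugates `translateR (δ ∘ a)` by `translateR ι = R'
* j`. Colinearity of `a` rewrites the middle factor through the coaction, and moving `R'` across it
(`coactKHom_mul_flipR`) puts the remaining `T`-leg on `K` alone. What is left is `coactMid` applied
to `adConv a`. Since `coactMid` does not coact on the `B`-leg, coefficients along that leg are again
colinear. -/
lemma translateR_adConv {a : WithConv (Bosonization 𝓡 H →ₗ[k] K)}
    (ha : translateR 𝓡 a = convPost _ (coactKHom 𝓡 H K) a) :
    translateR 𝓡 (adConv a) = convPost _ (coactMid 𝓡 H K) (adConv a) := by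
  set ι := inclB k (Bosonization 𝓡 H) K
  set j := inclMid k T (Bosonization 𝓡 H) K
  set c := Algebra.TensorProduct.map (AlgHom.id k T) (coact (k := k) (B := Bosonization 𝓡 H)
    (K := K)) with hc
  set R' := convConst k (Bosonization 𝓡 H)
    (Algebra.TensorProduct.map (AlgHom.id k T) ι (flipR 𝓡 H)) with hR'
  have e1 : translateR 𝓡 (convPost _ (coact (k := k) (B := Bosonization 𝓡 H)) a) =
      convPost _ (c.comp (coactKHom 𝓡 H K)) a := by
    have : translateR 𝓡 (convPost _ (coact (k := k) (B := Bosonization 𝓡 H)) a) =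
        convPost _ c (translateR 𝓡 a) := by
      ext x
      simp only [translateR_apply, convPost_apply, map_sum]
      simp [c]
    rw [this, ha]; rfl
  have e2 : convPost _ (coactMid 𝓡 H K) (adConv a) = convInv j *
      convPost _ ((coactMid 𝓡 H K).comp (coact (k := k) (B := Bosonization 𝓡 H))) a *
      convHom j := by
    rw [adConv, map_mul, map_mul, convInv, convPost_coactMid_inclB]
    congr 1
    exact convPost_coactMid_inclB 𝓡 LinearMap.id
  have e3 : convPost _ (c.comp (coactKHom 𝓡 H K)) a * R' = R' *
      convPost _ ((coactMid 𝓡 H K).comp (coact (k := k) (B := Bosonization 𝓡 H))) a := by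
    ext x
    rw [mul_convConst_apply, convConst_mul_apply]
    exact coactKHom_mul_flipR 𝓡 (a x)
  have e4 : translateR 𝓡 (convInv ι) * translateR 𝓡 (convHom ι) = 1 := by
    rw [← map_mul, convInv_mul_convHom, map_one]
  -- It suffices to compare after multiplication by `translateR ι`, which `e4` shows to be
  -- cancellable on the left in the present product.
  have e5 : translateR 𝓡 (convHom ι) * convPost _ (coactMid 𝓡 H K) (adConv a) =
      convPost _ (c.comp (coactKHom 𝓡 H K)) a * translateR 𝓡 (convHom ι) := by
    rw [e2, translateR_inclB, ← hR', mul_assoc (convInv j), mul_assoc R',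
      convHom_mul_convInv_assoc, ← mul_assoc, ← mul_assoc, e3]
  rw [adConv, map_mul, map_mul, e1, mul_assoc, ← e5, ← mul_assoc, e4, one_mul]
  rfl

end Translation
end CentralHopf

/-! ### Separating families of linear maps on tensor products -/

namespace CentralHopf
section Separation

variable {k : Type*} [Field k] {X Y Z : Type*} [AddCommGroup X] [Module k X]
  [AddCommGroup Y] [Module k Y] [AddCommGroup Z] [Module k Z]

lemma sum_basis_contract {ι : Type*} [Fintype ι] (b : Module.Basis ι k X) (z : X ⊗[k] Y) :
    ∑ i, b i ⊗ₜ[k] TensorProduct.lid k Y ((b.coord i).rTensor Y z) = z := by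
  induction z using TensorProduct.induction_on with
  | zero => simp
  | add x y hx hy => simp only [map_add, TensorProduct.tmul_add, Finset.sum_add_distrib, hx, hy]
  | tmul x y =>
    have h := congrArg (fun x => x ⊗ₜ[k] y) (b.sum_repr x)
    simp only [TensorProduct.sum_tmul, TensorProduct.smul_tmul] at h
    simpa using h

/-- Expanding along a basis of the finite-dimensional factor reduces equality in `X ⊗ Y` to equality
of coordinates in `Y`. Below, the separating maps are evaluations of functions at the points of `B`.
-/
lemma tensor_ext_of_separating [Module.Finite k X] {ι : Type*} (e : ι → Y →ₗ[k] Z)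
    (he : ∀ y y', (∀ i, e i y = e i y') → y = y') {z z' : X ⊗[k] Y}
    (h : ∀ i, (e i).lTensor X z = (e i).lTensor X z') : z = z' := by
  let b := Module.finBasis k X
  rw [← sum_basis_contract b z, ← sum_basis_contract b z']
  refine Finset.sum_congr rfl fun j _ => congrArg _ (he _ _ fun i => ?_)
  have h1 : ∀ z : X ⊗[k] Y, e i (TensorProduct.lid k Y ((b.coord j).rTensor Y z)) =
      TensorProduct.lid k Z ((b.coord j).rTensor Z ((e i).lTensor X z)) := by
    intro z
    induction z using TensorProduct.induction_on with
    | zero => simp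
    | add x y hx hy => simp only [map_add, hx, hy]
    | tmul x y => simp
  rw [h1, h1, h]

end Separation

/-! ### Yetter–Drinfeld modules and objects of the centre -/

section YetterDrinfeld

open Coalgebra

variable {k : Type u} [Field k] {B : Type u} [Ring B] [HopfAlgebra k B]

/-- A left-left Yetter–Drinfeld structure on a representation of `B`. -/
structure YetterDrinfeld (X : FRep k B) where
  δ : X.V →ₗ[k] B ⊗[k] X.V
  coassoc : ∀ v, TensorProduct.assoc k B B X.V ((comul (R := k) (A := B)).rTensor X.V (δ v)) =
    δ.lTensor B (δ v)
  counit : ∀ v, TensorProduct.lid k X.V ((Coalgebra.counit (R := k) (A := B)).rTensor X.V (δ v)) = v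
  compat : ∀ (h : B) (v : X.V), ∑ i ∈ (ℛ k h).index,
      TensorProduct.map (LinearMap.mulLeft k ((ℛ k h).left i)) (X.ρ ((ℛ k h).right i)) (δ v) =
    ∑ i ∈ (ℛ k h).index,
      (LinearMap.mulRight k ((ℛ k h).right i)).rTensor X.V (δ (X.ρ ((ℛ k h).left i) v))

namespace YetterDrinfeld
variable {X : FRep k B} (D : YetterDrinfeld X) (W : FRep k B)

/-- The half-braiding `v ⊗ w ↦ v₋₁ w ⊗ v₀`. -/
noncomputable def braidMap : X.V ⊗[k] W.V →ₗ[k] W.V ⊗[k] X.V :=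
  TensorProduct.lift (LinearMap.flip
    ((LinearMap.lcomp k (W.V ⊗[k] X.V) D.δ) ∘ₗ (LinearMap.rTensorHom X.V) ∘ₗ W.ρ.toLinearMap.flip))

@[simp] lemma braidMap_tmul (v : X.V) (w : W.V) :
    D.braidMap W (v ⊗ₜ[k] w) = (evAt W.ρ w).rTensor X.V (D.δ v) := rfl

/-- `compat`, with both sides applied to `w` through the `B`-leg. -/
lemma braidMap_comm (b : B) : D.braidMap W ∘ₗ tρ X.ρ W.ρ b = tρ W.ρ X.ρ b ∘ₗ D.braidMap W := by
  refine TensorProduct.ext' fun v w => ?_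
  have h := congrArg ((evAt W.ρ w).rTensor X.V) (D.compat b v)
  simp only [map_sum] at h
  simp only [LinearMap.comp_apply, tρ_sum, map_sum, braidMap_tmul]
  have h1 : ∀ c (z : B ⊗[k] X.V), (evAt W.ρ w).rTensor X.V
      ((LinearMap.mulRight k c).rTensor X.V z) = (evAt W.ρ (W.ρ c w)).rTensor X.V z := by
    intro c z
    induction z using TensorProduct.induction_on with
    | zero => simp
    | add x y hx hy => simp only [map_add, hx, hy]
    | tmul x y => simp
  rw [Finset.sum_congr rfl fun i _ => (h1 _ _).symm, ← h]
  induction D.δ v using TensorProduct.induction_on with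
  | zero => simp
  | add x y hx hy => simp only [map_add, Finset.sum_add_distrib, hx, hy]
  | tmul x y => simp [tρ_sum]

lemma braidMap_assoc {U : FRep k B} (z : B ⊗[k] (B ⊗[k] X.V)) (u : U.V) (w : W.V) :
    (TensorProduct.assoc k U.V W.V X.V).symm
      (TensorProduct.map (evAt U.ρ u) ((evAt W.ρ w).rTensor X.V) z) =
    TensorProduct.map (TensorProduct.map (evAt U.ρ u) (evAt W.ρ w)) LinearMap.id
      ((TensorProduct.assoc k B B X.V).symm z) := by
  induction z using TensorProduct.induction_on with
  | zero => simp
  | add x y hx hy => simp only [map_add, hx, hy]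
  | tmul x y =>
    induction y using TensorProduct.induction_on with
    | zero => simp
    | add x y hx hy => simp only [TensorProduct.tmul_add, map_add, hx, hy]
    | tmul y z => simp

/-- The hexagon is coassociativity of `δ`: on `U ⊗ W` the coefficient `v₋₁` acts through its
coproduct, while braiding in two steps uses the coaction twice. -/
lemma braidMap_tensor (U : FRep k B) (v : X.V) (u : U.V) (w : W.V) :
    D.braidMap (U ⊗ W) (v ⊗ₜ[k] (u ⊗ₜ[k] w) : X.V ⊗[k] (U.V ⊗[k] W.V)) =
      (TensorProduct.assoc k U.V W.V X.V).symm ((D.braidMap W).lTensor U.V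
        (TensorProduct.assoc k U.V X.V W.V ((D.braidMap U (v ⊗ₜ[k] u)) ⊗ₜ[k] w))) := by
  have h1 : ∀ z : B ⊗[k] X.V, (D.braidMap W).lTensor U.V
        (TensorProduct.assoc k U.V X.V W.V (((evAt U.ρ u).rTensor X.V z) ⊗ₜ[k] w)) =
      TensorProduct.map (evAt U.ρ u) ((evAt W.ρ w).rTensor X.V) (D.δ.lTensor B z) := by
    intro z
    induction z using TensorProduct.induction_on with
    | zero => simp
    | add x y hx hy => simp only [TensorProduct.add_tmul, map_add, hx, hy]
    | tmul x y => simp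
  rw [braidMap_tmul D U, h1, braidMap_assoc, ← D.coassoc, LinearEquiv.symm_apply_apply]
  change (evAt (tρ U.ρ W.ρ) (u ⊗ₜ[k] w)).rTensor X.V (D.δ v) = _
  induction D.δ v using TensorProduct.induction_on with
  | zero => simp
  | add x y hx hy => simp only [map_add, hx, hy]
  | tmul x y => simp [tρ_tmul]

variable [Module.Finite k B]

/-- The inverse half-braiding `w ⊗ v ↦ v₀ ⊗ S⁻¹(v₋₁) w`. -/
noncomputable def unbraidMap : W.V ⊗[k] X.V →ₗ[k] X.V ⊗[k] W.V :=
  TensorProduct.lift (LinearMap.compr₂ (LinearMap.flip ((LinearMap.flip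
    (LinearMap.rTensorHom X.V ∘ₗ (W.ρ.toLinearMap ∘ₗ antipodeInv).flip)) ∘ₗ D.δ)).flip.flip
      (TensorProduct.comm k W.V X.V).toLinearMap)

@[simp] lemma unbraidMap_tmul (w : W.V) (v : X.V) :
    D.unbraidMap W (w ⊗ₜ[k] v) = TensorProduct.comm k W.V X.V
      ((evAt W.ρ w ∘ₗ antipodeInv).rTensor X.V (D.δ v)) := rfl

/-- After coassociativity the element `S⁻¹(v₋₁) v₋₂` acts on `w`, and it collapses to a counit. -/
lemma unbraidMap_braidMap : D.unbraidMap W ∘ₗ D.braidMap W = LinearMap.id := by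
  refine TensorProduct.ext' fun v w => ?_
  let Ξ : B ⊗[k] B →ₗ[k] W.V := evAt W.ρ w ∘ₗ LinearMap.mul' k B ∘ₗ
    (antipodeInv (k := k) (B := B)).rTensor B ∘ₗ (TensorProduct.comm k B B).toLinearMap
  have h1 : ∀ z : B ⊗[k] X.V, D.unbraidMap W ((evAt W.ρ w).rTensor X.V z) =
      TensorProduct.comm k W.V X.V (Ξ.rTensor X.V
        ((TensorProduct.assoc k B B X.V).symm (D.δ.lTensor B z))) := by
    intro z
    induction z using TensorProduct.induction_on with
    | zero => simp
    | add x y hx hy => simp only [map_add, hx, hy]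
    | tmul x y =>
      simp only [LinearMap.rTensor_tmul, LinearMap.lTensor_tmul, unbraidMap_tmul]
      induction D.δ y using TensorProduct.induction_on with
      | zero => simp
      | add x y hx hy => simp only [TensorProduct.tmul_add, map_add, hx, hy]
      | tmul a b => simp [Ξ]
  have h2 : ∀ z : B ⊗[k] X.V, Ξ.rTensor X.V ((comul (R := k) (A := B)).rTensor X.V z) =
      w ⊗ₜ[k] TensorProduct.lid k X.V ((Coalgebra.counit (R := k) (A := B)).rTensor X.V z) := by
    intro z
    induction z using TensorProduct.induction_on with
    | zero => simp
    | add x y hx hy => simp only [map_add, hx, hy, TensorProduct.tmul_add]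
    | tmul x y =>
      have h3 := congrArg (fun b => W.ρ b w ⊗ₜ[k] y) (sum_antipodeInv_mul (k := k) x)
      simp only [LinearMap.rTensor_tmul]
      conv_lhs => rw [← (ℛ k x).eq]
      simpa [Ξ, TensorProduct.smul_tmul] using h3
  rw [LinearMap.comp_apply, braidMap_tmul, h1, ← D.coassoc, LinearEquiv.symm_apply_apply, h2,
    D.counit]
  simp

/-- The half-braiding as a linear isomorphism. -/
noncomputable def braidEquiv : X.V ⊗[k] W.V ≃ₗ[k] W.V ⊗[k] X.V :=
  LinearEquiv.ofBijective (D.braidMap W) (by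
    -- A left inverse is enough, because both tensor products have the same finite dimension.
    have hi : Function.Injective (D.braidMap W) :=
      Function.LeftInverse.injective (g := D.unbraidMap W)
        (fun z => LinearMap.congr_fun (D.unbraidMap_braidMap W) z)
    refine ⟨hi, (LinearMap.injective_iff_surjective_of_finrank_eq_finrank ?_).1 hi⟩
    rw [Module.finrank_tensorProduct, Module.finrank_tensorProduct, mul_comm])

/-- The half-braiding of a Yetter–Drinfeld module. -/
noncomputable def halfBraiding : HalfBraiding X where
  β W := FRep.mkIso (X := X ⊗ W) (Y := W ⊗ X) (D.braidEquiv W) (D.braidMap_comm W)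
  monoidal U W := FRep.Hom.ext (TensorProduct.ext (LinearMap.ext fun v =>
    TensorProduct.ext' fun u w => D.braidMap_tensor W U v u w))
  naturality {U U'} f := FRep.Hom.ext (TensorProduct.ext' fun v u => by
    change (evAt U'.ρ (f.hom u)).rTensor X.V (D.δ v) =
      f.hom.rTensor X.V ((evAt U.ρ u).rTensor X.V (D.δ v))
    induction D.δ v using TensorProduct.induction_on with
    | zero => simp
    | add x y hx hy => simp only [map_add, hx, hy]
    | tmul x y => simp [FRep.hom_comm])

/-- A Yetter–Drinfeld module as an object of the centre. -/
noncomputable abbrev center : Center (FRep k B) := ⟨X, D.halfBraiding⟩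

open MonObj in
/-- An algebra whose coaction is multiplicative is an algebra in the centre. -/
noncomputable abbrev monObj [MonObj X]
    (hmul : ∀ v w : X.V, D.δ ((μ[X]).hom (v ⊗ₜ[k] w : X.V ⊗[k] X.V)) =
      TensorProduct.map (LinearMap.mul' k B) (μ[X]).hom
        (TensorProduct.tensorTensorTensorComm k B X.V B X.V (D.δ v ⊗ₜ[k] D.δ w)))
    (hone : D.δ ((η[X]).hom (1 : k)) = 1 ⊗ₜ[k] (η[X]).hom (1 : k)) :
    MonObj D.center where
  mul := Center.Hom.mk (X := D.center ⊗ D.center) (Y := D.center) (μ[X])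
    (fun U => FRep.Hom.ext (TensorProduct.ext_threefold fun v w u => by
      change D.braidMap U ((μ[X]).hom (v ⊗ₜ[k] w : X.V ⊗[k] X.V) ⊗ₜ[k] u) =
        (μ[X]).hom.lTensor U.V (TensorProduct.assoc k U.V X.V X.V ((D.braidMap U).rTensor X.V
          ((TensorProduct.assoc k X.V U.V X.V).symm (v ⊗ₜ[k] (D.braidMap U (w ⊗ₜ[k] u))))))
      -- Compatibility of the product with the half-braiding: the coefficient of a product is the
      -- product of the coefficients, and these act on `u` one after the other.
      rw [braidMap_tmul, braidMap_tmul, hmul]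
      induction D.δ w using TensorProduct.induction_on with
      | zero => simp
      | add x y hx hy => simp only [TensorProduct.tmul_add, map_add, hx, hy]
      | tmul c y =>
        simp only [LinearMap.rTensor_tmul, TensorProduct.assoc_symm_tmul, braidMap_tmul]
        induction D.δ v using TensorProduct.induction_on with
        | zero => simp
        | add x y hx hy => simp only [TensorProduct.add_tmul, map_add, hx, hy]
        | tmul d z => simp))
  one := Center.Hom.mk (X := 𝟙_ (Center (FRep k B))) (Y := D.center) (η[X])
    (fun U => FRep.Hom.ext (TensorProduct.ext' fun (c : k) u => by
      change D.braidMap U ((η[X]).hom c ⊗ₜ[k] u) = (η[X]).hom.lTensor U.V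
        ((TensorProduct.rid k U.V).symm (TensorProduct.lid k U.V (c ⊗ₜ[k] u)))
      have hc : (η[X]).hom c = c • (η[X]).hom (1 : k) := by
        rw [← map_smul, smul_eq_mul, _root_.mul_one]
      rw [hc, braidMap_tmul, map_smul, hone]
      simp [TensorProduct.smul_tmul']))
  one_mul := Center.ext _ _ (MonObj.one_mul X)
  mul_one := Center.ext _ _ (MonObj.mul_one X)
  mul_assoc := Center.ext _ _ (MonObj.mul_assoc X)

end YetterDrinfeld
end YetterDrinfeld

/-! ### Algebras of functions on `B` as algebras in the centre -/

section ConvolutionModule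

open Coalgebra WithConv

variable {k : Type u} [Field k] {B : Type u} [Ring B] [HopfAlgebra k B]
  {A : Type u} [Ring A] [Algebra k A]

/-- `x ⊗ h ↦ x ε(h)`. -/
noncomputable def projLeft : B ⊗[k] B →ₗc[k] B :=
  (Coalgebra.TensorProduct.rid k k B).toCoalgHom.comp
    (Coalgebra.TensorProduct.map (CoalgHom.id k B) (Coalgebra.counitCoalgHom k B))

/-- `x ⊗ h ↦ ε(x) h`. -/
noncomputable def projRight : B ⊗[k] B →ₗc[k] B :=
  (Coalgebra.TensorProduct.lid k B).toCoalgHom.comp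
    (Coalgebra.TensorProduct.map (Coalgebra.counitCoalgHom k B) (CoalgHom.id k B))

@[simp] lemma projLeft_tmul (x h : B) : projLeft (x ⊗ₜ[k] h) = counit (R := k) h • x := rfl

@[simp] lemma projRight_tmul (x h : B) : projRight (x ⊗ₜ[k] h) = counit (R := k) x • h := rfl

/-- `f ↦ f(- ⊗ h)`. -/
noncomputable def convLeft (f : WithConv (B ⊗[k] B →ₗ[k] A)) (h : B) : WithConv (B →ₗ[k] A) :=
  toConv (f.ofConv ∘ₗ (TensorProduct.mk k B B).flip h)

@[simp] lemma convLeft_apply (f : WithConv (B ⊗[k] B →ₗ[k] A)) (h x : B) :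
    convLeft f h x = f (x ⊗ₜ[k] h) := rfl

/-- Fixing the second argument of a function on `B ⊗ B` is compatible with convolution by functions
of the first argument alone, because the counit removes the second leg. -/
lemma convLeft_mul (f : WithConv (B ⊗[k] B →ₗ[k] A)) (g : WithConv (B →ₗ[k] A)) (h : B) :
    convLeft (f * convPre A projLeft g) h = convLeft f h * g := by
  ext x
  have h1 := fun i => congrArg ((TensorProduct.rid k A).toLinearMap ∘ₗ
    (f.ofConv ∘ₗ TensorProduct.mk k B B ((ℛ k x).left i)).rTensor k) (sum_tmul_counit_eq (ℛ k h))
  simp only [map_sum, LinearMap.comp_apply, LinearMap.rTensor_tmul, LinearEquiv.coe_coe,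
    TensorProduct.rid_tmul, one_smul, TensorProduct.mk_apply] at h1
  rw [convLeft_apply, ((ℛ k x).tmul (ℛ k h)).convMul_apply, (ℛ k x).convMul_apply]
  simp only [Coalgebra.Repr.tmul, Finset.sum_product, convPre_apply, projLeft_tmul, map_smul,
    convLeft_apply]
  refine Finset.sum_congr rfl fun i _ => ?_
  rw [← h1, Finset.sum_mul]
  simp

lemma convLeft_mul' (f : WithConv (B ⊗[k] B →ₗ[k] A)) (g : WithConv (B →ₗ[k] A)) (h : B) :
    convLeft (convPre A projLeft g * f) h = g * convLeft f h := by
  ext x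
  have h1 := fun i => congrArg (f.ofConv ∘ₗ TensorProduct.mk k B B ((ℛ k x).right i))
    (sum_counit_smul (ℛ k h))
  simp only [map_sum, LinearMap.comp_apply, map_smul, TensorProduct.mk_apply] at h1
  rw [convLeft_apply, ((ℛ k x).tmul (ℛ k h)).convMul_apply, (ℛ k x).convMul_apply]
  simp only [Coalgebra.Repr.tmul, Finset.sum_product, convPre_apply, projLeft_tmul, map_smul,
    convLeft_apply]
  refine Finset.sum_congr rfl fun i _ => ?_
  rw [← h1, Finset.mul_sum]
  simp

lemma mul_projRight_apply (f : WithConv (B ⊗[k] B →ₗ[k] A)) (g : WithConv (B →ₗ[k] A)) (x h : B) :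
    (f * convPre A projRight g) (x ⊗ₜ[k] h) =
      ∑ i ∈ (ℛ k h).index, f (x ⊗ₜ[k] (ℛ k h).left i) * g ((ℛ k h).right i) := by
  have h1 := fun j => congrArg ((TensorProduct.rid k A).toLinearMap ∘ₗ
    (f.ofConv ∘ₗ (TensorProduct.mk k B B).flip ((ℛ k h).left j)).rTensor k)
    (sum_tmul_counit_eq (ℛ k x))
  simp only [map_sum, LinearMap.comp_apply, LinearMap.rTensor_tmul, LinearEquiv.coe_coe,
    TensorProduct.rid_tmul, one_smul, TensorProduct.mk_apply, LinearMap.flip_apply] at h1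
  rw [((ℛ k x).tmul (ℛ k h)).convMul_apply]
  simp only [Coalgebra.Repr.tmul, Finset.sum_product_right, convPre_apply, projRight_tmul,
    map_smul]
  refine Finset.sum_congr rfl fun i _ => ?_
  rw [← h1, Finset.sum_mul]
  simp

lemma projRight_mul_apply (f : WithConv (B ⊗[k] B →ₗ[k] A)) (g : WithConv (B →ₗ[k] A)) (x h : B) :
    (convPre A projRight g * f) (x ⊗ₜ[k] h) =
      ∑ i ∈ (ℛ k h).index, g ((ℛ k h).left i) * f (x ⊗ₜ[k] (ℛ k h).right i) := by
  have h1 := fun j => congrArg (f.ofConv ∘ₗ (TensorProduct.mk k B B).flip ((ℛ k h).right j))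
    (sum_counit_smul (ℛ k x))
  simp only [map_sum, LinearMap.comp_apply, map_smul, TensorProduct.mk_apply,
    LinearMap.flip_apply] at h1
  rw [((ℛ k x).tmul (ℛ k h)).convMul_apply]
  simp only [Coalgebra.Repr.tmul, Finset.sum_product_right, convPre_apply, projRight_tmul,
    map_smul]
  refine Finset.sum_congr rfl fun i _ => ?_
  rw [← h1, Finset.mul_sum]
  simp

/-- An algebra map satisfies `f(x h) = f(x) f(h)`; as functions on the coalgebra `B ⊗ B` the right
side is a convolution product. -/
lemma convPre_mul_convHom (f : B →ₐ[k] A) : convPre A (Bialgebra.mulCoalgHom k B) (convHom f) =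
    convPre A projLeft (convHom f) * convPre A projRight (convHom f) := by
  refine WithConv.ofConv_injective (TensorProduct.ext' fun x h => ?_)
  refine Eq.trans ?_ (mul_projRight_apply _ _ x h).symm
  have h1 := congrArg f (sum_counit_smul (ℛ k h))
  simp only [map_sum, map_smul] at h1
  simp [← h1, Finset.mul_sum]

variable {K : Type u} [Ring K] [Algebra k K] [LeftComoduleAlgebra k B K]

/-- `f ↦ f(- h)`. -/
noncomputable def convTranslate (f : WithConv (B →ₗ[k] A)) (h : B) : WithConv (B →ₗ[k] A) :=
  toConv (f.ofConv ∘ₗ LinearMap.mulRight k h)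

@[simp] lemma convTranslate_apply (f : WithConv (B →ₗ[k] A)) (h x : B) :
    convTranslate f h x = f (x * h) := rfl

/-- The Yetter–Drinfeld condition at the level of functions. Pull `ι * ad(a) = (δ ∘ a) * ι` back
along the multiplication of `B`, which is a coalgebra map. The pullback of `ι` splits into a factor
in `x` and a factor in `h`; cancelling the first on the left leaves a conjugation in `x` only. -/
lemma adConv_convTranslate (a : WithConv (B →ₗ[k] K)) (h x : B) :
    ∑ i ∈ (ℛ k h).index, ((ℛ k h).left i ⊗ₜ[k] (1 : K)) * adConv a (x * (ℛ k h).right i) =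
      ∑ i ∈ (ℛ k h).index, adConv (convTranslate a ((ℛ k h).left i)) x *
        ((ℛ k h).right i ⊗ₜ[k] (1 : K)) := by
  set ι := inclB k B K
  set E := convPost B (LeftComoduleAlgebra.coact (k := k) (B := B)) a
  let m := Bialgebra.mulCoalgHom k B
  have e1 : convPre _ projRight (convHom ι) * convPre _ m (adConv a) =
      convPre _ projLeft (convInv ι) * convPre _ m E * convPre _ projLeft (convHom ι) *
        convPre _ projRight (convHom ι) := by
    have e2 : convPre _ m (convHom ι) * convPre _ m (adConv a) =
        convPre _ m E * convPre _ m (convHom ι) := by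
      rw [← map_mul, ← map_mul, inclB_mul_adConv]
    rw [convPre_mul_convHom] at e2
    have e3 : convPre _ projLeft (convInv ι) * convPre _ projLeft (convHom ι) =
        (1 : WithConv (B ⊗[k] B →ₗ[k] B ⊗[k] K)) := by
      rw [← map_mul, convInv_mul_convHom, map_one]
    rw [mul_assoc _ (convPre _ projLeft (convHom ι)), mul_assoc _ (convPre _ m E), ← e2,
      ← mul_assoc, ← mul_assoc, e3, one_mul]
  have e4 := congrArg (fun f : WithConv (B ⊗[k] B →ₗ[k] B ⊗[k] K) => f (x ⊗ₜ[k] h)) e1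
  simp only [mul_projRight_apply, projRight_mul_apply] at e4
  refine e4.trans (Finset.sum_congr rfl fun i _ => ?_)
  -- For fixed `h₁` the remaining product is the conjugation of `δ ∘ a(- h₁)`, that is, `adConv` of
  -- the translate.
  have e5 := convLeft_mul (convPre _ projLeft (convInv ι) * convPre _ m E) (convHom ι)
    ((ℛ k h).left i)
  rw [convLeft_mul'] at e5
  have e6 := congrArg (fun f : WithConv (B →ₗ[k] B ⊗[k] K) => f x) e5
  exact congrArg (fun z => z * ((ℛ k h).right i ⊗ₜ[k] (1 : K))) e6

/-- An algebra of functions `B → K` that is stable under translation and under the coefficients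
of `adConv`. -/
structure FunctionAlgebra (k B K : Type u) [Field k] [Ring B] [HopfAlgebra k B]
    [Ring K] [Algebra k K] [LeftComoduleAlgebra k B K] (X : FRep k B) where
  j : X.V →ₗ[k] B →ₗ[k] K
  injective : Function.Injective j
  j_act : ∀ h v x, j (X.ρ h v) x = j v (x * h)
  δ : X.V →ₗ[k] B ⊗[k] X.V
  j_δ : ∀ v x, (j.flip x).lTensor B (δ v) = adConv (toConv (j v)) x
  mul : X.V ⊗[k] X.V →ₗ[k] X.V
  j_mul : ∀ v w, toConv (j (mul (v ⊗ₜ[k] w))) = toConv (j v) * toConv (j w)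
  one : X.V
  j_one : toConv (j one) = 1

namespace FunctionAlgebra
variable {X : FRep k B} (D : FunctionAlgebra k B K X)

lemma ext {v w : X.V} (h : ∀ x, D.j.flip x v = D.j.flip x w) : v = w :=
  D.injective (LinearMap.ext h)

variable [Module.Finite k B]

lemma coassoc (v : X.V) : TensorProduct.assoc k B B X.V
    ((comul (R := k) (A := B)).rTensor X.V (D.δ v)) = D.δ.lTensor B (D.δ v) := by
  -- Evaluations separate the points of `X`, hence those of `B ⊗ X`, hence those of `B ⊗ (B ⊗ X)`.
  -- It remains to compare functions of `x`.
  refine tensor_ext_of_separating (fun x => (D.j.flip x).lTensor B)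
    (fun y y' h => tensor_ext_of_separating (fun x => D.j.flip x) (fun _ _ => D.ext) h) fun x => ?_
  have h1 : ∀ z : B ⊗[k] X.V, ((D.j.flip x).lTensor B).lTensor B
      (TensorProduct.assoc k B B X.V ((comul (R := k) (A := B)).rTensor X.V z)) =
      TensorProduct.assoc k B B K ((comul (R := k) (A := B)).rTensor K
        ((D.j.flip x).lTensor B z)) := by
    intro z
    induction z using TensorProduct.induction_on with
    | zero => simp
    | add x y hx hy => simp only [map_add, hx, hy]
    | tmul b w =>
      simp only [LinearMap.rTensor_tmul, LinearMap.lTensor_tmul]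
      induction comul (R := k) b using TensorProduct.induction_on with
      | zero => simp
      | add x y hx hy => simp only [TensorProduct.add_tmul, map_add, hx, hy]
      | tmul a c => simp
  -- Coacting a second time conjugates the coefficient functions by the middle inclusion;
  -- `comul_adConv` has the same form.
  have h2 : ∀ z : B ⊗[k] X.V, ((D.j.flip x).lTensor B).lTensor B (D.δ.lTensor B z) =
      ∑ i ∈ (ℛ k x).index, ∑ l ∈ (ℛ k ((ℛ k x).left i)).index,
        convInv (inclMid k B B K) ((ℛ k ((ℛ k x).left i)).left l) *
          Algebra.TensorProduct.map (AlgHom.id k B) (LeftComoduleAlgebra.coact (k := k) (B := B))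
            ((D.j.flip ((ℛ k ((ℛ k x).left i)).right l)).lTensor B z) *
          convHom (inclMid k B B K) ((ℛ k x).right i) := by
    intro z
    induction z using TensorProduct.induction_on with
    | zero => simp
    | add x y hx hy => simp only [map_add, mul_add, add_mul, Finset.sum_add_distrib, hx, hy]
    | tmul b w =>
      simp only [LinearMap.lTensor_tmul, D.j_δ]
      rw [adConv, (ℛ k x).convMul_apply, TensorProduct.tmul_sum]
      refine Finset.sum_congr rfl fun i _ => ?_
      rw [(ℛ k ((ℛ k x).left i)).convMul_apply, Finset.sum_mul, TensorProduct.tmul_sum]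
      refine Finset.sum_congr rfl fun l _ => ?_
      simp
  rw [h1, h2, D.j_δ, comul_adConv, (ℛ k x).convMul_apply]
  refine Finset.sum_congr rfl fun i _ => ?_
  rw [(ℛ k ((ℛ k x).left i)).convMul_apply, Finset.sum_mul]
  simp only [D.j_δ]
  rfl

lemma counit (v : X.V) : TensorProduct.lid k X.V
    ((Coalgebra.counit (R := k) (A := B)).rTensor X.V (D.δ v)) = v := by
  refine D.ext fun x => ?_
  have h1 : ∀ z : B ⊗[k] X.V, D.j.flip x (TensorProduct.lid k X.V
      ((Coalgebra.counit (R := k) (A := B)).rTensor X.V z)) = TensorProduct.lid k K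
      ((Coalgebra.counit (R := k) (A := B)).rTensor K ((D.j.flip x).lTensor B z)) := by
    intro z
    induction z using TensorProduct.induction_on with
    | zero => simp
    | add x y hx hy => simp only [map_add, hx, hy]
    | tmul b w => simp
  rw [h1, D.j_δ, counit_adConv]
  rfl

/-- Evaluation at `x` turns the two sides into those of `adConv_convTranslate`, since the action of
`B` is translation. -/
lemma compat (h : B) (v : X.V) : ∑ i ∈ (ℛ k h).index,
      TensorProduct.map (LinearMap.mulLeft k ((ℛ k h).left i)) (X.ρ ((ℛ k h).right i)) (D.δ v) =
    ∑ i ∈ (ℛ k h).index,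
      (LinearMap.mulRight k ((ℛ k h).right i)).rTensor X.V (D.δ (X.ρ ((ℛ k h).left i) v)) := by
  refine tensor_ext_of_separating (fun x => D.j.flip x) (fun _ _ => D.ext) fun x => ?_
  have h1 : ∀ (b c : B) (z : B ⊗[k] X.V), (D.j.flip x).lTensor B
      (TensorProduct.map (LinearMap.mulLeft k b) (X.ρ c) z) =
      (b ⊗ₜ[k] (1 : K)) * (D.j.flip (x * c)).lTensor B z := by
    intro b c z
    induction z using TensorProduct.induction_on with
    | zero => simp
    | add x y hx hy => simp only [map_add, mul_add, hx, hy]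
    | tmul a w => simp [D.j_act]
  have h2 : ∀ (b : B) (z : B ⊗[k] X.V), (D.j.flip x).lTensor B
      ((LinearMap.mulRight k b).rTensor X.V z) = (D.j.flip x).lTensor B z * (b ⊗ₜ[k] (1 : K)) := by
    intro b z
    induction z using TensorProduct.induction_on with
    | zero => simp
    | add x y hx hy => simp only [map_add, add_mul, hx, hy]
    | tmul a w => simp
  have h3 : ∀ c, convTranslate (toConv (D.j v)) c = toConv (D.j (X.ρ c v)) := fun c =>
    WithConv.ofConv_injective (LinearMap.ext fun y => (D.j_act c v y).symm)
  simp only [map_sum, h1, h2, D.j_δ, adConv_convTranslate, h3]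

/-- The Yetter–Drinfeld structure of an algebra of functions. -/
noncomputable def yetterDrinfeld : YetterDrinfeld X where
  δ := D.δ
  coassoc := D.coassoc
  counit := D.counit
  compat := D.compat

lemma j_mul_apply (v w : X.V) (x : B) : D.j (D.mul (v ⊗ₜ[k] w)) x =
    ∑ i ∈ (ℛ k x).index, D.j v ((ℛ k x).left i) * D.j w ((ℛ k x).right i) := by
  have h := congrArg (fun f : WithConv (B →ₗ[k] K) => f x) (D.j_mul v w)
  exact h.trans ((ℛ k x).convMul_apply _ _)

/-- The product of an algebra of functions. -/
noncomputable abbrev monObj : MonObj X where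
  mul := FRep.Hom.mk (X := X ⊗ X) D.mul (fun b => TensorProduct.ext' fun v w => by
    refine D.ext fun x => ?_
    change D.j (D.mul (tρ X.ρ X.ρ b (v ⊗ₜ[k] w))) x = D.j (X.ρ b (D.mul (v ⊗ₜ[k] w))) x
    -- Linearity over `B` is multiplicativity of `Δ`: convolution at `x b` runs over `x₁ b₁ ⊗ x₂
    -- b₂`.
    have h := congrArg (fun f : WithConv (B →ₗ[k] K) => f (x * b)) (D.j_mul v w)
    rw [((ℛ k x).mul (ℛ k b)).convMul_apply] at h
    rw [D.j_act, tρ_sum, map_sum, map_sum, LinearMap.sum_apply]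
    refine Eq.trans ?_ h.symm
    simp only [j_mul_apply, D.j_act]
    exact (Finset.sum_product_right _ _ fun p : (B × B) × (B × B) =>
      D.j v ((ℛ k x).left p.1 * (ℛ k b).left p.2) *
        D.j w ((ℛ k x).right p.1 * (ℛ k b).right p.2)).symm)
  one := FRep.Hom.mk (X := 𝟙_ _) (LinearMap.toSpanSingleton k X.V D.one)
    (fun b => LinearMap.ext_ring (D.ext fun x => by
      have h : ∀ y, D.j D.one y = algebraMap k K (Coalgebra.counit (R := k) y) := fun y =>
        congrArg (fun f : WithConv (B →ₗ[k] K) => f y) D.j_one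
      change D.j (uρ k B b 1 • D.one) x = D.j (X.ρ b ((1 : k) • D.one)) x
      rw [one_smul, D.j_act, map_smul, LinearMap.smul_apply, h, h, Bialgebra.counit_mul]
      simp [Algebra.algebraMap_eq_smul_one, smul_smul, mul_comm]))
  one_mul := FRep.Hom.ext (TensorProduct.ext' fun c v => D.injective
    (congrArg ofConv (show toConv (D.j (D.mul ((c • D.one) ⊗ₜ[k] v))) = toConv (D.j (c • v)) by
      rw [← TensorProduct.smul_tmul', map_smul, map_smul, map_smul, toConv_smul, D.j_mul, D.j_one,
        one_mul]; rfl)))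
  mul_one := FRep.Hom.ext (TensorProduct.ext' fun v c => D.injective
    (congrArg ofConv (show toConv (D.j (D.mul (v ⊗ₜ[k] (c • D.one)))) = toConv (D.j (c • v)) by
      rw [TensorProduct.tmul_smul, map_smul, map_smul, map_smul, toConv_smul, D.j_mul, D.j_one,
        mul_one]; rfl)))
  mul_assoc := FRep.Hom.ext (TensorProduct.ext_threefold fun u v w => D.injective
    (congrArg ofConv (show toConv (D.j (D.mul (D.mul (u ⊗ₜ[k] v) ⊗ₜ[k] w))) =
        toConv (D.j (D.mul (u ⊗ₜ[k] (D.mul (v ⊗ₜ[k] w))))) by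
      simp only [D.j_mul, mul_assoc])))

lemma δ_mul (v w : X.V) : D.δ (D.mul (v ⊗ₜ[k] w)) = TensorProduct.map (LinearMap.mul' k B) D.mul
    (TensorProduct.tensorTensorTensorComm k B X.V B X.V (D.δ v ⊗ₜ[k] D.δ w)) := by
  refine tensor_ext_of_separating (fun x => D.j.flip x) (fun _ _ => D.ext) fun x => ?_
  have h1 : ∀ z z' : B ⊗[k] X.V, (D.j.flip x).lTensor B (TensorProduct.map (LinearMap.mul' k B)
      D.mul (TensorProduct.tensorTensorTensorComm k B X.V B X.V (z ⊗ₜ[k] z'))) =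
      ∑ i ∈ (ℛ k x).index, (D.j.flip ((ℛ k x).left i)).lTensor B z *
        (D.j.flip ((ℛ k x).right i)).lTensor B z' := by
    intro z z'
    induction z using TensorProduct.induction_on with
    | zero => simp
    | add x y hx hy => simp only [TensorProduct.add_tmul, map_add, add_mul, Finset.sum_add_distrib,
        hx, hy]
    | tmul a y =>
      induction z' using TensorProduct.induction_on with
      | zero => simp
      | add x y hx hy => simp only [TensorProduct.tmul_add, map_add, mul_add,
          Finset.sum_add_distrib, hx, hy]
      | tmul b z => simp [j_mul_apply, TensorProduct.tmul_sum]
  rw [h1, D.j_δ, D.j_mul, adConv_mul, (ℛ k x).convMul_apply]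
  simp only [D.j_δ]

lemma δ_one : D.δ D.one = 1 ⊗ₜ[k] D.one := by
  refine tensor_ext_of_separating (fun x => D.j.flip x) (fun _ _ => D.ext) fun x => ?_
  have h : D.j D.one x = algebraMap k K (Coalgebra.counit (R := k) x) :=
    congrArg (fun f : WithConv (B →ₗ[k] K) => f x) D.j_one
  rw [D.j_δ, D.j_one, adConv_one]
  simp [h, Algebra.TensorProduct.one_def, Algebra.algebraMap_eq_smul_one]

/-- An algebra of functions, as an algebra in the centre. -/
noncomputable abbrev centerMonObj : MonObj D.yetterDrinfeld.center :=
  letI := D.monObj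
  D.yetterDrinfeld.monObj D.δ_mul (by
    change D.δ ((1 : k) • D.one) = 1 ⊗ₜ[k] ((1 : k) • D.one)
    rw [one_smul, δ_one])

end FunctionAlgebra
end ConvolutionModule
end CentralHopf

/-! ### The algebra `S^T(H, K)` in the centre -/

namespace CentralHopf
section STAlgebra

open Coalgebra WithConv LeftComoduleAlgebra Bosonization

variable {k : Type u} [Field k] {T : Type u} [Ring T] [HopfAlgebra k T] (𝓡 : RMatrix k T)
  {H : Type u} [Ring H] [Algebra k H] [Coalgebra k H] [BraidedHopfAlgebra 𝓡 H]
  {K : Type u} [Ring K] [Algebra k K] [LeftComoduleAlgebra k (Bosonization 𝓡 H) K]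

variable (H K) in
/-- The map `x ↦ α(x ⊗ 1)` of `α ∈ S^T(H, K)`. -/
noncomputable def stFun : ST 𝓡 H K →ₗ[k] Bosonization 𝓡 H →ₗ[k] K :=
  LinearMap.lcomp k K ((TensorProduct.mk k (Bosonization 𝓡 H) K).flip 1) ∘ₗ (ST 𝓡 H K).subtype

lemma stFun_apply (α : ST 𝓡 H K) (x : Bosonization 𝓡 H) : stFun 𝓡 H K α x = α.1 (x ⊗ₜ[k] 1) := rfl

lemma st_tmul (α : ST 𝓡 H K) (x : Bosonization 𝓡 H) (κ : K) :
    α.1 (x ⊗ₜ[k] κ) = stFun 𝓡 H K α x * κ := α.2.2.1 x κ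

/-- Right `K`-linearity recovers `α` from its values at the `x ⊗ 1`. -/
lemma stFun_injective : Function.Injective (stFun 𝓡 H K) := fun α β h =>
  Subtype.ext (TensorProduct.ext' fun x κ => by rw [st_tmul, st_tmul, h])

lemma isCoactLinear_stFun (α : ST 𝓡 H K) : IsCoactLinear (toConv (stFun 𝓡 H K α)) := by
  intro x κ
  refine Eq.trans ?_ (α.2.1 κ (x ⊗ₜ[k] 1))
  simp only [coactPair, LinearMap.comp_apply, AlgHom.toLinearMap_apply]
  induction coact (k := k) (B := Bosonization 𝓡 H) κ using TensorProduct.induction_on with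
  | zero => rw [map_zero, map_zero, zero_mul, map_zero]
  | add a b ha hb => rw [map_add, map_add, ha, hb, add_mul, map_add]
  | tmul b m =>
    rw [Algebra.TensorProduct.tmul_mul_tmul, mul_one, st_tmul]
    simp

lemma coactT_tmul (x : Bosonization 𝓡 H) (κ : K) : coactT 𝓡 H K (x ⊗ₜ[k] κ) =
    ∑ c ∈ 𝓡.supp, TensorProduct.map (LinearMap.mulLeft k c.2)
      (TensorProduct.mk k (Bosonization 𝓡 H) K (inT 𝓡 c.1 * x)) (coactK 𝓡 H K κ) := by
  simp only [coactT, LinearMap.comp_apply, LinearMap.lTensor_tmul, LinearMap.sum_apply,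
    LinearEquiv.coe_coe]
  refine Finset.sum_congr rfl fun c _ => ?_
  induction coactK 𝓡 H K κ using TensorProduct.induction_on with
  | zero => simp
  | add a b ha hb => simp only [TensorProduct.tmul_add, map_add, ha, hb]
  | tmul a b => simp

/-- Condition 3 at `x ⊗ 1`, where the coaction of `1` is trivial. -/
lemma translateR_stFun (α : ST 𝓡 H K) : translateR 𝓡 (toConv (stFun 𝓡 H K α)) =
    convPost _ (coactKHom 𝓡 H K) (toConv (stFun 𝓡 H K α)) := by
  refine WithConv.ofConv_injective (LinearMap.ext fun x => ?_)
  refine Eq.trans (translateR_apply 𝓡 _ x) ?_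
  refine Eq.trans ?_ (LinearMap.congr_fun α.2.2.2 (x ⊗ₜ[k] 1))
  have h1 : coactK 𝓡 H K 1 = 1 ⊗ₜ[k] 1 := map_one (coactKHom 𝓡 H K)
  rw [LinearMap.comp_apply, coactT_tmul, h1, map_sum]
  simp [stFun_apply]

/-- The element of `S^T(H, K)` with given values at the `x ⊗ 1`. -/
noncomputable def stMk (a : WithConv (Bosonization 𝓡 H →ₗ[k] K)) (h1 : IsCoactLinear a)
    (h2 : translateR 𝓡 a = convPost _ (coactKHom 𝓡 H K) a) : ST 𝓡 H K :=
  ⟨LinearMap.mul' k K ∘ₗ a.ofConv.rTensor K, by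
    refine ⟨fun κ z => ?_, fun x κ => by simp, TensorProduct.ext' fun x κ => ?_⟩
    · induction z using TensorProduct.induction_on with
      | zero => rw [mul_zero, map_zero, mul_zero]
      | add y z hy hz => rw [mul_add, map_add, map_add, hy, hz, mul_add]
      | tmul x l =>
        have h3 : ∀ w : Bosonization 𝓡 H ⊗[k] K,
            (LinearMap.mul' k K ∘ₗ a.ofConv.rTensor K) (w * x ⊗ₜ[k] l) =
            LinearMap.mul' k K (TensorProduct.map (a.ofConv ∘ₗ LinearMap.mulRight k x)
              LinearMap.id w) * l := by
          intro w
          induction w using TensorProduct.induction_on with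
          | zero => rw [zero_mul, map_zero, map_zero, map_zero, zero_mul]
          | add y z hy hz => rw [add_mul, map_add, map_add, map_add, hy, hz, add_mul]
          | tmul y m => simp [mul_assoc]
        refine (h3 _).trans ?_
        have h4 := h1 x κ
        simp only [coactPair, LinearMap.comp_apply, AlgHom.toLinearMap_apply] at h4
        rw [h4]
        simp [mul_assoc]
    -- The coaction of `K` is multiplicative, so colinearity at `x ⊗ 1` multiplied by the coaction
    -- of `κ` is colinearity at `x ⊗ κ`.
    · have h3 := congrArg (fun f : WithConv (Bosonization 𝓡 H →ₗ[k] T ⊗[k] K) =>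
        f x * coactK 𝓡 H K κ) h2
      simp only [translateR_apply, Finset.sum_mul] at h3
      rw [LinearMap.comp_apply, coactT_tmul, map_sum]
      refine Eq.trans (Finset.sum_congr rfl fun c _ => ?_)
        (h3.trans (map_mul (coactKHom 𝓡 H K) (a x) κ).symm)
      induction coactK 𝓡 H K κ using TensorProduct.induction_on with
      | zero => rw [map_zero, map_zero, mul_zero]
      | add y z hy hz => rw [map_add, map_add, hy, hz, mul_add]
      | tmul t m => simp⟩

@[simp] lemma stFun_stMk (a : WithConv (Bosonization 𝓡 H →ₗ[k] K)) (h1 : IsCoactLinear a)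
    (h2 : translateR 𝓡 a = convPost _ (coactKHom 𝓡 H K) a) :
    stFun 𝓡 H K (stMk 𝓡 a h1 h2) = a.ofConv :=
  LinearMap.ext fun x => mul_one (a x)

lemma adConv_add {B : Type u} [Ring B] [HopfAlgebra k B] {K : Type u} [Ring K]
    [Algebra k K] [LeftComoduleAlgebra k B K] (a b : WithConv (B →ₗ[k] K)) :
    adConv (a + b) = adConv a + adConv b := by
  simp only [adConv, map_add, mul_add, add_mul]

lemma adConv_smul {B : Type u} [Ring B] [HopfAlgebra k B] {K : Type u} [Ring K]
    [Algebra k K] [LeftComoduleAlgebra k B K] (c : k) (a : WithConv (B →ₗ[k] K)) :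
    adConv (c • a) = c • adConv a := by
  have h : convPost B (coact (k := k) (B := B)) (c • a) =
      c • convPost B (coact (k := k) (B := B)) a := by
    ext x; simp
  simp only [adConv, h, mul_smul_comm, smul_mul_assoc]

lemma isCoactLinear_one {B : Type u} [Ring B] [HopfAlgebra k B] {K : Type u} [Ring K]
    [Algebra k K] [LeftComoduleAlgebra k B K] : IsCoactLinear (1 : WithConv (B →ₗ[k] K)) := by
  intro x κ
  have h := congrArg (fun m => counit (R := k) x • m) (counit_coact (k := k) (B := B) κ)
  refine Eq.trans ?_ (h.trans (by simp [Algebra.algebraMap_eq_smul_one]))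
  simp only [coactPair, LinearMap.comp_apply, AlgHom.toLinearMap_apply]
  induction coact (k := k) (B := B) κ using TensorProduct.induction_on with
  | zero => simp
  | add y z hy hz => simp only [map_add, smul_add, hy, hz]
  | tmul b l => simp [Algebra.algebraMap_eq_smul_one, smul_smul, mul_comm]

/-- `b ⊗ κ ↦ g(b) κ`. -/
noncomputable def contractLeftOf {B : Type u} [AddCommGroup B] [Module k B]
    (g : B →ₗ[k] k) : B ⊗[k] K →ₗ[k] K :=
  (TensorProduct.lid k K).toLinearMap ∘ₗ g.rTensor K

/-- In `IsCoactLinear.adConv` the element `κ` enters only through `1 ⊗ κ`, and multiplication by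
such elements commutes with applying a functional to the `B`-leg. -/
lemma IsCoactLinear.contract {B : Type u} [Ring B] [HopfAlgebra k B] {K : Type u} [Ring K]
    [Algebra k K] [LeftComoduleAlgebra k B K] {a : WithConv (B →ₗ[k] K)} (ha : IsCoactLinear a)
    (g : B →ₗ[k] k) :
    IsCoactLinear (toConv (contractLeftOf g ∘ₗ (CentralHopf.adConv a).ofConv) :
      WithConv (B →ₗ[k] K)) := by
  intro x κ
  have h1 : ∀ (m : K) (z : B ⊗[k] K), contractLeftOf g (inclK k B K m * z) =
      m * contractLeftOf g z := by
    intro m z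
    induction z using TensorProduct.induction_on with
    | zero => simp
    | add y z hy hz => simp only [map_add, mul_add, hy, hz]
    | tmul b l => simp [contractLeftOf]
  have h2 : ∀ (m : K) (z : B ⊗[k] K), contractLeftOf g (z * inclK k B K m) =
      contractLeftOf g z * m := by
    intro m z
    induction z using TensorProduct.induction_on with
    | zero => simp
    | add y z hy hz => simp only [map_add, add_mul, hy, hz]
    | tmul b l => simp [contractLeftOf]
  refine Eq.trans ?_ ((congrArg (contractLeftOf g) (ha.adConv x κ)).trans (h1 _ _))
  simp only [coactPair, LinearMap.comp_apply]
  induction (coact (k := k) (B := B)).toLinearMap κ using TensorProduct.induction_on with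
  | zero => simp
  | add y z hy hz => simp only [map_add, hy, hz]
  | tmul b l => exact (h2 _ _).symm

/-- By `translateR_adConv` the `T`-coaction does not touch the `B`-leg, so a functional may be
applied there. -/
lemma translateR_contract {a : WithConv (Bosonization 𝓡 H →ₗ[k] K)}
    (ha : translateR 𝓡 a = convPost _ (coactKHom 𝓡 H K) a) (g : Bosonization 𝓡 H →ₗ[k] k) :
    translateR 𝓡 (toConv (contractLeftOf g ∘ₗ (adConv a).ofConv)) =
      convPost _ (coactKHom 𝓡 H K) (toConv (contractLeftOf g ∘ₗ (adConv a).ofConv)) := by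
  refine WithConv.ofConv_injective (LinearMap.ext fun x => ?_)
  refine (translateR_apply 𝓡 _ x).trans ?_
  have h1 := congrArg (fun f : WithConv (Bosonization 𝓡 H →ₗ[k] T ⊗[k] (Bosonization 𝓡 H ⊗[k] K)) =>
    (contractLeftOf (K := K) g).lTensor T (f x)) (translateR_adConv 𝓡 ha)
  simp only [translateR_apply, map_sum] at h1
  refine h1.trans ?_
  change (contractLeftOf (K := K) g).lTensor T (coactMid 𝓡 H K (adConv a x)) =
    coactKHom 𝓡 H K (contractLeftOf g (adConv a x))
  induction adConv a x using TensorProduct.induction_on with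
  | zero => simp
  | add y z hy hz => simp only [map_add, hy, hz]
  | tmul b m =>
    simp only [coactMid, AlgHom.comp_apply, Algebra.TensorProduct.map_tmul, contractLeftOf,
      LinearMap.comp_apply, LinearMap.rTensor_tmul, LinearEquiv.coe_coe, TensorProduct.lid_tmul,
      map_smul]
    induction coactKHom 𝓡 H K m using TensorProduct.induction_on with
    | zero => simp
    | add y z hy hz => simp only [map_add, TensorProduct.tmul_add, smul_add, hy, hz]
    | tmul t l => simp

/-- The product of `S^T(H, K)`. -/
noncomputable def stMul (α β : ST 𝓡 H K) : ST 𝓡 H K :=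
  stMk 𝓡 (toConv (stFun 𝓡 H K α) * toConv (stFun 𝓡 H K β))
    ((isCoactLinear_stFun 𝓡 α).mul (isCoactLinear_stFun 𝓡 β))
    (by rw [map_mul, map_mul, translateR_stFun, translateR_stFun])

lemma stFun_stMul (α β : ST 𝓡 H K) : stFun 𝓡 H K (stMul 𝓡 α β) =
    (toConv (stFun 𝓡 H K α) * toConv (stFun 𝓡 H K β)).ofConv := stFun_stMk 𝓡 _ _ _

variable (H K) in
/-- The unit of `S^T(H, K)`. -/
noncomputable def stOne : ST 𝓡 H K := stMk 𝓡 1 isCoactLinear_one (by rw [map_one, map_one])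

lemma stFun_stOne : stFun 𝓡 H K (stOne 𝓡 H K) =
    (1 : WithConv (Bosonization 𝓡 H →ₗ[k] K)).ofConv := stFun_stMk 𝓡 _ _ _

variable [Module.Finite k H] [Module.Finite k T]

variable (H K) in
/-- The coaction `α ↦ α₋₁ ⊗ α₀` on `S^T(H, K)`. -/
noncomputable def stCoact : ST 𝓡 H K →ₗ[k] Bosonization 𝓡 H ⊗[k] ST 𝓡 H K :=
  -- A basis of `B` is used to write `ad(a)` as a sum of basis elements tensored with coefficient
  -- functions. `lTensor_stCoact` characterizes the result independently of the basis.
  ∑ i, TensorProduct.mk k (Bosonization 𝓡 H) (ST 𝓡 H K) (Module.finBasis k (Bosonization 𝓡 H) i) ∘ₗ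
    { toFun := fun α => stMk 𝓡 (toConv (contractLeftOf
          ((Module.finBasis k (Bosonization 𝓡 H)).coord i) ∘ₗ
            (adConv (toConv (stFun 𝓡 H K α))).ofConv))
        ((isCoactLinear_stFun 𝓡 α).contract _) (translateR_contract 𝓡 (translateR_stFun 𝓡 α) _)
      map_add' := fun α β => stFun_injective 𝓡 (by
        simp only [map_add, stFun_stMk]
        rw [toConv_add, adConv_add]
        exact LinearMap.comp_add _ _ _)
      map_smul' := fun c α => stFun_injective 𝓡 (by
        simp only [map_smul, stFun_stMk, RingHom.id_apply]
        rw [toConv_smul, adConv_smul]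
        exact LinearMap.comp_smul _ _ _) }

lemma lTensor_stCoact (α : ST 𝓡 H K) (x : Bosonization 𝓡 H) :
    ((stFun 𝓡 H K).flip x).lTensor _ (stCoact 𝓡 H K α) = adConv (toConv (stFun 𝓡 H K α)) x := by
  refine Eq.trans ?_ (sum_basis_contract (Module.finBasis k (Bosonization 𝓡 H))
    (adConv (toConv (stFun 𝓡 H K α)) x))
  simp only [stCoact, LinearMap.sum_apply, map_sum, LinearMap.comp_apply]
  refine Finset.sum_congr rfl fun i _ => ?_
  exact congrArg (fun z => _ ⊗ₜ[k] z) (LinearMap.congr_fun (stFun_stMk 𝓡 _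
    ((isCoactLinear_stFun 𝓡 α).contract _) (translateR_contract 𝓡 (translateR_stFun 𝓡 α) _)) x)

variable [Module.Finite k K]

variable (H K) in
/-- `S^T(H, K)` as an algebra of functions on `H # T`. -/
noncomputable def stFunctionAlgebra :
    FunctionAlgebra k (Bosonization 𝓡 H) K (STRep 𝓡 H K) where
  j := stFun 𝓡 H K
  injective := stFun_injective 𝓡
  j_act h α x := rfl
  δ := stCoact 𝓡 H K
  j_δ := lTensor_stCoact 𝓡
  mul := TensorProduct.lift (LinearMap.mk₂ k (stMul 𝓡)
    (fun α α' β => stFun_injective 𝓡 (by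
      simp only [map_add, stFun_stMul]
      rw [toConv_add, add_mul]; rfl))
    (fun c α β => stFun_injective 𝓡 (by
      simp only [map_smul, stFun_stMul]
      rw [toConv_smul, smul_mul_assoc]; rfl))
    (fun α β β' => stFun_injective 𝓡 (by
      simp only [map_add, stFun_stMul]
      rw [toConv_add, mul_add]; rfl))
    (fun c α β => stFun_injective 𝓡 (by
      simp only [map_smul, stFun_stMul]
      rw [toConv_smul, mul_smul_comm]; rfl)))
  j_mul α β := congrArg toConv (stFun_stMul 𝓡 α β)
  one := stOne 𝓡 H K
  j_one := congrArg toConv (stFun_stOne 𝓡)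

/-- The function `x ↦ x ⊗ κ` is `ι` convolved with a constant, so `κ` factors out on the right and
the conjugation remains. -/
lemma adCoact_eq (α : ST 𝓡 H K) (κ : K) (x : Bosonization 𝓡 H) :
    adCoact 𝓡 α.1 κ x = adConv (toConv (stFun 𝓡 H K α)) x * inclK k (Bosonization 𝓡 H) K κ := by
  have h : toConv ((TensorProduct.mk k (Bosonization 𝓡 H) K).flip κ) =
      convHom (inclB k (Bosonization 𝓡 H) K) *
        convConst k _ (inclK k (Bosonization 𝓡 H) K κ) := by
    ext x
    rw [mul_convConst_apply]
    simp
  have h1 : adCoact 𝓡 α.1 κ x = (convInv (inclB k (Bosonization 𝓡 H) K) *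
      (convPost _ (coact (k := k) (B := Bosonization 𝓡 H)) (toConv (stFun 𝓡 H K α)) *
        toConv ((TensorProduct.mk k (Bosonization 𝓡 H) K).flip κ))) x := rfl
  rw [h1, h, ← mul_convConst_apply, adConv]
  simp only [mul_assoc]

lemma lTensor_mulRight_comp {B V A : Type*} [Ring B] [Algebra k B] [AddCommGroup V] [Module k V]
    [Ring A] [Algebra k A] (f : V →ₗ[k] A) (a : A) (z : B ⊗[k] V) :
    (LinearMap.mulRight k a ∘ₗ f).lTensor B z = f.lTensor B z * (1 : B) ⊗ₜ[k] a := by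
  induction z using TensorProduct.induction_on with
  | zero => simp
  | add y z hy hz => simp only [map_add, add_mul, hy, hz]
  | tmul b v => simp

lemma stEval_tmul (x : Bosonization 𝓡 H) (κ : K) :
    stEval 𝓡 (x ⊗ₜ κ) = LinearMap.mulRight k κ ∘ₗ (stFun 𝓡 H K).flip x :=
  LinearMap.ext fun α => st_tmul 𝓡 α x κ

lemma lTensor_stEval_stCoact (α : ST 𝓡 H K) (x : Bosonization 𝓡 H) (κ : K) :
    (stEval 𝓡 (x ⊗ₜ κ)).lTensor (Bosonization 𝓡 H) (stCoact 𝓡 H K α) = adCoact 𝓡 α.1 κ x := by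
  have h := lTensor_mulRight_comp (k := k) (B := Bosonization 𝓡 H) (V := ST 𝓡 H K) (A := K)
    ((stFun 𝓡 H K).flip x) κ (stCoact 𝓡 H K α)
  rw [lTensor_stCoact] at h
  rw [stEval_tmul]
  exact h.trans (adCoact_eq 𝓡 α κ x).symm

lemma stEval_stMul (α β : ST 𝓡 H K) (x : Bosonization 𝓡 H) (κ : K) :
    stEval 𝓡 (x ⊗ₜ κ) (stMul 𝓡 α β) = α.1 ((β.1 ∘ₗ
      (TensorProduct.mk k _ K).flip κ).lTensor (Bosonization 𝓡 H) (comul (R := k) x)) := by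
  conv_rhs => rw [← (ℛ k x).eq]
  simp only [map_sum, LinearMap.lTensor_tmul, st_tmul, LinearMap.comp_apply,
    LinearMap.flip_apply, TensorProduct.mk_apply]
  rw [stEval_tmul, LinearMap.comp_apply, LinearMap.flip_apply, stFun_stMul,
    LinearMap.mulRight_apply]
  refine (congrArg (fun z => z * κ) ((ℛ k x).convMul_apply (toConv (stFun 𝓡 H K α))
    (toConv (stFun 𝓡 H K β)))).trans ?_
  simp only [Finset.sum_mul, mul_assoc]

lemma stEval_stOne (x : Bosonization 𝓡 H) (κ : K) :
    stEval 𝓡 (x ⊗ₜ κ) ((1 : k) • stOne 𝓡 H K) = counit (R := k) x • κ := by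
  rw [one_smul, stEval_tmul, LinearMap.comp_apply, LinearMap.flip_apply, stFun_stOne,
    LinearMap.mulRight_apply]
  simp [Algebra.algebraMap_eq_smul_one]

variable (H K) in
/-- The structure of an algebra in the centre on `S^T(H, K)`. -/
noncomputable def stStructure : STStructure 𝓡 H K where
  δ := stCoact 𝓡 H K
  δ_spec := lTensor_stEval_stCoact 𝓡
  hb := (stFunctionAlgebra 𝓡 H K).yetterDrinfeld.halfBraiding
  hb_spec X α y := rfl
  mon := (stFunctionAlgebra 𝓡 H K).centerMonObj
  mul_spec α β x κ := stEval_stMul 𝓡 α β x κ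
  one_spec x κ := stEval_stOne 𝓡 x κ

end STAlgebra
end CentralHopf

/-! ### Internal Homs of the module category and functions acting on modules -/

namespace CentralHopf
section InternalHomFormulas

open Coalgebra WithConv LeftComoduleAlgebra FRep MonoidalLeftAction

variable {k : Type u} [Field k] {B : Type u} [Ring B] [HopfAlgebra k B] [Module.Finite k B]
  {K : Type u} [Ring K] [Algebra k K] [LeftComoduleAlgebra k B K]
  {X : FRep k B} {L M N : FRep k K}

/-- Morphisms into an internal Hom are computed by letting `h` act first and then evaluating at `1`;
this identity converts the outcome into a value at `h`. The formulas for `pre`, `comp`, `b` and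
`aInv` all arise in this way. -/
lemma homAct_one_tmul (α : homK B M N) (h : B) (m : M.V) :
    (homAct B M N h α).1 (1 ⊗ₜ[k] m) = α.1 (h ⊗ₜ[k] m) := by
  simp

lemma hopfInternalHom_pre (f : L ⟶ M) (α : homK B M N) (h : B) (m : L.V) :
    (((hopfInternalHom B).pre f N).hom α : homK B L N).1 (h ⊗ₜ[k] m) = α.1 (h ⊗ₜ[k] f.hom m) :=
  homAct_one_tmul α h (f.hom m)

lemma hopfInternalHom_comp (α : homK B M N) (β : homK B L M) (h : B) (m : L.V) :
    (((hopfInternalHom B).comp L M N).hom (α ⊗ₜ[k] β : homK B M N ⊗[k] homK B L M) :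
        homK B L N).1 (h ⊗ₜ[k] m) =
      ∑ i ∈ (ℛ k h).index, α.1 ((ℛ k h).left i ⊗ₜ[k] β.1 ((ℛ k h).right i ⊗ₜ[k] m)) := by
  let e : (homK B M N ⊗[k] homK B L M) ⊗[k] L.V →ₗ[k] N.V :=
    ((hopfInternalHom B).ev M N).hom ∘ₗ
      (((hopfInternalHom B).ev L M).hom.lTensor (homK B M N)) ∘ₗ
      (TensorProduct.assoc k (homK B M N) (homK B L M) L.V).toLinearMap
  have h1 : ∀ γ δ, e ((γ ⊗ₜ[k] δ) ⊗ₜ[k] m) = γ.1 (1 ⊗ₜ[k] δ.1 (1 ⊗ₜ[k] m)) := fun γ δ => rfl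
  change e ((tρ (homAct B M N) (homAct B L M) h (α ⊗ₜ[k] β)) ⊗ₜ[k] m) = _
  rw [tρ_sum, TensorProduct.sum_tmul, map_sum]
  simp only [h1, homAct_one_tmul]

lemma hopfInternalHom_b (W : FRep k B) (α : homK B (W ⊙ₗ M) N) (w : W.V) (h : B) (m : M.V) :
    (((hopfInternalHom B).b W M N).hom (α ⊗ₜ[k] w : homK B (W ⊙ₗ M) N ⊗[k] W.V) :
        homK B M N).1 (h ⊗ₜ[k] m) =
      ∑ i ∈ (ℛ k h).index, α.1 ((ℛ k h).left i ⊗ₜ[k]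
        (W.ρ ((ℛ k h).right i) w ⊗ₜ[k] m : W.V ⊗[k] M.V)) := by
  let e : (homK B (W ⊙ₗ M) N ⊗[k] W.V) ⊗[k] M.V →ₗ[k] N.V :=
    ((hopfInternalHom B).ev (W ⊙ₗ M) N).hom ∘ₗ
      (TensorProduct.assoc k (homK B (W ⊙ₗ M) N) W.V M.V).toLinearMap
  have h1 : ∀ γ w, e ((γ ⊗ₜ[k] w) ⊗ₜ[k] m) = γ.1 (1 ⊗ₜ[k] (w ⊗ₜ[k] m : W.V ⊗[k] M.V)) :=
    fun γ w => rfl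
  change e ((tρ (homAct B (W ⊙ₗ M) N) W.ρ h (α ⊗ₜ[k] w)) ⊗ₜ[k] m) = _
  rw [tρ_sum, TensorProduct.sum_tmul, map_sum]
  simp only [h1]
  exact Finset.sum_congr rfl fun i _ => homAct_one_tmul α _ (_ ⊗ₜ[k] m)

lemma hopfInternalHom_aInv (W : FRep k B) (w : W.V) (α : homK B M N) (h : B) (m : M.V) :
    (((hopfInternalHom B).aInv W M N).hom (w ⊗ₜ[k] α : W.V ⊗[k] homK B M N) :
        homK B M (W ⊙ₗ N)).1 (h ⊗ₜ[k] m) =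
      (∑ i ∈ (ℛ k h).index, W.ρ ((ℛ k h).left i) w ⊗ₜ[k] α.1 ((ℛ k h).right i ⊗ₜ[k] m) :
        W.V ⊗[k] N.V) := by
  let e : (W.V ⊗[k] homK B M N) ⊗[k] M.V →ₗ[k] W.V ⊗[k] N.V :=
    ((hopfInternalHom B).ev M N).hom.lTensor W.V ∘ₗ
      (TensorProduct.assoc k W.V (homK B M N) M.V).toLinearMap
  have h1 : ∀ w γ, e ((w ⊗ₜ[k] γ) ⊗ₜ[k] m) = w ⊗ₜ[k] γ.1 (1 ⊗ₜ[k] m) := fun w γ => rfl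
  change e ((tρ W.ρ (homAct B M N) h (w ⊗ₜ[k] α)) ⊗ₜ[k] m) = _
  rw [tρ_sum, TensorProduct.sum_tmul, map_sum]
  simp only [h1, homAct_one_tmul]

lemma homK_ext {α β : homK B M N} (h : ∀ b m, α.1 (b ⊗ₜ[k] m) = β.1 (b ⊗ₜ[k] m)) : α = β :=
  Subtype.ext (TensorProduct.ext' h)

end InternalHomFormulas

namespace FunctionAlgebra

open Coalgebra WithConv LeftComoduleAlgebra FRep MonoidalLeftAction

variable {k : Type u} [Field k] {B : Type u} [Ring B] [HopfAlgebra k B] [Module.Finite k B]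
  {K : Type u} [Ring K] [Algebra k K] [LeftComoduleAlgebra k B K]
  {X : FRep k B} (D : FunctionAlgebra k B K X) (hD : ∀ v, IsCoactLinear (toConv (D.j v)))

/-- The map `v ↦ (x ⊗ m ↦ v(x) m)`. -/
noncomputable def toHomK (M : FRep k K) : X.V →ₗ[k] homK B M M :=
  LinearMap.codRestrict (homK B M M)
    (TensorProduct.uncurry (RingHom.id k) B M.V M.V ∘ₗ
      M.ρ.toLinearMap.compRight k ∘ₗ D.j) (fun v κ => by
        refine TensorProduct.ext' fun x m => ?_
        -- `K`-linearity of `x ⊗ m ↦ v(x) m` is condition 1 for the function of `v`, applied to `m`.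
        have h := congrArg (fun κ => M.ρ κ m) (hD v x κ)
        simp only [LinearMap.comp_apply, aρ_tmul]
        refine Eq.trans ?_ (h.trans (by rw [map_mul]; rfl))
        simp only [coactPair, LinearMap.comp_apply, AlgHom.toLinearMap_apply]
        induction coact (k := k) (B := B) κ using TensorProduct.induction_on with
        | zero => simp
        | add y z hy hz => simp only [map_add, LinearMap.add_apply, hy, hz]
        | tmul b l => simp)

lemma toHomK_tmul (M : FRep k K) (v : X.V) (x : B) (m : M.V) :
    (D.toHomK hD M v).1 (x ⊗ₜ[k] m) = M.ρ (D.j v x) m := rfl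

/-- The map `v ↦ (x ⊗ m ↦ v(x) m)`, as a morphism. -/
noncomputable def toHom (M : FRep k K) : X ⟶ ((hopfInternalHom B).hom M).obj M where
  hom := D.toHomK hD M
  comm b := LinearMap.ext fun v => homK_ext fun x m => by
    change M.ρ (D.j (X.ρ b v) x) m = M.ρ (D.j v (x * b)) m
    rw [D.j_act]

lemma toHom_dinatural {M N : FRep k K} (f : M ⟶ N) :
    D.toHom hD M ≫ ((hopfInternalHom B).hom M).map f =
      D.toHom hD N ≫ (hopfInternalHom B).pre f N := by
  refine FRep.Hom.ext (LinearMap.ext fun v => homK_ext fun b m => ?_)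
  change f.hom ((D.toHomK hD M v).1 (b ⊗ₜ[k] m)) =
    (((hopfInternalHom B).pre f N).hom (D.toHomK hD N v) : homK B M N).1 (b ⊗ₜ[k] m)
  rw [hopfInternalHom_pre, toHomK_tmul, toHomK_tmul, hom_comm]

/-- At `h ⊗ m` one side is `a(h₁)` acting on `h₂ w ⊗ m` through the coaction, the other is `h₁ a₋₁ w
⊗ a₀(h₂) m`. These are the two sides of `inclB_mul_adConv`, applied to `w ⊗ m`. -/
lemma toHom_halfBraiding (W : FRep k B) (M : FRep k K) (v : X.V) (w : W.V) :
    ((hopfInternalHom B).b W M (W ⊙ₗ M)).hom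
        (D.toHomK hD (W ⊙ₗ M) v ⊗ₜ[k] w : homK B (W ⊙ₗ M) (W ⊙ₗ M) ⊗[k] W.V) =
      ((hopfInternalHom B).aInv W M M).hom (((D.toHomK hD M).lTensor W.V
        ((evAt W.ρ w).rTensor X.V (D.δ v)) : W.V ⊗[k] homK B M M)) := by
  refine homK_ext fun h m => ?_
  rw [hopfInternalHom_b]
  let Θ : B ⊗[k] K →ₗ[k] W.V ⊗[k] M.V :=
    TensorProduct.map (evAt W.ρ w) (M.ρ.toLinearMap.flip m)
  let e : W.V ⊗[k] homK B M M →ₗ[k] W.V ⊗[k] M.V := LinearMap.applyₗ (h ⊗ₜ[k] m) ∘ₗ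
    (homK B M (W ⊙ₗ M)).subtype ∘ₗ ((hopfInternalHom B).aInv W M M).hom
  have h1 : ∀ z : B ⊗[k] X.V,
      e ((D.toHomK hD M).lTensor W.V ((evAt W.ρ w).rTensor X.V z)) = ∑ i ∈ (ℛ k h).index,
      Θ (inclB k B K ((ℛ k h).left i) * (D.j.flip ((ℛ k h).right i)).lTensor B z) := by
    intro z
    induction z using TensorProduct.induction_on with
    | zero => simp only [map_zero, mul_zero, Finset.sum_const_zero]
    | add y z hy hz =>
      simp only [map_add, mul_add, Finset.sum_add_distrib, ← hy, ← hz]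
    | tmul b v =>
      refine (hopfInternalHom_aInv W _ _ h m).trans (Finset.sum_congr rfl fun i _ => ?_)
      rw [toHomK_tmul]
      simp [Θ]
  refine Eq.trans ?_ (h1 _).symm
  have h2 := congrArg (fun f : WithConv (B →ₗ[k] B ⊗[k] K) => Θ (f h))
    (inclB_mul_adConv (toConv (D.j v)))
  simp only [(ℛ k h).convMul_apply, map_sum] at h2
  simp only [D.j_δ]
  refine Eq.trans (Finset.sum_congr rfl fun i _ => ?_) h2.symm
  rw [toHomK_tmul]
  change aρ W.ρ M.ρ _ (W.ρ _ w ⊗ₜ[k] m) = Θ (coact (k := k) (B := B) _ * inclB k B K _)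
  rw [aρ_tmul]
  change _ = Θ (coact (k := k) (B := B) (D.j v ((ℛ k h).left i)) * inclB k B K _)
  induction coact (k := k) (B := B) (D.j v ((ℛ k h).left i)) using TensorProduct.induction_on with
  | zero => simp
  | add y z hy hz => simp only [map_add, add_mul, hy, hz]
  | tmul b l => simp [Θ]

lemma toHom_mul (M : FRep k K) (v w : X.V) :
    D.toHomK hD M (D.mul (v ⊗ₜ[k] w)) = ((hopfInternalHom B).comp M M M).hom
      (D.toHomK hD M v ⊗ₜ[k] D.toHomK hD M w : homK B M M ⊗[k] homK B M M) := by
  refine homK_ext fun h m => ?_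
  rw [hopfInternalHom_comp, toHomK_tmul, j_mul_apply, map_sum, LinearMap.sum_apply]
  refine Finset.sum_congr rfl fun i _ => ?_
  rw [toHomK_tmul, toHomK_tmul, map_mul]
  rfl

lemma toHom_one (M : FRep k K) : D.toHomK hD M D.one =
    ((hopfInternalHom B).coev (𝟙_ (FRep k B)) M ≫
      ((hopfInternalHom B).hom M).map (λₗ M).hom).hom (1 : k) := by
  refine homK_ext fun h m => ?_
  have h1 : D.j D.one h = algebraMap k K (Coalgebra.counit (R := k) h) :=
    congrArg (fun f : WithConv (B →ₗ[k] K) => f h) D.j_one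
  rw [toHomK_tmul, h1]
  change _ = (Coalgebra.counit (R := k) h * 1) • m
  rw [AlgHom.commutes, _root_.mul_one]
  rfl

end FunctionAlgebra
end CentralHopf

/-! ### Colinearity in the form in which the prebalancing produces it -/

namespace CentralHopf
section TranslationInverse

open Coalgebra WithConv LeftComoduleAlgebra Bosonization

variable {k : Type u} [Field k] {T : Type u} [Ring T] [HopfAlgebra k T] (𝓡 : RMatrix k T)

/-- `r¹R¹ ⊗ S(R²)r² = 1`. -/
lemma RMatrix.sum_antipode_mul : ∑ i ∈ 𝓡.supp, ∑ j ∈ 𝓡.supp,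
    (i.1 * j.1) ⊗ₜ[k] (HopfAlgebra.antipode k j.2 * i.2) = (1 : T ⊗[k] T) := by
  have h := congrArg (TensorProduct.map LinearMap.id
    (LinearMap.mul' k T ∘ₗ (HopfAlgebra.antipode k (A := T)).rTensor T)) 𝓡.comul_right_sum
  simp only [map_sum, TensorProduct.map_tmul, LinearMap.id_apply, LinearMap.comp_apply,
    LinearMap.rTensor_tmul, LinearMap.mul'_apply] at h
  rw [← h]
  simp only [← TensorProduct.tmul_sum, HopfAlgebra.sum_antipode_mul_eq_smul]
  simp only [← TensorProduct.smul_tmul, ← TensorProduct.sum_tmul]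
  rw [𝓡.counit_right_sum]; rfl

variable {H : Type u} [Ring H] [Algebra k H] [Coalgebra k H] [BraidedHopfAlgebra 𝓡 H]
  {K : Type u} [Ring K] [Algebra k K] [LeftComoduleAlgebra k (Bosonization 𝓡 H) K]

/-- The action on a dual representation involves `S`, so the prebalancing yields `S(R²)` on the side
of the coaction instead of `R²` on the other side. The two forms are exchanged by multiplying with a
second copy of `R` and using the relations between `R` and `(id ⊗ S)(R)`. -/
lemma translateR_eq_iff (a : WithConv (Bosonization 𝓡 H →ₗ[k] K)) :
    translateR 𝓡 a = convPost _ (coactKHom 𝓡 H K) a ↔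
      ∀ x, ∑ c ∈ 𝓡.supp, (HopfAlgebra.antipode k c.2 ⊗ₜ[k] (1 : K)) *
        coactKHom 𝓡 H K (a (inT 𝓡 c.1 * x)) = 1 ⊗ₜ[k] a x := by
  constructor
  · intro h x
    have h1 : ∀ y, ∑ c ∈ 𝓡.supp, c.2 ⊗ₜ[k] a (inT 𝓡 c.1 * y) = coactKHom 𝓡 H K (a y) := fun y =>
      (translateR_apply 𝓡 a y).symm.trans
        (congrArg (fun f : WithConv (Bosonization 𝓡 H →ₗ[k] T ⊗[k] K) => f y) h)
    let Φ : T ⊗[k] T →ₗ[k] T ⊗[k] K := TensorProduct.map LinearMap.id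
      (a.ofConv ∘ₗ LinearMap.mulRight k x ∘ₗ (inT 𝓡).toLinearMap) ∘ₗ
        (TensorProduct.comm k T T).toLinearMap
    have h2 := congrArg Φ 𝓡.sum_antipode_mul
    rw [Algebra.TensorProduct.one_def] at h2
    simp only [Φ, map_sum, LinearMap.comp_apply, LinearEquiv.coe_coe, TensorProduct.comm_tmul,
      TensorProduct.map_tmul, LinearMap.id_apply, AlgHom.toLinearMap_apply,
      LinearMap.mulRight_apply, map_mul, map_one, one_mul, mul_assoc] at h2
    rw [← h2, Finset.sum_comm]
    simp only [← h1, Finset.mul_sum, Algebra.TensorProduct.tmul_mul_tmul, one_mul]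
  · intro h
    refine WithConv.ofConv_injective (LinearMap.ext fun x => (translateR_apply 𝓡 a x).trans ?_)
    let Φ : T ⊗[k] T →ₗ[k] T ⊗[k] K := LinearMap.mul' k (T ⊗[k] K) ∘ₗ
      TensorProduct.map ((TensorProduct.mk k T K).flip 1) ((coactKHom 𝓡 H K).toLinearMap ∘ₗ
        a.ofConv ∘ₗ LinearMap.mulRight k x ∘ₗ (inT 𝓡).toLinearMap) ∘ₗ
        (TensorProduct.comm k T T).toLinearMap
    have h2 := congrArg Φ 𝓡.sum_antipode
    rw [Algebra.TensorProduct.one_def] at h2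
    simp only [Φ, map_sum, LinearMap.comp_apply, LinearEquiv.coe_coe, TensorProduct.comm_tmul,
      TensorProduct.map_tmul, AlgHom.toLinearMap_apply, LinearMap.flip_apply,
      TensorProduct.mk_apply, LinearMap.mul'_apply,
      LinearMap.mulRight_apply, map_mul, map_one, one_mul, mul_assoc] at h2
    refine Eq.trans ?_ (h2.trans (one_mul _))
    rw [Finset.sum_comm]
    refine Finset.sum_congr rfl fun c _ => ?_
    have h3 := congrArg (fun z => (c.2 ⊗ₜ[k] (1 : K)) * z) (h (inT 𝓡 c.1 * x))
    simp only [Finset.mul_sum, ← mul_assoc, Algebra.TensorProduct.tmul_mul_tmul, one_mul,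
      mul_one] at h3
    rw [← h3]
    simp only [mul_assoc]

end TranslationInverse

/-! ### `S^T(H, K)` as the relative end -/

section RelativeFormulas

open Coalgebra WithConv LeftComoduleAlgebra Bosonization FRep MonoidalLeftAction

variable {k : Type u} [Field k] {T : Type u} [Ring T] [HopfAlgebra k T] (𝓡 : RMatrix k T)
  {H : Type u} [Ring H] [Algebra k H] [Coalgebra k H] [BraidedHopfAlgebra 𝓡 H]
  {K : Type u} [Ring K] [Algebra k K] [LeftComoduleAlgebra k (Bosonization 𝓡 H) K]

lemma evG_tmul (V : FRep k T) (f : Module.Dual k V.V) (v : V.V) :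
    (evG (toCenter 𝓡 H) V).hom (f ⊗ₜ[k] v : Module.Dual k V.V ⊗[k] V.V) = f v := by
  -- `evG` ends with the inverse of the unit comparison. Composing with that comparison, whose
  -- underlying map is the identity of `k`, removes it.
  have h0 : (Functor.LaxMonoidal.μ (toCenter 𝓡 H) (Vᘁ) V ≫ (toCenter 𝓡 H).map (ε_ V (Vᘁ)) ≫
      Functor.OplaxMonoidal.η (toCenter 𝓡 H)) ≫ Functor.LaxMonoidal.ε (toCenter 𝓡 H) =
      Functor.LaxMonoidal.μ (toCenter 𝓡 H) (Vᘁ) V ≫ (toCenter 𝓡 H).map (ε_ V (Vᘁ)) := by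
    rw [Category.assoc, Category.assoc, Functor.Monoidal.η_ε, Category.comp_id]
  exact congrArg (fun g => FRep.Hom.hom (Center.Hom.f g)
    (f ⊗ₜ[k] v : Module.Dual k V.V ⊗[k] V.V)) h0

lemma evAct_tmul (V : FRep k T) (M : FRep k K) (f : Module.Dual k V.V) (v : V.V) (m : M.V) :
    (evAct (toCenter 𝓡 H) V M).hom (f ⊗ₜ[k] (v ⊗ₜ[k] m) : Module.Dual k V.V ⊗[k] (V.V ⊗[k] M.V)) =
      f v • m :=
  congrArg (fun c : k => c • m) (evG_tmul 𝓡 (H := H) V f v)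

variable [Module.Finite k H] [Module.Finite k T]

/-- The inverse of `σ^{V*}` on `X ⊗ V*` is `x ⊗ f ↦ R² · f ⊗ R¹ x`. In the dual `R² · f = f ∘
S(R²)`, and `R¹` acts on `h · α` by translation, which puts it to the left of `h`. -/
lemma prebal_apply (V : FRep k T) (M N : FRep k K)
    (α : homK (Bosonization 𝓡 H) M (restr (toCenter 𝓡 H) V N)) (h : Bosonization 𝓡 H)
    (f : Module.Dual k V.V) (m : M.V) :
    ((prebal (toCenter 𝓡 H) (hopfInternalHom (Bosonization 𝓡 H)) V M N).hom α :
      homK (Bosonization 𝓡 H) (restr (toCenter 𝓡 H) (Vᘁ) M) N).1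
        (h ⊗ₜ[k] (f ⊗ₜ[k] m : Module.Dual k V.V ⊗[k] M.V)) =
      ∑ c ∈ 𝓡.supp, (evAct (toCenter 𝓡 H) V N).hom
        ((f ∘ₗ V.ρ (HopfAlgebra.antipode k c.2)) ⊗ₜ[k] α.1 ((inT 𝓡 c.1 * h) ⊗ₜ[k] m) :
          Module.Dual k V.V ⊗[k] (V.V ⊗[k] N.V)) := by
  let e : (Module.Dual k V.V ⊗[k] homK (Bosonization 𝓡 H) M (restr (toCenter 𝓡 H) V N)) ⊗[k] M.V
      →ₗ[k] N.V :=
    (evAct (toCenter 𝓡 H) V N).hom ∘ₗ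
      (((hopfInternalHom (Bosonization 𝓡 H)).ev M
        (restr (toCenter 𝓡 H) V N)).hom.lTensor (Module.Dual k V.V)) ∘ₗ
      (TensorProduct.assoc k (Module.Dual k V.V)
        (homK (Bosonization 𝓡 H) M (restr (toCenter 𝓡 H) V N)) M.V).toLinearMap
  have h1 : ∀ g β, e ((g ⊗ₜ[k] β) ⊗ₜ[k] m) = (evAct (toCenter 𝓡 H) V N).hom
      (g ⊗ₜ[k] β.1 (1 ⊗ₜ[k] m) : Module.Dual k V.V ⊗[k] (V.V ⊗[k] N.V)) := fun g β => rfl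
  let F : Module.Dual k V.V ⊗[k] homK (Bosonization 𝓡 H) M (restr (toCenter 𝓡 H) V N) →ₗ[k] N.V :=
    e ∘ₗ (TensorProduct.mk k _ M.V).flip m
  refine (congrArg F (hbIso_tmul 𝓡 (Vᘁ)
    (((hopfInternalHom (Bosonization 𝓡 H)).hom M).obj (restr (toCenter 𝓡 H) V N))
    (homAct (Bosonization 𝓡 H) M (restr (toCenter 𝓡 H) V N) h α) f)).trans
    ((map_sum F _ _).trans ?_)
  refine Finset.sum_congr rfl fun c _ => ?_
  refine (h1 _ _).trans ?_
  refine congrArg (fun z => (evAct (toCenter 𝓡 H) V N).hom (_ ⊗ₜ[k] z :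
    Module.Dual k V.V ⊗[k] (V.V ⊗[k] N.V))) ?_
  exact homAct_one_tmul (homAct (Bosonization 𝓡 H) M (restr (toCenter 𝓡 H) V N) h α) _ m

/-- `t ⊗ κ ↦ f(t v) κ m`. -/
noncomputable def matrixPair (V : FRep k T) (M : FRep k K) (f : Module.Dual k V.V) (v : V.V)
    (m : M.V) : T ⊗[k] K →ₗ[k] M.V :=
  (TensorProduct.lid k M.V).toLinearMap ∘ₗ
    TensorProduct.map (f ∘ₗ evAt V.ρ v) (M.ρ.toLinearMap.flip m)

lemma evAct_aρ (V : FRep k T) (M : FRep k K) (f : Module.Dual k V.V) (v : V.V) (m : M.V)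
    (t : T) (κ : K) :
    (evAct (toCenter 𝓡 H) V M).hom ((f ∘ₗ V.ρ t) ⊗ₜ[k]
        aρ (V.ρ.comp (proj 𝓡 (H := H))) M.ρ κ (v ⊗ₜ[k] m) :
        Module.Dual k V.V ⊗[k] (V.V ⊗[k] M.V)) =
      matrixPair V M f v m ((t ⊗ₜ[k] (1 : K)) * coactKHom 𝓡 H K κ) := by
  let e : V.V ⊗[k] M.V →ₗ[k] M.V := (evAct (toCenter 𝓡 H) V M).hom ∘ₗ
    TensorProduct.mk k (Module.Dual k V.V) (V.V ⊗[k] M.V) (f ∘ₗ V.ρ t)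
  rw [aρ_tmul]
  change e (TensorProduct.map (evAt (V.ρ.comp (proj 𝓡 (H := H))) v) (M.ρ.toLinearMap.flip m)
    (coact (k := k) (B := Bosonization 𝓡 H) κ)) = matrixPair V M f v m ((t ⊗ₜ[k] (1 : K)) *
      (proj 𝓡).toLinearMap.rTensor K (coact (k := k) (B := Bosonization 𝓡 H) κ))
  induction coact (k := k) (B := Bosonization 𝓡 H) κ using TensorProduct.induction_on with
  | zero => simp only [map_zero, mul_zero]
  | add y z hy hz => simp only [map_add, mul_add, hy, hz]
  | tmul b l =>
    refine (evAct_tmul 𝓡 V M (f ∘ₗ V.ρ t) (V.ρ (proj 𝓡 b) v) (M.ρ l m)).trans ?_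
    simp [matrixPair]

lemma sum_evAct_aρ (V : FRep k T) (M : FRep k K) (f : Module.Dual k V.V) (v : V.V) (m : M.V)
    (a : Bosonization 𝓡 H →ₗ[k] K) (h : Bosonization 𝓡 H) :
    ∑ c ∈ 𝓡.supp, (evAct (toCenter 𝓡 H) V M).hom ((f ∘ₗ V.ρ (HopfAlgebra.antipode k c.2)) ⊗ₜ[k]
        aρ (V.ρ.comp (proj 𝓡 (H := H))) M.ρ (a (inT 𝓡 c.1 * h)) (v ⊗ₜ[k] m) :
        Module.Dual k V.V ⊗[k] (V.V ⊗[k] M.V)) =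
      matrixPair V M f v m (∑ c ∈ 𝓡.supp, (HopfAlgebra.antipode k c.2 ⊗ₜ[k] (1 : K)) *
        coactKHom 𝓡 H K (a (inT 𝓡 c.1 * h))) := by
  rw [map_sum]
  exact Finset.sum_congr rfl fun c _ => evAct_aρ 𝓡 V M f v m _ _

variable [Module.Finite k K]

variable (H) in
/-- The map `α ↦ (x ⊗ m ↦ α(x ⊗ 1) m)`. -/
noncomputable abbrev stHom (M : FRep k K) :
    STRep 𝓡 H K ⟶ ((hopfInternalHom (Bosonization 𝓡 H)).hom M).obj M :=
  (stFunctionAlgebra 𝓡 H K).toHom (isCoactLinear_stFun 𝓡) M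

/-- On `f ⊗ (v ⊗ m)` the left side is `f(v) a(h) m` and the right side is `matrixPair` of the sum in
`translateR_eq_iff`; colinearity of `a` identifies them. -/
lemma stHom_balanced (V : FRep k T) (M : FRep k K) :
    stHom 𝓡 H M ≫ (hopfInternalHom (Bosonization 𝓡 H)).pre (evAct (toCenter 𝓡 H) V M) M =
      stHom 𝓡 H (restr (toCenter 𝓡 H) V M) ≫
        prebal (toCenter 𝓡 H) (hopfInternalHom (Bosonization 𝓡 H)) V
          (restr (toCenter 𝓡 H) V M) M := by
  refine FRep.Hom.ext (LinearMap.ext fun α => homK_ext fun h y => ?_)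
  let u : homK (Bosonization 𝓡 H) (restr (toCenter 𝓡 H) (Vᘁ) (restr (toCenter 𝓡 H) V M)) M →
      Module.Dual k V.V ⊗[k] (V.V ⊗[k] M.V) →ₗ[k] M.V := fun β =>
    β.1 ∘ₗ TensorProduct.mk k (Bosonization 𝓡 H) (Module.Dual k V.V ⊗[k] (V.V ⊗[k] M.V)) h
  let α₁ := ((hopfInternalHom (Bosonization 𝓡 H)).pre (evAct (toCenter 𝓡 H) V M) M).hom
    ((stFunctionAlgebra 𝓡 H K).toHomK (isCoactLinear_stFun 𝓡) M α)
  let α₂ := (prebal (toCenter 𝓡 H) (hopfInternalHom (Bosonization 𝓡 H)) V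
      (restr (toCenter 𝓡 H) V M) M).hom ((stFunctionAlgebra 𝓡 H K).toHomK
        (isCoactLinear_stFun 𝓡) (restr (toCenter 𝓡 H) V M) α)
  suffices h0 : ∀ (f : Module.Dual k V.V) (v : V.V) (m : M.V),
      u α₁ (f ⊗ₜ[k] (v ⊗ₜ[k] m)) = u α₂ (f ⊗ₜ[k] (v ⊗ₜ[k] m)) from
    LinearMap.congr_fun (f := u α₁) (g := u α₂)
      (TensorProduct.ext (LinearMap.ext fun f => TensorProduct.ext' (h0 f))) y
  intro f v m
  refine (hopfInternalHom_pre (evAct (toCenter 𝓡 H) V M)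
    ((stFunctionAlgebra 𝓡 H K).toHomK (isCoactLinear_stFun 𝓡) M α) h _).trans ?_
  refine Eq.trans ?_ (prebal_apply 𝓡 V (restr (toCenter 𝓡 H) V M) M
    ((stFunctionAlgebra 𝓡 H K).toHomK (isCoactLinear_stFun 𝓡) (restr (toCenter 𝓡 H) V M) α) h f
    (v ⊗ₜ[k] m : V.V ⊗[k] M.V)).symm
  refine (congrArg (fun m => ((stFunctionAlgebra 𝓡 H K).toHomK (isCoactLinear_stFun 𝓡) M α).1
    (h ⊗ₜ[k] m)) (evAct_tmul 𝓡 V M f v m)).trans ?_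
  refine Eq.trans ?_ (sum_evAct_aρ 𝓡 V M f v m (stFun 𝓡 H K α) h).symm
  have h1 := (translateR_eq_iff 𝓡 _).1 (translateR_stFun 𝓡 α) h
  refine Eq.trans ?_ (congrArg (matrixPair V M f v m) h1).symm
  change M.ρ (stFun 𝓡 H K α h) ((f : Module.Dual k V.V) v • m) = _
  simp [matrixPair]

/-- The regular representation. -/
noncomputable abbrev regRep (k : Type u) [Field k] (B : Type u) [Ring B] [Algebra k B]
    [Module.Finite k B] : FRep k B where
  V := B
  ρ := Algebra.lmul k B

/-- The map `κ ↦ κ m`. -/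
noncomputable def regRepHom (M : FRep k K) (m : M.V) : regRep k K ⟶ M where
  hom := M.ρ.toLinearMap.flip m
  comm κ := LinearMap.ext fun l => by simp

section Universal

variable {𝓡} {E : FRep k (Bosonization 𝓡 H)}
  {ξ : ∀ M : FRep k K, E ⟶ ((hopfInternalHom (Bosonization 𝓡 H)).hom M).obj M}

/-- The component of a family of morphisms at `M`, as a linear map. -/
noncomputable def component (ξ : ∀ M : FRep k K,
    E ⟶ ((hopfInternalHom (Bosonization 𝓡 H)).hom M).obj M) (M : FRep k K) :
    E.V →ₗ[k] homK (Bosonization 𝓡 H) M M := (ξ M).hom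

/-- The functions `x ↦ ξ_K(e)(x ⊗ 1)`. -/
noncomputable def regFun (ξ : ∀ M : FRep k K,
    E ⟶ ((hopfInternalHom (Bosonization 𝓡 H)).hom M).obj M) :
    E.V →ₗ[k] Bosonization 𝓡 H →ₗ[k] K :=
  LinearMap.lcomp k K ((TensorProduct.mk k (Bosonization 𝓡 H) K).flip 1) ∘ₗ
    (homK (Bosonization 𝓡 H) (regRep k K) (regRep k K)).subtype ∘ₗ component ξ (regRep k K)

lemma regFun_act (b x : Bosonization 𝓡 H) (e : E.V) :
    regFun ξ (E.ρ b e) x = regFun ξ e (x * b) :=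
  congrArg (fun z : homK (Bosonization 𝓡 H) (regRep k K) (regRep k K) => z.1 (x ⊗ₜ[k] (1 : K)))
    (hom_comm (ξ (regRep k K)) b e)

/-- Dinaturality along `κ ↦ κ m` from the regular module to `M`, evaluated at `x ⊗ 1`: the whole
family is determined by its component at `K`. -/
lemma component_tmul (hξ : IsRelativeDinatural (toCenter 𝓡 H)
    (hopfInternalHom (K := K) (Bosonization 𝓡 H)) E ξ)
    (M : FRep k K) (e : E.V) (x : Bosonization 𝓡 H) (m : M.V) :
    (component ξ M e).1 (x ⊗ₜ[k] m) = M.ρ (regFun ξ e x) m := by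
  have h := congrArg (fun g => FRep.Hom.hom g e) (hξ.dinatural (regRepHom M m))
  have h1 := congrArg (fun z : homK (Bosonization 𝓡 H) (regRep k K) M => z.1 (x ⊗ₜ[k] (1 : K))) h
  have h2 := h1.trans (hopfInternalHom_pre (regRepHom M m) (component ξ M e) x (1 : K))
  refine Eq.trans ?_ h2.symm
  change _ = (component ξ M e).1 (x ⊗ₜ[k] M.ρ 1 m)
  rw [map_one]; rfl

/-- `K`-linearity of the component at the regular module, at `x ⊗ 1`; `component_tmul` turns
`ξ_K(e)(κ₋₁ x ⊗ κ₀)` into a product in `K`. -/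
lemma isCoactLinear_regFun (hξ : IsRelativeDinatural (toCenter 𝓡 H)
    (hopfInternalHom (K := K) (Bosonization 𝓡 H)) E ξ)
    (e : E.V) : IsCoactLinear (toConv (regFun ξ e)) := by
  intro x κ
  have h := LinearMap.congr_fun ((component ξ (regRep k K) e).2 κ) (x ⊗ₜ[k] (1 : K))
  refine Eq.trans ?_ h
  rw [LinearMap.comp_apply, aρ_tmul]
  simp only [coactPair, LinearMap.comp_apply, AlgHom.toLinearMap_apply]
  induction coact (k := k) (B := Bosonization 𝓡 H) κ using TensorProduct.induction_on with
  | zero => simp only [map_zero]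
  | add y z hy hz => simp only [map_add, hy, hz]
  | tmul b l =>
    rw [TensorProduct.map_tmul]
    refine Eq.trans ?_ (component_tmul hξ (regRep k K) e _ _).symm
    simp

/-- The balancing condition for the regular representations of `T` and `K`, tested on `f ⊗ (1 ⊗ 1)`.
With `f` running through a coordinate basis, this reads off every `T`-coordinate of the identity in
`translateR_eq_iff`. -/
lemma translateR_regFun (hξ : IsRelativeDinatural (toCenter 𝓡 H)
    (hopfInternalHom (K := K) (Bosonization 𝓡 H)) E ξ)
    (e : E.V) : translateR 𝓡 (toConv (regFun ξ e)) =
    convPost _ (coactKHom 𝓡 H K) (toConv (regFun ξ e)) := by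
  refine (translateR_eq_iff 𝓡 _).2 fun x => ?_
  let b := Module.finBasis k T
  rw [← sum_basis_contract b (∑ c ∈ 𝓡.supp, _), ← sum_basis_contract b (1 ⊗ₜ[k] _)]
  refine Finset.sum_congr rfl fun i _ => congrArg _ ?_
  -- The matrix coefficient of the regular representation at the vector `1` and the functional `f`
  -- is `f` itself.
  have hp : ∀ z : T ⊗[k] K, TensorProduct.lid k K ((b.coord i).rTensor K z) =
      matrixPair (regRep k T) (regRep k K) (b.coord i) (1 : T) (1 : K) z := by
    intro z
    induction z using TensorProduct.induction_on with
    | zero => simp only [map_zero]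
    | add y z hy hz => simp only [map_add, hy, hz]
    | tmul t κ => simp [matrixPair]
  rw [hp, hp]
  refine (sum_evAct_aρ 𝓡 (regRep k T) (regRep k K) (b.coord i) (1 : T) (1 : K) (regFun ξ e) x).symm.trans ?_
  have h := congrArg (fun g => FRep.Hom.hom g e) (hξ.balanced (regRep k T) (regRep k K))
  let u : homK (Bosonization 𝓡 H) (restr (toCenter 𝓡 H) ((regRep k T)ᘁ)
      (restr (toCenter 𝓡 H) (regRep k T) (regRep k K))) (regRep k K) → K := fun β =>
    β.1 (x ⊗ₜ[k] (b.coord i ⊗ₜ[k] ((1 : T) ⊗ₜ[k] (1 : K)) : Module.Dual k T ⊗[k] (T ⊗[k] K)))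
  have h1 := congrArg u h
  have h2 := (hopfInternalHom_pre (evAct (toCenter 𝓡 H) (regRep k T) (regRep k K))
    (component ξ (regRep k K) e) x _).symm.trans (h1.trans (prebal_apply 𝓡 (regRep k T)
      (restr (toCenter 𝓡 H) (regRep k T) (regRep k K)) (regRep k K)
      (component ξ (restr (toCenter 𝓡 H) (regRep k T) (regRep k K)) e) x (b.coord i)
      ((1 : T) ⊗ₜ[k] (1 : K) : T ⊗[k] K)))
  refine Eq.trans (Finset.sum_congr rfl fun c _ => ?_) (h2.symm.trans ?_)
  · refine congrArg (fun z => (evAct (toCenter 𝓡 H) (regRep k T) (regRep k K)).hom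
      (_ ⊗ₜ[k] z : Module.Dual k T ⊗[k] (T ⊗[k] K))) ?_
    exact (component_tmul hξ (restr (toCenter 𝓡 H) (regRep k T) (regRep k K)) e _ _).symm
  · refine (congrArg (fun m => (component ξ (regRep k K) e).1 (x ⊗ₜ[k] m))
      (evAct_tmul 𝓡 (regRep k T) (regRep k K) (b.coord i) (1 : T) (1 : K))).trans ?_
    refine (component_tmul hξ (regRep k K) e _ _).trans ?_
    simp [matrixPair]

end Universal

variable (H K) in
-- The factorization sends `e` to the element of `S^T(H, K)` whose function is `regFun ξ e`.
-- Uniqueness is seen at the regular module, where evaluation at `x ⊗ 1` returns the function of an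
-- element.
lemma stHom_isRelativeEnd : IsRelativeEnd (toCenter 𝓡 H)
    (hopfInternalHom (K := K) (Bosonization 𝓡 H)) (STRep 𝓡 H K) (stHom 𝓡 H) where
  isRelativeDinatural :=
    { dinatural := (stFunctionAlgebra 𝓡 H K).toHom_dinatural (isCoactLinear_stFun 𝓡)
      balanced := stHom_balanced 𝓡 }
  universal E ξ hξ := by
    refine ⟨⟨⟨⟨fun e => stMk 𝓡 (toConv (regFun ξ e)) (isCoactLinear_regFun hξ e)
      (translateR_regFun hξ e), fun e e' => stFun_injective 𝓡 ?_⟩,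
      fun c e => stFun_injective 𝓡 ?_⟩, fun b => LinearMap.ext fun e => stFun_injective 𝓡 ?_⟩,
      fun M => FRep.Hom.ext (LinearMap.ext fun e => homK_ext fun x m => ?_), fun g hg => ?_⟩
    · simp only [map_add, stFun_stMk]
    · simp only [map_smul, stFun_stMk, RingHom.id_apply]
    · refine LinearMap.ext fun x => ?_
      change stFun 𝓡 H K (stMk 𝓡 (toConv (regFun ξ (E.ρ b e))) (isCoactLinear_regFun hξ _)
        (translateR_regFun hξ _)) x = stFun 𝓡 H K (stMk 𝓡 (toConv (regFun ξ e))
        (isCoactLinear_regFun hξ e) (translateR_regFun hξ e)) (x * b)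
      rw [stFun_stMk, stFun_stMk]
      exact regFun_act b x e
    · refine Eq.trans ?_ (component_tmul hξ M e x m).symm
      change M.ρ (stFun 𝓡 H K (stMk 𝓡 (toConv (regFun ξ e)) (isCoactLinear_regFun hξ e)
        (translateR_regFun hξ e)) x) m = _
      rw [stFun_stMk]
    · refine FRep.Hom.ext (LinearMap.ext fun e => stFun_injective 𝓡 (LinearMap.ext fun x => ?_))
      refine Eq.trans ?_ (LinearMap.congr_fun (stFun_stMk 𝓡 (toConv (regFun ξ e))
        (isCoactLinear_regFun hξ e) (translateR_regFun hξ e)) x).symm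
      have h := congrArg (fun g => FRep.Hom.hom g e) (hg (regRep k K))
      have h1 := congrArg (fun z : homK (Bosonization 𝓡 H) (regRep k K) (regRep k K) =>
        z.1 (x ⊗ₜ[k] (1 : K))) h
      exact (mul_one (stFun 𝓡 H K (g.hom e) x)).symm.trans h1

end RelativeFormulas
end CentralHopf

/-! ### Uniqueness of the adjoint algebra -/

namespace CentralHopf
section RelativeEnd

open MonoidalLeftAction

variable {𝒱 C M : Type*} [Category* 𝒱] [MonoidalCategory 𝒱] [RightRigidCategory 𝒱]
  [Category* C] [MonoidalCategory C] [Category* M] [MonoidalLeftAction C M]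
  {G : 𝒱 ⥤ Center C} [G.Monoidal] {ih : InternalHom C M}

lemma IsRelativeDinatural.precomp {E E' : C} {ξ : ∀ m : M, E ⟶ (ih.hom m).obj m}
    (hξ : IsRelativeDinatural G ih E ξ) (g : E' ⟶ E) :
    IsRelativeDinatural G ih E' fun m => g ≫ ξ m where
  dinatural f := by rw [Category.assoc, hξ.dinatural, Category.assoc]
  balanced V m := by rw [Category.assoc, hξ.balanced, Category.assoc]

lemma IsRelativeEnd.hom_ext {E E' : C} {π : ∀ m : M, E ⟶ (ih.hom m).obj m}
    (hπ : IsRelativeEnd G ih E π) {f g : E' ⟶ E} (h : ∀ m, f ≫ π m = g ≫ π m) : f = g := by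
  obtain ⟨_, _, hu⟩ := hπ.universal E' _ (hπ.isRelativeDinatural.precomp g)
  exact (hu f h).trans (hu g fun _ => rfl).symm

lemma IsRelativeEnd.exists_iso {E E' : C} {π : ∀ m : M, E ⟶ (ih.hom m).obj m}
    {π' : ∀ m : M, E' ⟶ (ih.hom m).obj m} (hπ : IsRelativeEnd G ih E π)
    (hπ' : IsRelativeEnd G ih E' π') : ∃ e : E ≅ E', ∀ m, e.hom ≫ π' m = π m := by
  obtain ⟨f, hf, _⟩ := hπ'.universal E π hπ.isRelativeDinatural
  obtain ⟨g, hg, _⟩ := hπ.universal E' π' hπ'.isRelativeDinatural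
  refine ⟨⟨f, g, hπ.hom_ext fun m => ?_, hπ'.hom_ext fun m => ?_⟩, hf⟩
  · rw [Category.assoc, hg, hf, Category.id_comp]
  · rw [Category.assoc, hf, hg, Category.id_comp]

/-- Two adjoint algebras are isomorphic when the half-braiding of one of them is determined by
its compatibility with the family `π`. -/
lemma AdjointAlgebra.nonempty_iso (A A' : AdjointAlgebra G ih)
    (hA' : ∀ {X Y : C} (f g : Y ⟶ X ⊗ A'.A.1),
      (∀ m, f ≫ X ◁ A'.π m ≫ ih.aInv X m m = g ≫ X ◁ A'.π m ≫ ih.aInv X m m) → f = g) :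
    Nonempty (Mon.mk A.A ≅ Mon.mk A'.A) := by
  obtain ⟨e, he⟩ := A.isRelativeEnd.exists_iso A'.isRelativeEnd
  -- Both composites land in `X ⊗ A'`. After `X ◁ A'.π m` and `aInv` they agree, because the
  -- half-braidings of `A` and `A'` satisfy the same defining square.
  have hb : ∀ X : C, e.hom ▷ X ≫ (A'.A.2.β X).hom = (A.A.2.β X).hom ≫ X ◁ e.hom := fun X =>
    hA' _ _ fun m => by
      rw [Category.assoc, ← A'.halfBraiding, ← comp_whiskerRight_assoc, he, A.halfBraiding,
        Category.assoc, ← whiskerLeft_comp_assoc, he]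
  have : IsIso (Center.Hom.f (⟨e.hom, hb⟩ : A.A ⟶ A'.A)) := inferInstanceAs (IsIso e.hom)
  refine ⟨Mon.mkIso (Center.isoMk ⟨e.hom, hb⟩) (Center.ext _ _ ?_) (Center.ext _ _ ?_)⟩
  · refine A'.isRelativeEnd.hom_ext fun m => ?_
    change (Center.Hom.f _ ≫ e.hom) ≫ A'.π m = _
    rw [Category.assoc, he, A'.one]
    exact A.one m
  -- Each product is determined by composition of internal Homs, and `e` carries one family of
  -- projections to the other.
  · refine A'.isRelativeEnd.hom_ext fun m => ?_
    let m₁ : A.A.1 ⊗ A.A.1 ⟶ A.A.1 := Center.Hom.f (MonObj.mul (X := A.A))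
    let m₂ : A'.A.1 ⊗ A'.A.1 ⟶ A'.A.1 := Center.Hom.f (MonObj.mul (X := A'.A))
    have h₁ : m₁ ≫ A.π m = (A.π m ⊗ₘ A.π m) ≫ ih.comp m m m := A.mul m
    have h₂ : m₂ ≫ A'.π m = (A'.π m ⊗ₘ A'.π m) ≫ ih.comp m m m := A'.mul m
    change (m₁ ≫ e.hom) ≫ A'.π m = ((e.hom ⊗ₘ e.hom) ≫ m₂) ≫ A'.π m
    rw [Category.assoc, he, Category.assoc, h₂, tensorHom_comp_tensorHom_assoc, he, h₁]

end RelativeEnd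

/-! ### Injectivity of `X ⊗ Hom(M, N) → Hom(M, X ⊗ N)` -/

section InternalHom

open Coalgebra FRep MonoidalLeftAction

variable {k : Type u} [Field k] {B : Type u} [Ring B] [HopfAlgebra k B] [Module.Finite k B]
  {K : Type u} [Ring K] [Algebra k K] [LeftComoduleAlgebra k B K]
  {M N : FRep k K}

/-- On `w ⊗ α` the left side is `S(h₁) h₂ w ⊗ α(h₃ ⊗ m)`, where the antipode cancels. So `aInv` of
an element determines all evaluations of its second leg, which is what makes the half-braiding of
the adjoint algebra unique. -/
lemma sum_antipode_aInv (W : FRep k B) (z : W.V ⊗[k] homK B M N) (h : B) (m : M.V) :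
    ∑ i ∈ (ℛ k h).index, (W.ρ (HopfAlgebra.antipode k ((ℛ k h).left i))).rTensor N.V
      ((((hopfInternalHom B).aInv W M N).hom z : homK B M (W ⊙ₗ N)).1
        ((ℛ k h).right i ⊗ₜ[k] m)) =
      (LinearMap.applyₗ (h ⊗ₜ[k] m) ∘ₗ (homK B M N).subtype).lTensor W.V z := by
  let F : homK B M (W ⊙ₗ N) →ₗ[k] W.V ⊗[k] N.V := ∑ i ∈ (ℛ k h).index,
    (W.ρ (HopfAlgebra.antipode k ((ℛ k h).left i))).rTensor N.V ∘ₗ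
      LinearMap.applyₗ ((ℛ k h).right i ⊗ₜ[k] m) ∘ₗ (homK B M (W ⊙ₗ N)).subtype
  have hF : ∀ β, F β = ∑ i ∈ (ℛ k h).index,
      (W.ρ (HopfAlgebra.antipode k ((ℛ k h).left i))).rTensor N.V
        (β.1 ((ℛ k h).right i ⊗ₜ[k] m)) := fun β => by
    simp only [F, LinearMap.sum_apply]; rfl
  let F' : W.V ⊗[k] homK B M N →ₗ[k] W.V ⊗[k] N.V :=
    F ∘ₗ ((hopfInternalHom B).aInv W M N).hom
  suffices h0 : F' = (LinearMap.applyₗ (h ⊗ₜ[k] m) ∘ₗ (homK B M N).subtype).lTensor W.V from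
    (hF _).symm.trans (LinearMap.congr_fun h0 z)
  refine TensorProduct.ext' fun w α => ?_
  let Φ : B ⊗[k] (B ⊗[k] B) →ₗ[k] W.V ⊗[k] N.V :=
    TensorProduct.map (evAt W.ρ w ∘ₗ LinearMap.mul' k B ∘ₗ
        (HopfAlgebra.antipode k (A := B)).rTensor B)
      (α.1 ∘ₗ (TensorProduct.mk k B M.V).flip m) ∘ₗ (TensorProduct.assoc k B B B).symm.toLinearMap
  have h1 := congrArg Φ (sum_tmul_tmul_eq (ℛ k h) (fun i => ℛ k ((ℛ k h).left i))
    (fun i => ℛ k ((ℛ k h).right i)))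
  have h2 : ∀ i, ∑ j ∈ (ℛ k ((ℛ k h).left i)).index,
      HopfAlgebra.antipode k ((ℛ k ((ℛ k h).left i)).left j) * (ℛ k ((ℛ k h).left i)).right j =
      algebraMap k B (Coalgebra.counit (R := k) ((ℛ k h).left i)) := fun i =>
    HopfAlgebra.sum_antipode_mul_eq_algebraMap_counit (ℛ k ((ℛ k h).left i))
  simp only [Φ, map_sum, LinearMap.comp_apply, LinearEquiv.coe_coe, TensorProduct.assoc_symm_tmul,
    TensorProduct.map_tmul, LinearMap.rTensor_tmul, LinearMap.mul'_apply, LinearMap.flip_apply,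
    TensorProduct.mk_apply] at h1
  refine ((hF _).trans (Finset.sum_congr rfl fun i _ => ?_)).trans (h1.symm.trans ?_)
  · refine (congrArg _ (hopfInternalHom_aInv W w α ((ℛ k h).right i) m)).trans ?_
    rw [map_sum]
    exact Finset.sum_congr rfl fun j _ => by simp
  · simp only [← TensorProduct.sum_tmul, ← map_sum, h2, Algebra.algebraMap_eq_smul_one]
    have h3 := congrArg (fun x => w ⊗ₜ[k] α.1 (x ⊗ₜ[k] m)) (sum_counit_smul (ℛ k h))
    simp only [TensorProduct.sum_tmul, map_sum, TensorProduct.tmul_sum] at h3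
    refine Eq.trans (Finset.sum_congr rfl fun i _ => ?_) h3
    simp [TensorProduct.smul_tmul]

end InternalHom

/-! ### The projection of the coaction to `T` -/

section Relative
open Coalgebra WithConv LeftComoduleAlgebra Bosonization FRep MonoidalLeftAction

variable {k : Type u} [Field k] {T : Type u} [Ring T] [HopfAlgebra k T] (𝓡 : RMatrix k T)
  {H : Type u} [Ring H] [Algebra k H] [Coalgebra k H] [BraidedHopfAlgebra 𝓡 H]
  {K : Type u} [Ring K] [Algebra k K] [LeftComoduleAlgebra k (Bosonization 𝓡 H) K]

/-- `π(a₋₁) ⊗ a₀(x) = R² ⊗ a(x R¹)`. -/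
lemma proj_adConv (a : WithConv (Bosonization 𝓡 H →ₗ[k] K))
    (ha : translateR 𝓡 a = convPost _ (coactKHom 𝓡 H K) a) (x : Bosonization 𝓡 H) :
    (proj 𝓡).toLinearMap.rTensor K (adConv a x) =
      ∑ c ∈ 𝓡.supp, c.2 ⊗ₜ[k] a (x * inT 𝓡 c.1) := by
  let p : Bosonization 𝓡 H ⊗[k] K →ₐ[k] T ⊗[k] K :=
    Algebra.TensorProduct.map (proj 𝓡) (AlgHom.id k K)
  let q : Bosonization 𝓡 H →ₐ[k] T ⊗[k] K :=
    (Algebra.TensorProduct.includeLeft (R := k) (S := k) (A := T) (B := K)).comp (proj 𝓡)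
  let Q : WithConv (Bosonization 𝓡 H →ₗ[k] T ⊗[k] K) :=
    toConv (∑ c ∈ 𝓡.supp, TensorProduct.mk k T K c.2 ∘ₗ a.ofConv ∘ₗ
      LinearMap.mulRight k (inT 𝓡 c.1))
  -- Apply `π` to the `B`-leg of `ι * ad(a) = (δ ∘ a) * ι`; colinearity replaces the projected
  -- coaction by `translateR a`.
  have h1 : convHom q * convPost _ p (adConv a) = translateR 𝓡 a * convHom q := by
    have h := congrArg (convPost _ p) (inclB_mul_adConv a)
    rw [map_mul, map_mul] at h
    rw [ha]
    exact h
  -- `flipR_mul`, with `a` applied to the second leg, exchanges left translation by `R¹` for right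
  -- translation. Cancelling the invertible `q` then gives the claim.
  have h2 : translateR 𝓡 a * convHom q = convHom q * Q := by
    refine WithConv.ofConv_injective (LinearMap.ext fun y => ?_)
    have h := congrArg (a.ofConv.lTensor T) (flipR_mul 𝓡 y)
    refine ((ℛ k y).convMul_apply _ _).trans (Eq.trans ?_ ((ℛ k y).convMul_apply _ _).symm)
    simp only [flipR, Finset.mul_sum, Finset.sum_mul, Algebra.TensorProduct.tmul_mul_tmul,
      map_sum, LinearMap.lTensor_tmul] at h
    refine Eq.trans (Finset.sum_congr rfl fun i _ => ?_)
      (h.trans (Finset.sum_comm.trans (Finset.sum_congr rfl fun i _ => ?_)))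
    · refine (congrArg (fun z => z * q ((ℛ k y).right i))
        (translateR_apply 𝓡 a ((ℛ k y).left i))).trans ?_
      rw [Finset.sum_mul]
      refine Finset.sum_congr rfl fun c _ => ?_
      simp [q]
    · simp [q, Q, LinearMap.sum_apply, Finset.mul_sum]
  have h3 : convPost _ p (adConv a) = Q := by
    rw [← convInv_mul_convHom_assoc q (convPost _ p (adConv a)), h1, h2,
      convInv_mul_convHom_assoc]
  have h4 := congrArg (fun f : WithConv (Bosonization 𝓡 H →ₗ[k] T ⊗[k] K) => f x) h3
  refine h4.trans ?_
  simp [Q, LinearMap.sum_apply]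

end Relative

/-! ### Braided commutativity at the level of functions -/

section Commutative
open Coalgebra WithConv LeftComoduleAlgebra

variable {k : Type u} [Field k] {B : Type u} [Ring B] [HopfAlgebra k B]
  {K : Type u} [Ring K] [Algebra k K] [LeftComoduleAlgebra k B K]

/-- `b(x₁ a₋₁) a₀(x₂) = a(x₁) b(x₂)`. -/
lemma IsCoactLinear.sum_adConv {b : WithConv (B →ₗ[k] K)} (hb : IsCoactLinear b)
    (a : WithConv (B →ₗ[k] K)) (x : B) :
    ∑ i ∈ (ℛ k x).index, LinearMap.mul' k K (b.ofConv.rTensor K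
      (inclB k B K ((ℛ k x).left i) * CentralHopf.adConv a ((ℛ k x).right i))) = (a * b) x := by
  -- Applying `c ⊗ l ↦ b(c) l` to `ι * ad(a) = (δ ∘ a) * ι` leaves `b(a(x₁)₋₁ x₂) a(x₁)₀` on the
  -- right, which condition 1 for `b` evaluates.
  have h := congrArg (fun f : WithConv (B →ₗ[k] B ⊗[k] K) => LinearMap.mul' k K
    (b.ofConv.rTensor K (f x))) (inclB_mul_adConv a)
  simp only [(ℛ k x).convMul_apply, map_sum] at h
  refine h.trans (Eq.trans (Finset.sum_congr rfl fun i _ => ?_)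
    ((ℛ k x).convMul_apply a b).symm)
  refine Eq.trans ?_ (hb ((ℛ k x).right i) (a ((ℛ k x).left i)))
  simp only [coactPair, LinearMap.comp_apply, AlgHom.toLinearMap_apply, convPost_apply]
  induction coact (k := k) (B := B) (a ((ℛ k x).left i)) using TensorProduct.induction_on with
  | zero => simp
  | add y z hy hz => simp only [map_add, add_mul, hy, hz]
  | tmul c l => simp

end Commutative
end CentralHopf

/-! ### The isomorphism, the relative centre and commutativity for `S^T(H, K)` -/

namespace CentralHopf
section FunctionAlgebra
open Coalgebra WithConv LeftComoduleAlgebra FRep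

variable {k : Type u} [Field k] {B : Type u} [Ring B] [HopfAlgebra k B]
  {K : Type u} [Ring K] [Algebra k K] [LeftComoduleAlgebra k B K]

lemma FunctionAlgebra.tensor_ext {X : FRep k B} (D : FunctionAlgebra k B K X) {Y : Type u}
    [AddCommGroup Y] [Module k Y] [Module.Finite k Y] {z z' : Y ⊗[k] X.V}
    (h : ∀ x, (D.j.flip x).lTensor Y z = (D.j.flip x).lTensor Y z') : z = z' :=
  tensor_ext_of_separating (fun x => D.j.flip x) (fun _ _ => D.ext) h

lemma mul'_rTensor_inclB_mul (b : B →ₗ[k] K) (x y : B) (l : K) :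
    LinearMap.mul' k K (b.rTensor K (inclB k B K x * y ⊗ₜ[k] l)) = b (x * y) * l := by
  simp

end FunctionAlgebra

section STStructure
open Coalgebra WithConv LeftComoduleAlgebra Bosonization FRep MonoidalLeftAction

variable {k : Type u} [Field k] {T : Type u} [Ring T] [HopfAlgebra k T] (𝓡 : RMatrix k T)
  {H : Type u} [Ring H] [Algebra k H] [Coalgebra k H] [BraidedHopfAlgebra 𝓡 H]
  {K : Type u} [Ring K] [Algebra k K] [LeftComoduleAlgebra k (Bosonization 𝓡 H) K]
  [Module.Finite k H] [Module.Finite k T] [Module.Finite k K]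

/-- `proj_adConv` at every `x`; right translation by `R¹` is the action of `R¹`. -/
lemma proj_stCoact (α : ST 𝓡 H K) : (proj 𝓡).toLinearMap.rTensor (ST 𝓡 H K) (stCoact 𝓡 H K α) =
    ∑ c ∈ 𝓡.supp, c.2 ⊗ₜ[k] stAct 𝓡 H K (inT 𝓡 c.1) α := by
  refine (stFunctionAlgebra 𝓡 H K).tensor_ext fun x => ?_
  change ((stFun 𝓡 H K).flip x).lTensor _ _ = ((stFun 𝓡 H K).flip x).lTensor _ _
  have h1 := proj_adConv 𝓡 _ (translateR_stFun 𝓡 α) x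
  rw [← lTensor_stCoact] at h1
  rw [map_sum]
  refine Eq.trans ?_ (h1.trans rfl)
  induction stCoact 𝓡 H K α using TensorProduct.induction_on with
  | zero => simp only [map_zero]
  | add y z hy hz => simp only [map_add, hy, hz]
  | tmul b v => rfl

/-- The identity `(α₋₁ · β) α₀ = α β`, by `IsCoactLinear.sum_adConv`: the action of `α₋₁` on `β` is
right translation. -/
lemma sum_stCoact_mul (α β : ST 𝓡 H K) :
    TensorProduct.lift (TensorProduct.curry (stFunctionAlgebra 𝓡 H K).mul ∘ₗ evAt (stAct 𝓡 H K) β)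
      (stCoact 𝓡 H K α) = stMul 𝓡 α β := by
  refine stFun_injective 𝓡 (LinearMap.ext fun x => ?_)
  rw [stFun_stMul]
  refine Eq.trans ?_ ((isCoactLinear_stFun 𝓡 β).sum_adConv (toConv (stFun 𝓡 H K α)) x)
  simp only [← lTensor_stCoact]
  induction stCoact 𝓡 H K α using TensorProduct.induction_on with
  | zero => simp
  | add y z hy hz => simp only [map_add, LinearMap.add_apply, mul_add, hy, hz, Finset.sum_add_distrib]
  | tmul b γ =>
    change stFun 𝓡 H K (stMul 𝓡 (stAct 𝓡 H K b β) γ) x = _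
    rw [stFun_stMul]
    refine ((ℛ k x).convMul_apply _ _).trans (Finset.sum_congr rfl fun i _ => ?_)
    exact (mul'_rTensor_inclB_mul (stFun 𝓡 H K β) ((ℛ k x).left i) b
      (stFun 𝓡 H K γ ((ℛ k x).right i))).symm

namespace STStructure
variable {𝓡} (S : STStructure 𝓡 H K)

/-- Evaluations at the `x ⊗ 1` separate `B ⊗ S^T(H, K)`, so the formula for the coaction leaves no
choice. The same holds for the product and the unit, and what is proved for the constructed
structure applies to every `STStructure`. -/
lemma δ_eq : S.δ = stCoact 𝓡 H K := LinearMap.ext fun α => by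
  refine (stFunctionAlgebra 𝓡 H K).tensor_ext fun x => ?_
  change ((stFun 𝓡 H K).flip x).lTensor _ _ = ((stFun 𝓡 H K).flip x).lTensor _ _
  exact (S.δ_spec α x 1).trans (lTensor_stEval_stCoact 𝓡 α x 1).symm

lemma mul_eq (α β : ST 𝓡 H K) : (MonObj.mul (X := S.obj)).f.hom
    (α ⊗ₜ[k] β : ST 𝓡 H K ⊗[k] ST 𝓡 H K) = stMul 𝓡 α β :=
  stFun_injective 𝓡 (LinearMap.ext fun x =>
    (S.mul_spec α β x 1).trans (stEval_stMul 𝓡 α β x 1).symm)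

lemma one_eq : (MonObj.one (X := S.obj)).f.hom (1 : k) = stOne 𝓡 H K :=
  stFun_injective 𝓡 (LinearMap.ext fun x =>
    (S.one_spec x 1).trans ((stEval_stOne 𝓡 x 1).symm.trans (by rw [one_smul]; rfl)))

lemma hb_apply (X : FRep k (Bosonization 𝓡 H)) (α : ST 𝓡 H K) (y : X.V) :
    (S.hb.β X).hom.hom (α ⊗ₜ[k] y : ST 𝓡 H K ⊗[k] X.V) =
      ((evAt X.ρ y).rTensor (ST 𝓡 H K) (stCoact 𝓡 H K α) : X.V ⊗[k] ST 𝓡 H K) := by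
  rw [← S.δ_eq]; exact S.hb_spec X α y

lemma stHom_halfBraiding (X : FRep k (Bosonization 𝓡 H)) (M : FRep k K) :
    stHom 𝓡 H (X ⊙ₗ M) ▷ X ≫ (hopfInternalHom (Bosonization 𝓡 H)).b X M (X ⊙ₗ M) =
      (S.hb.β X).hom ≫ X ◁ stHom 𝓡 H M ≫ (hopfInternalHom (Bosonization 𝓡 H)).aInv X M M := by
  refine FRep.Hom.ext (TensorProduct.ext' fun α y => ?_)
  refine ((stFunctionAlgebra 𝓡 H K).toHom_halfBraiding (isCoactLinear_stFun 𝓡) X M α y).trans ?_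
  exact congrArg (fun z => ((hopfInternalHom (Bosonization 𝓡 H)).aInv X M M).hom
    (((stFunctionAlgebra 𝓡 H K).toHomK (isCoactLinear_stFun 𝓡) M).lTensor X.V z))
    (S.hb_apply X α y).symm

lemma stHom_mul (M : FRep k K) : (MonObj.mul (X := S.obj)).f ≫ stHom 𝓡 H M =
    (stHom 𝓡 H M ⊗ₘ stHom 𝓡 H M) ≫ (hopfInternalHom (Bosonization 𝓡 H)).comp M M M := by
  refine FRep.Hom.ext (TensorProduct.ext' fun α β => ?_)
  refine (congrArg ((stFunctionAlgebra 𝓡 H K).toHomK (isCoactLinear_stFun 𝓡) M)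
    (S.mul_eq α β)).trans ?_
  exact (stFunctionAlgebra 𝓡 H K).toHom_mul (isCoactLinear_stFun 𝓡) M α β

lemma stHom_one (M : FRep k K) : (MonObj.one (X := S.obj)).f ≫ stHom 𝓡 H M =
    (hopfInternalHom (Bosonization 𝓡 H)).coev (𝟙_ (FRep k (Bosonization 𝓡 H))) M ≫
      ((hopfInternalHom (Bosonization 𝓡 H)).hom M).map (λₗ M).hom := by
  refine FRep.Hom.ext (LinearMap.ext_ring ?_)
  refine (congrArg ((stFunctionAlgebra 𝓡 H K).toHomK (isCoactLinear_stFun 𝓡) M) S.one_eq).trans ?_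
  exact (stFunctionAlgebra 𝓡 H K).toHom_one (isCoactLinear_stFun 𝓡) M

/-- `S^T(H, K)` is the adjoint algebra. -/
noncomputable def adjointAlgebra :
    AdjointAlgebra (toCenter 𝓡 H) (hopfInternalHom (K := K) (Bosonization 𝓡 H)) where
  A := S.obj
  π := stHom 𝓡 H
  isRelativeEnd := stHom_isRelativeEnd 𝓡 H K
  halfBraiding := S.stHom_halfBraiding
  mul := S.stHom_mul
  one := S.stHom_one

/-- The regular module alone detects morphisms into `X ⊗ S^T(H, K)`: by `sum_antipode_aInv` their
images under `aInv` determine all evaluations at `x ⊗ 1`, and these separate points. -/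
lemma nonempty_iso (A : AdjointAlgebra (toCenter 𝓡 H)
    (hopfInternalHom (K := K) (Bosonization 𝓡 H))) : Nonempty (Mon.mk A.A ≅ Mon.mk S.obj) := by
  refine A.nonempty_iso S.adjointAlgebra fun {X Y} f g h => FRep.Hom.ext (LinearMap.ext fun y => ?_)
  let p : ST 𝓡 H K →ₗ[k] homK (Bosonization 𝓡 H) (regRep k K) (regRep k K) :=
    (stFunctionAlgebra 𝓡 H K).toHomK (isCoactLinear_stFun 𝓡) (regRep k K)
  let f' : Y.V →ₗ[k] X.V ⊗[k] ST 𝓡 H K := f.hom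
  let g' : Y.V →ₗ[k] X.V ⊗[k] ST 𝓡 H K := g.hom
  have h1 : ((hopfInternalHom (Bosonization 𝓡 H)).aInv X (regRep k K) (regRep k K)).hom
      (p.lTensor X.V (f' y)) = ((hopfInternalHom (Bosonization 𝓡 H)).aInv X (regRep k K)
        (regRep k K)).hom (p.lTensor X.V (g' y)) :=
    congrArg (fun f => FRep.Hom.hom f y) (h (regRep k K))
  refine (stFunctionAlgebra 𝓡 H K).tensor_ext (z := f' y) (z' := g' y) fun x => ?_
  change ((stFun 𝓡 H K).flip x).lTensor _ _ = ((stFun 𝓡 H K).flip x).lTensor _ _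
  have h2 : ∀ z : X.V ⊗[k] ST 𝓡 H K, ((stFun 𝓡 H K).flip x).lTensor X.V z =
      (LinearMap.applyₗ (x ⊗ₜ[k] (1 : K)) ∘ₗ (homK (Bosonization 𝓡 H) (regRep k K)
        (regRep k K)).subtype).lTensor X.V (p.lTensor X.V z) := by
    intro z
    induction z using TensorProduct.induction_on with
    | zero => simp only [map_zero]
    | add y z hy hz => simp only [map_add, hy, hz]
    | tmul v α => exact congrArg (fun κ => v ⊗ₜ[k] κ) (mul_one (stFun 𝓡 H K α x)).symm
  rw [h2, h2]
  refine (sum_antipode_aInv X (p.lTensor X.V (f' y)) x (1 : K)).symm.trans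
    (Eq.trans ?_ (sum_antipode_aInv X (p.lTensor X.V (g' y)) x (1 : K)))
  rw [h1]

/-- The element `α₋₁` acts on `V_π` through `π`, so `proj_stCoact` identifies the half-braiding at
`V_π` with `hbIso`. The half-braiding of `G(V)` is by definition the inverse of `hbIso`, and the
double braiding cancels. -/
lemma relativeCenter_obj : relativeCenter (toCenter 𝓡 H) S.obj := by
  intro V
  refine Center.ext _ _ ?_
  have h1 : (S.hb.β (pull 𝓡 V)).hom = (hbIso 𝓡 V (STRep 𝓡 H K)).hom := by
    refine FRep.Hom.ext (TensorProduct.ext' fun α v => ?_)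
    refine (S.hb_apply (pull 𝓡 V) α v).trans (Eq.trans ?_ (hbIso_tmul 𝓡 V (STRep 𝓡 H K) α v).symm)
    have h2 := congrArg ((evAt V.ρ v).rTensor (ST 𝓡 H K)) (proj_stCoact 𝓡 α)
    rw [map_sum] at h2
    refine Eq.trans ?_ h2
    induction stCoact 𝓡 H K α using TensorProduct.induction_on with
    | zero => simp only [map_zero]
    | add y z hy hz => simp only [map_add, hy, hz]
    | tmul b v => rfl
  change (hbIso 𝓡 V (STRep 𝓡 H K)).inv ≫ (S.hb.β (pull 𝓡 V)).hom = 𝟙 _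
  rw [h1]
  exact Iso.inv_hom_id _

lemma braiding_mul : (β_ S.obj S.obj).hom ≫ MonObj.mul (X := S.obj) = MonObj.mul (X := S.obj) := by
  refine Center.ext _ _ (FRep.Hom.ext (TensorProduct.ext' fun α β => ?_))
  let m : ST 𝓡 H K ⊗[k] ST 𝓡 H K →ₗ[k] ST 𝓡 H K := (MonObj.mul (X := S.obj)).f.hom
  have hm : m = (stFunctionAlgebra 𝓡 H K).mul := TensorProduct.ext' S.mul_eq
  change m ((S.hb.β (STRep 𝓡 H K)).hom.hom (α ⊗ₜ[k] β : ST 𝓡 H K ⊗[k] ST 𝓡 H K)) =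
    m (α ⊗ₜ[k] β)
  refine (congrArg m (S.hb_apply (STRep 𝓡 H K) α β)).trans ?_
  rw [hm]
  refine Eq.trans ?_ (sum_stCoact_mul 𝓡 α β)
  induction stCoact 𝓡 H K α using TensorProduct.induction_on with
  | zero => simp only [map_zero]
  | add y z hy hz => simp only [map_add, hy, hz]
  | tmul b v => rfl

lemma isRelativelyCommutative : IsRelativelyCommutative (toCenter 𝓡 H) S.obj := by
  refine ⟨S.relativeCenter_obj, ?_⟩
  let := relativeMonObj (toCenter 𝓡 H) S.obj S.relativeCenter_obj
  refine ⟨(relativeCenter (toCenter 𝓡 H)).fullyFaithfulι.map_injective ?_⟩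
  -- The product in the full subcategory is the one in the centre up to composition with an
  -- identity, so commutativity can be checked in the centre.
  have h : (relativeCenter (toCenter 𝓡 H)).ι.map (MonObj.mul
      (X := (⟨S.obj, S.relativeCenter_obj⟩ : (relativeCenter (toCenter 𝓡 H)).FullSubcategory))) =
      MonObj.mul (X := S.obj) := Category.id_comp (MonObj.mul (X := S.obj))
  rw [Functor.map_comp, h]
  exact S.braiding_mul

end STStructure
end STStructure
end CentralHopf

theorem mainTheorem7 {k : Type u} [Field k] [IsAlgClosed k]
    {T : Type u} [Ring T] [HopfAlgebra k T] [Module.Finite k T] (𝓡 : CentralHopf.RMatrix k T)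
    {H : Type u} [Ring H] [Algebra k H] [Coalgebra k H] [CentralHopf.BraidedHopfAlgebra 𝓡 H]
    [Module.Finite k H]
    {K : Type u} [Ring K] [Algebra k K] [Module.Finite k K]
    [CentralHopf.LeftComoduleAlgebra k (CentralHopf.Bosonization 𝓡 H) K]
    (hK : CentralHopf.IsRightSimple k (CentralHopf.Bosonization 𝓡 H) K) :
    (Nonempty (CentralHopf.STStructure 𝓡 H K) ∧
      Nonempty (CentralHopf.AdjointAlgebra (CentralHopf.toCenter 𝓡 H)
        (CentralHopf.FRep.hopfInternalHom (K := K) (CentralHopf.Bosonization 𝓡 H)))) ∧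
    (∀ (S : CentralHopf.STStructure 𝓡 H K)
      (A : CentralHopf.AdjointAlgebra (CentralHopf.toCenter 𝓡 H)
        (CentralHopf.FRep.hopfInternalHom (K := K) (CentralHopf.Bosonization 𝓡 H))),
      Nonempty (Mon.mk A.A ≅ Mon.mk S.obj)) ∧
    (∀ S : CentralHopf.STStructure 𝓡 H K,
      CentralHopf.IsRelativelyCommutative (CentralHopf.toCenter 𝓡 H) S.obj) := by
  exact ⟨⟨⟨CentralHopf.stStructure 𝓡 H K⟩, ⟨(CentralHopf.stStructure 𝓡 H K).adjointAlgebra⟩⟩,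
    fun S A => S.nonempty_iso A, fun S => S.isRelativelyCommutative⟩
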